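/- Let $y,y',z\in\mathbb{C}$ and consider the perturbed cubic oscillator $$\psi''(\lambda)=Q(\lambda)\,\psi(\lambda),\qquad Q(\lambda)=4\lambda^3-2\lambda z+2zy-4y^3+y'^2+\frac{y'}{\lambda-y}+\frac{3}{4(\lambda-y)^2}.$$ All its solutions change sign around the singularity $\lambda=y$. For $k\in\mathbb{Z}_5=\mathbb{Z}/5\mathbb{Z}$ let $S_k=\{\lambda\neq 0:\ |\arg\lambda-\tfrac{2\pi k}{5}|<\tfrac{\pi}{5}\}$ (arguments taken modulo $2\pi$) be the $k$-th Stokes sector. *Stokes multipliers.* Fix $k\in\mathbb{Z}_5$. Let $D$ be a cut plane, that is, a simply connected domain with $y\notin D$ which, for every $\delta>0$, contains all $\lambda$ of sufficiently large modulus with $|\arg\lambda-\frac{2\pi k}{5}|<\pi-\delta$; and fix a branch of $\lambda^{1/4}$ on $\{\lambda\ne0:\ |\arg\lambda-\frac{2\pi k}{5}|<\pi\}$, with $\lambda^{-3/4}=(\lambda^{1/4})^{-3}$. For $j\in\{k-1,k,k+1\}$ the $j$-th subdominant solution $\psi_j$ is the solution of the equation on $D$ such that, for every $\varepsilon>0$,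 $$\frac{\psi_j(\lambda)}{\lambda^{-3/4}\exp\left(-\frac45\lambda^{5/2}+z\lambda^{1/2}\right)}\longrightarrow 1\qquad\Big(\lambda\to\infty,\ \big|\arg\lambda-\tfrac{2\pi j}{5}\big|<\tfrac{3\pi}{5}-\varepsilon\Big),$$ where the branch of $\lambda^{1/2}$ (and $\lambda^{5/2}=(\lambda^{1/2})^5$) is the one with $\mathrm{Re}\,\lambda^{5/2}\to+\infty$ along the ray $\arg\lambda=\frac{2\pi j}{5}$. The $k$-th Stokes multiplier is the number $\sigma_k\in\mathbb{C}$ with $$\psi_{k-1}=\psi_{k+1}+\sigma_k\psi_k\quad\text{on } D.$$ *Theorem.* Let $f$ be any non-constant meromorphic function on $\mathbb{C}$ which solves the Schwarzian equation $$\{f,\lambda\}=\frac{f'''}{f'}-\frac32\Big(\frac{f''}{f'}\Big)^2=-2Q(\lambda).$$ Then for every $k\in\mathbb{Z}_5$ the limit $$w_k(f)=\lim_{\lambda\to\infty,\ \lambda\in S_k}f(\lambda)\in\mathbb{C}\cup\{\infty\},$$ taken non-tangentially to the boundary of $S_k$ (that is, in $|\arg\lambda-\frac{2\pi k}{5}|<\frac{\pi}{5}-\delta$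 for each $\delta>0$), exists, and $w_k(f)\neq w_{k+1}(f)$. For every $k\in\mathbb{Z}_5$ and every choice of the cut plane and of the branch of $\lambda^{1/4}$, the Stokes multiplier $\sigma_k$ exists and is unique, and it equals $$\sigma_k=i\,\big(w_{k+1}(f),\,w_{k-2}(f);\,w_{k-1}(f),\,w_{k+2}(f)\big),$$ where $(a,b;c,d)=\frac{(a-c)(b-d)}{(a-d)(b-c)}$ is the cross ratio of four points of the Riemann sphere (a finite number here, because $w_{k+1}\ne w_{k+2}$ and $w_{k-2}\ne w_{k-1}$). -/

import Mathlib

open Filter Topology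

noncomputable section

namespace CubicOscillator

/-! ### The perturbed cubic oscillator `ψ'' = Q ψ` -/

/-- The potential `Q(x; y, y', z)` of the perturbed cubic oscillator (used for `x ≠ y` only). -/
def Q (y y' z x : ℂ) : ℂ :=
  4 * x ^ 3 - 2 * x * z + 2 * z * y - 4 * y ^ 3 + y' ^ 2 + y' / (x - y) + 3 / (4 * (x - y) ^ 2)

/-- `ψ` is a holomorphic solution of `ψ'' = Q ψ` on the open set `D`. -/
def IsSolutionOn (y y' z : ℂ) (D : Set ℂ) (ψ : ℂ → ℂ) : Prop :=
  DifferentiableOn ℂ ψ D ∧ ∀ x ∈ D, deriv (deriv ψ) x = Q y y' z x * ψ x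

/-! ### Sectors, cuts and branches of roots -/

/-- The unit vector `exp (2πik/5)` on the central direction of the `k`-th Stokes sector. -/
def direction (k : ZMod 5) : ℂ :=
  Complex.exp (2 * Real.pi * Complex.I * k.val / 5)

/-- The sector `|arg x - 2πk/5| < θ` (argument modulo `2π`), without the origin. The `k`-th Stokes
sector is `sector k (π / 5)`. -/
def sector (k : ZMod 5) (θ : ℝ) : Set ℂ :=
  {x | x ≠ 0 ∧ |Complex.arg (x / direction k)| < θ}

/-- `D` is the plane cut from `y` to infinity, the cut going away in the direction opposite to the
`k`-th Stokes sector: `D` is a simply connected domain that omits the singularity `y`, and near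
infinity it contains every sector `|arg x - 2πk/5| < π - δ` with `δ > 0`. On such a domain the
solutions of the equation, which change sign around `y`, are single-valued. -/
structure IsCutPlane (y : ℂ) (k : ZMod 5) (D : Set ℂ) : Prop where
  isOpen : IsOpen D
  isSimplyConnected : IsSimplyConnected D
  notMem : y ∉ D
  eventually_mem : ∀ δ : ℝ, 0 < δ →
    ∀ᶠ x in Bornology.cobounded ℂ, x ∈ sector k (Real.pi - δ) → x ∈ D

/-- `q` is a branch of `x ^ (1/4)` on the plane cut along the ray opposite to the `k`-th Stokes
sector. -/
structure IsFourthRootBranch (k : ZMod 5) (q : ℂ → ℂ) : Prop where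
  continuousOn : ContinuousOn q (sector k Real.pi)
  pow_eq : ∀ x ∈ sector k Real.pi, q x ^ 4 = x

/-- `r` is the branch of `x ^ (1/2)` on the sector `|arg x - 2πk/5| < 3π/5` for which
`Re x ^ (5/2) → +∞` as `x → ∞` along the ray `arg x = 2πk/5`. -/
structure IsSqrtBranch (k : ZMod 5) (r : ℂ → ℂ) : Prop where
  continuousOn : ContinuousOn r (sector k (3 * Real.pi / 5))
  sq_eq : ∀ x ∈ sector k (3 * Real.pi / 5), r x ^ 2 = x
  tendsto_re : Tendsto (fun t : ℝ => (r (t * direction k) ^ 5).re) atTop atTop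

/-! ### Subdominant solutions and Stokes multipliers -/

/-- `ψ` is the `k`-th subdominant solution on the domain `D`, normalised with the branch `q` of
`x ^ (1/4)`: as `x → ∞` in `|arg x - 2πk/5| < 3π/5 - ε`, for each `ε > 0`,
`ψ x ∼ x ^ (-3/4) * exp (-(4/5) x ^ (5/2) + z x ^ (1/2))`. -/
def IsSubdominant (y y' z : ℂ) (D : Set ℂ) (q : ℂ → ℂ) (k : ZMod 5) (ψ : ℂ → ℂ) : Prop :=
  IsSolutionOn y y' z D ψ ∧
  ∃ r : ℂ → ℂ, IsSqrtBranch k r ∧ ∀ ε : ℝ, 0 < ε →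
    Tendsto (fun x => ψ x / ((q x ^ 3)⁻¹ * Complex.exp (-(4 / 5) * r x ^ 5 + z * r x)))
      (Bornology.cobounded ℂ ⊓ 𝓟 (sector k (3 * Real.pi / 5 - ε))) (𝓝 1)

/-- `σ` is the `k`-th Stokes multiplier: `ψ_{k-1} = ψ_{k+1} + σ ψ_k`, where the three subdominant
solutions live on the same cut plane and are normalised with the same branch of `x ^ (1/4)`. -/
def IsStokesMultiplier (y y' z : ℂ) (D : Set ℂ) (q : ℂ → ℂ) (k : ZMod 5) (σ : ℂ) : Prop :=
  ∃ ψm ψ ψp : ℂ → ℂ,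
    IsSubdominant y y' z D q (k - 1) ψm ∧ IsSubdominant y y' z D q k ψ ∧
    IsSubdominant y y' z D q (k + 1) ψp ∧ ∀ x ∈ D, ψm x = ψp x + σ * ψ x

/-! ### The Schwarzian equation and asymptotic values -/

/-- The Schwarzian derivative `{f, x} = f'''/f' - (3/2) (f''/f')²`. -/
def schwarzian (f : ℂ → ℂ) (x : ℂ) : ℂ :=
  deriv (deriv (deriv f)) x / deriv f x - 3 / 2 * (deriv (deriv f) x / deriv f x) ^ 2

/-- `f` is a non-constant meromorphic function on `ℂ` with `{f, x} = -2 Q`. As usual for meromorphic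
functions, identities are meant up to a closed discrete set of points. -/
structure IsSchwarzianSolution (y y' z : ℂ) (f : ℂ → ℂ) : Prop where
  meromorphic : Meromorphic f
  nonconstant : ¬ ∃ c : ℂ, f =ᶠ[codiscrete ℂ] fun _ => c
  eq : schwarzian f =ᶠ[codiscrete ℂ] fun x => -2 * Q y y' z x

open Classical in
/-- The value at `x` of a meromorphic function, as a point of the Riemann sphere. It does not depend
on the number that the Lean function takes at poles and removable singularities. -/
def sphereValue (f : ℂ → ℂ) (x : ℂ) : OnePoint ℂ :=
  if meromorphicOrderAt f x < 0 then OnePoint.infty else ((limUnder (𝓝[≠] x) f : ℂ) : OnePoint ℂ)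

/-- `w` is the `k`-th asymptotic value of the meromorphic function `f`: its limit, on the Riemann
sphere, as `x → ∞` in the `k`-th Stokes sector without being tangential to its boundary. -/
def IsAsymptoticValue (f : ℂ → ℂ) (k : ZMod 5) (w : OnePoint ℂ) : Prop :=
  ∀ δ : ℝ, 0 < δ →
    Tendsto (sphereValue f) (Bornology.cobounded ℂ ⊓ 𝓟 (sector k (Real.pi / 5 - δ))) (𝓝 w)

/-! ### Cross ratio on the Riemann sphere -/

/-- The difference of two points of the sphere, computed as the determinant of the homogeneous
coordinates `(a, 1)` of `a ∈ ℂ` and `(1, 0)` of `∞`. -/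
def bracket (a b : OnePoint ℂ) : ℂ :=
  let u : OnePoint ℂ → ℂ × ℂ := fun p => p.elim (1, 0) fun c => (c, 1)
  (u a).1 * (u b).2 - (u b).1 * (u a).2

/-- The cross ratio `(a, b; c, d) = (a - c) (b - d) / ((a - d) (b - c))` on the Riemann sphere,
a finite number when `a ≠ d` and `b ≠ c`. -/
def crossRatio (a b c d : OnePoint ℂ) : ℂ :=
  bracket a c * bracket b d / (bracket a d * bracket b c)

end CubicOscillator

end

/-!
Solutions of `ψ'' = Q ψ` change sign around `y`, so `h = (x - y) ^ (1/2) ψ` is single-valued. It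
solves `(x - y) h'' = h' + G h` with a polynomial `G`; the exponents at `y` are `0` and `2`, and the
particular form of `Q` makes the singularity apparent. Hence all its solutions are entire
(`exists_isEntireSol`), they form a plane, and the Wronskian of two of them is
`omega y g h * (x - y)` with a constant symplectic form `omega` (`IsEntireSol.wronskian`).
Everything is done with these entire functions, and the cut plane enters only at the end.

Asymptotics are studied in the variable `l = log x`, which unfolds the sectors. After
multiplication by `x ^ (1/4)`, an entire solution is split into its components along `exp (-S)` and
`exp S`, where `S = ± ((4/5) x ^ (5/2) - z x ^ (1/2))`. The two amplitudes solve a first order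
system with an integrable error (`exists_isAmplitude`), and in the variable `x ^ (5/2)` straight segments
towards the positive reals are paths along which `Re S` grows. A Gronwall estimate along them
(`amplitude_cone_estimate`) yields a solution recessive along the central ray of each sector, and
spreads its asymptotics to the sector of half-width `3π/5` (`exists_isRecessive`). Numbering the
sectors by integers gives subdominant entire solutions `h_n`, unique by their asymptotics.

Comparing leading terms in the `n`-th sector, `h_{n-1} = h_{n+1} + σ_n h_n`
(`subdom_relation`). Going once around infinity, uniqueness gives `h_{n+5} = -i h_n`
(`subdom_add_five`). Moreover `omega (h_n, h_{n+1})` is an alternating non-zero sequence, so that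
the cross ratio formed with `omega` of `h_{n+1}, h_{n-2}, h_{n-1}, h_{n+2}` equals `-i σ_n`
(`stokes_eq`).

A solution `f` of the Schwarzian equation is a quotient `g / h` of two independent entire solutions,
namely `h = ((x - y) / f') ^ (1/2)` and `g = f h` near a regular point
(`IsSchwarzianSolution.exists_quotient`). In the `n`-th sector every solution `k` is asymptotic to
`omega (k, h_n)` times a dominant solution, so the `n`-th asymptotic value of `f` has homogeneous
coordinates `(omega (g, h_n), omega (h, h_n))` (`isAsymptoticValue_asymValue`). As `omega` is the
area form of the plane of solutions, the cross ratio of these points is the one computed with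
`omega` (`stokes_eq_crossRatio`).

On a cut plane with a given branch of `x ^ (1/4)`, the subdominant solutions near the `n`-th sector
are one common multiple of `h_{n-1}, h_n, h_{n+1}` (`IsCutPlane.exists_isSubdominant_iff`), and the
Stokes multiplier is that of the entire solutions (`IsCutPlane.isStokesMultiplier_iff`).
-/

noncomputable section

namespace CubicOscillator

/-! ### Entire solutions as power series -/

/-- The coefficients `a` decay faster than every geometric sequence, so that `∑ aₙ tⁿ` is entire. -/
def IsEntireCoeff (a : ℕ → ℂ) : Prop := ∀ ε : ℝ, 0 < ε → ∃ C : ℝ, ∀ n, ‖a n‖ ≤ C * ε ^ n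

/-- The sum `∑ aₙ tⁿ`. -/
def seriesSum (a : ℕ → ℂ) (t : ℂ) : ℂ := ∑' n, a n * t ^ n

/-- The coefficients of the derivative of `∑ aₙ tⁿ`. -/
def derivCoeff (a : ℕ → ℂ) (n : ℕ) : ℂ := (n + 1) * a (n + 1)

/-- The coefficients of `t ∑ aₙ tⁿ`. -/
def shiftCoeff (a : ℕ → ℂ) : ℕ → ℂ
  | 0 => 0
  | n + 1 => a n

theorem IsEntireCoeff.summable_norm {a : ℕ → ℂ} (ha : IsEntireCoeff a) {ρ : ℝ} (hρ : 0 < ρ) :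
    Summable fun n => ‖a n‖ * ρ ^ n := by
  obtain ⟨C, hC⟩ := ha (ρ⁻¹ / 2) (by positivity)
  refine Summable.of_nonneg_of_le (fun n => by positivity) (fun n => ?_)
    ((summable_geometric_two).mul_left C)
  calc ‖a n‖ * ρ ^ n ≤ C * (ρ⁻¹ / 2) ^ n * ρ ^ n := by gcongr; exact hC n
    _ = C * (1 / 2) ^ n := by
      rw [mul_assoc, ← mul_pow]; congr 2; field_simp

theorem IsEntireCoeff.summable {a : ℕ → ℂ} (ha : IsEntireCoeff a) (t : ℂ) :
    Summable fun n => a n * t ^ n := by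
  refine Summable.of_norm_bounded (ha.summable_norm (ρ := ‖t‖ + 1) (by positivity)) fun n => ?_
  rw [norm_mul, norm_pow]
  gcongr
  linarith

theorem IsEntireCoeff.derivCoeff {a : ℕ → ℂ} (ha : IsEntireCoeff a) :
    IsEntireCoeff (derivCoeff a) := by
  intro ε hε
  obtain ⟨C, hC⟩ := ha (ε / 2) (by positivity)
  refine ⟨C * ε, fun n => ?_⟩
  have h2 : ((n : ℝ) + 1) ≤ 2 ^ (n + 1) := by
    have := (Nat.lt_two_pow_self (n := n + 1)).le
    exact_mod_cast this
  have h0 : 0 ≤ C * (ε / 2) ^ (n + 1) := (norm_nonneg _).trans (hC (n + 1))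
  calc ‖CubicOscillator.derivCoeff a n‖ = ((n : ℝ) + 1) * ‖a (n + 1)‖ := by
        rw [CubicOscillator.derivCoeff, norm_mul]; congr 1
        exact_mod_cast Complex.norm_natCast (n + 1)
    _ ≤ 2 ^ (n + 1) * (C * (ε / 2) ^ (n + 1)) := by gcongr; exact hC _
    _ = C * ε * ε ^ n := by
      rw [mul_left_comm, ← mul_pow, mul_div_cancel₀ _ two_ne_zero]; ring

theorem IsEntireCoeff.shiftCoeff {a : ℕ → ℂ} (ha : IsEntireCoeff a) :
    IsEntireCoeff (shiftCoeff a) := by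
  intro ε hε
  obtain ⟨C, hC⟩ := ha ε hε
  have h0 : 0 ≤ C := by simpa using (norm_nonneg _).trans (hC 0)
  refine ⟨C / ε, fun n => ?_⟩
  cases n with
  | zero => simp only [CubicOscillator.shiftCoeff, norm_zero]; positivity
  | succ n =>
    refine (hC n).trans (le_of_eq ?_)
    rw [pow_succ]; field_simp

theorem hasDerivAt_seriesSum {a : ℕ → ℂ} (ha : IsEntireCoeff a) (t : ℂ) :
    HasDerivAt (seriesSum a) (seriesSum (derivCoeff a) t) t := by
  set ρ := ‖t‖ + 1 with hρ
  have hρ0 : 0 < ρ := by positivity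
  have hu : Summable fun n : ℕ => ‖a n‖ * (n * ρ ^ (n - 1)) := by
    rw [← summable_nat_add_iff 1]
    refine (ha.derivCoeff.summable_norm hρ0).congr fun n => ?_
    rw [derivCoeff, norm_mul]
    have : ‖((n : ℂ) + 1)‖ = n + 1 := by exact_mod_cast Complex.norm_natCast (n + 1)
    rw [this, Nat.add_sub_cancel]; push_cast; ring
  have key := hasDerivAt_tsum_of_isPreconnected (t := Metric.ball (0 : ℂ) ρ) hu Metric.isOpen_ball
    (convex_ball _ _).isPreconnected (g := fun n x => a n * x ^ n)
    (g' := fun n x => a n * (n * x ^ (n - 1))) (y₀ := 0) (y := t)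
    (fun n x _ => (hasDerivAt_pow n x).const_mul (a n))
    (fun n x hx => by
      rw [norm_mul, norm_mul, norm_pow, Complex.norm_natCast]
      have : ‖x‖ ≤ ρ := by simpa using (Metric.mem_ball.1 hx).le
      gcongr)
    (Metric.mem_ball_self hρ0) (ha.summable 0) (by simp [hρ])
  have hs : Summable fun n : ℕ => a n * (n * t ^ (n - 1)) := by
    refine Summable.of_norm_bounded hu fun n => ?_
    rw [norm_mul, norm_mul, norm_pow, Complex.norm_natCast]
    gcongr
    linarith
  have e : ∑' n : ℕ, a n * (n * t ^ (n - 1)) = seriesSum (derivCoeff a) t := by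
    rw [hs.tsum_eq_zero_add, seriesSum]
    simp only [Nat.cast_zero, zero_mul, mul_zero, zero_add, Nat.add_sub_cancel]
    refine tsum_congr fun n => ?_
    rw [derivCoeff]; push_cast; ring
  rw [e] at key
  exact key

theorem seriesSum_shiftCoeff {a : ℕ → ℂ} (ha : IsEntireCoeff a) (t : ℂ) :
    seriesSum (shiftCoeff a) t = t * seriesSum a t := by
  rw [seriesSum, (ha.shiftCoeff.summable t).tsum_eq_zero_add, seriesSum, ← tsum_mul_left]
  simp only [shiftCoeff, zero_mul, zero_add]
  exact tsum_congr fun n => by ring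

theorem seriesSum_zero (a : ℕ → ℂ) : seriesSum a 0 = a 0 := by
  rw [seriesSum, tsum_eq_single 0 (fun n hn => by simp [hn])]; simp

/-- A sequence satisfying a five-term recursion whose coefficients tend to zero decays faster than
every geometric sequence. -/
theorem isEntireCoeff_of_recursion {a : ℕ → ℂ} {M : ℝ} (hM : 0 ≤ M)
    (h : ∀ n, ‖a (n + 5)‖ ≤ M / (n + 1) *
      (‖a (n + 4)‖ + ‖a (n + 3)‖ + ‖a (n + 2)‖ + ‖a (n + 1)‖ + ‖a n‖)) :
    IsEntireCoeff a := by
  -- it suffices to treat small `ε`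
  suffices H : ∀ ε : ℝ, 0 < ε → ε ≤ 1 → ∃ C : ℝ, ∀ n, ‖a n‖ ≤ C * ε ^ n by
    intro ε hε
    obtain ⟨C, hC⟩ := H (min ε 1) (by positivity) (min_le_right _ _)
    have h0 : 0 ≤ C := by simpa using (norm_nonneg _).trans (hC 0)
    refine ⟨C, fun n => (hC n).trans ?_⟩
    gcongr
    exact min_le_left _ _
  intro ε hε hε1
  obtain ⟨N, hN⟩ := exists_nat_gt (5 * M / ε ^ 5)
  set C := ∑ n ∈ Finset.range (N + 5), ‖a n‖ / ε ^ n with hC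
  have hC0 : 0 ≤ C := Finset.sum_nonneg fun n _ => by positivity
  refine ⟨C, fun n => ?_⟩
  induction n using Nat.strong_induction_on with
  | _ n ih =>
    rcases lt_or_ge n (N + 5) with hn | hn
    · have := Finset.single_le_sum (f := fun n => ‖a n‖ / ε ^ n) (fun n _ => by positivity)
        (Finset.mem_range.2 hn)
      rwa [div_le_iff₀ (by positivity)] at this
    · obtain ⟨m, rfl⟩ := Nat.exists_eq_add_of_le' (show 5 ≤ n by omega)
      have hle : ∀ j, j < 5 → ‖a (m + j)‖ ≤ C * ε ^ m := fun j hj => by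
        refine (ih (m + j) (by omega)).trans ?_
        rw [pow_add]
        have : ε ^ j ≤ 1 := pow_le_one₀ hε.le hε1
        have h1 : 0 ≤ C * ε ^ m := by positivity
        nlinarith
      have h4 := hle 4 (by norm_num)
      have h3 := hle 3 (by norm_num)
      have h2 := hle 2 (by norm_num)
      have h1 := hle 1 (by norm_num)
      have h0 := hle 0 (by norm_num)
      rw [add_zero] at h0
      have hm : 5 * M ≤ ε ^ 5 * (m + 1) := by
        rw [div_lt_iff₀ (by positivity)] at hN
        have : (N : ℝ) ≤ m := by exact_mod_cast (by omega : N ≤ m)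
        nlinarith [pow_pos hε 5]
      calc ‖a (m + 5)‖ ≤ M / (m + 1) * (5 * (C * ε ^ m)) :=
            (h m).trans (by gcongr; linarith)
        _ = 5 * M / (m + 1) * (C * ε ^ m) := by ring
        _ ≤ ε ^ 5 * (C * ε ^ m) := by
            gcongr
            rwa [div_le_iff₀ (by positivity)]
        _ = C * ε ^ (m + 5) := by ring

/-- The polynomial `G` for which `ψ = (x - y) ^ (-1/2) h` turns `ψ'' = Q ψ` into
`(x - y) h'' = h' + G h`. -/
def G (y y' z x : ℂ) : ℂ :=
  y' + (x - y) * (4 * x ^ 3 - 2 * x * z + 2 * z * y - 4 * y ^ 3 + y' ^ 2)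

/-- `h` is an entire solution of `(x - y) h'' = h' + G h`; equivalently `(x - y) ^ (-1/2) h` solves
`ψ'' = Q ψ` away from `y`. -/
structure IsEntireSol (y y' z : ℂ) (h : ℂ → ℂ) : Prop where
  differentiable : Differentiable ℂ h
  eq : ∀ x, (x - y) * deriv (deriv h) x = deriv h x + G y y' z x * h x

/-- The Taylor coefficients at `y` of the entire solution with `h y = α` and `h'' y = 2 β`. The
exponents at the singularity are `0` and `2`, and the coefficient of `(x - y) ^ 2` is free because
the singularity is apparent. -/
def solCoeff (y y' z α β : ℂ) : ℕ → ℂ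
  | 0 => α
  | 1 => -y' * α
  | 2 => β
  | 3 => (y' * β + y' ^ 2 * (-y' * α) + (12 * y ^ 2 - 2 * z) * α) / 3
  | 4 => (y' * solCoeff y y' z α β 3 + y' ^ 2 * β + (12 * y ^ 2 - 2 * z) * (-y' * α)
      + 12 * y * α) / 8
  | n + 5 => (y' * solCoeff y y' z α β (n + 4) + y' ^ 2 * solCoeff y y' z α β (n + 3)
      + (12 * y ^ 2 - 2 * z) * solCoeff y y' z α β (n + 2)
      + 12 * y * solCoeff y y' z α β (n + 1) + 4 * solCoeff y y' z α β n) / ((n + 5) * (n + 3))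

theorem isEntireCoeff_solCoeff (y y' z α β : ℂ) : IsEntireCoeff (solCoeff y y' z α β) := by
  set M := ‖y'‖ + ‖y' ^ 2‖ + ‖12 * y ^ 2 - 2 * z‖ + ‖12 * y‖ + 4 with hM
  refine isEntireCoeff_of_recursion (M := M) (by positivity) fun n => ?_
  set a := solCoeff y y' z α β
  have e : a (n + 5) = (y' * a (n + 4) + y' ^ 2 * a (n + 3) + (12 * y ^ 2 - 2 * z) * a (n + 2)
      + 12 * y * a (n + 1) + 4 * a n) / ((n + 5) * (n + 3)) := by
    simp only [a]; rw [solCoeff]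
  have hd : ‖((n : ℂ) + 5) * (n + 3)‖ = ((n : ℝ) + 5) * (n + 3) := by
    exact_mod_cast Complex.norm_natCast ((n + 5) * (n + 3))
  have hnum : ‖y' * a (n + 4) + y' ^ 2 * a (n + 3) + (12 * y ^ 2 - 2 * z) * a (n + 2)
      + 12 * y * a (n + 1) + 4 * a n‖ ≤
      M * (‖a (n + 4)‖ + ‖a (n + 3)‖ + ‖a (n + 2)‖ + ‖a (n + 1)‖ + ‖a n‖) := by
    have hh : ∀ c : ℂ, ‖c‖ ≤ M → ∀ u, ‖c * u‖ ≤ M * ‖u‖ := fun c hc u => by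
      rw [norm_mul]; gcongr
    have p1 := norm_nonneg y'
    have p2 := norm_nonneg (y' ^ 2)
    have p3 := norm_nonneg (12 * y ^ 2 - 2 * z)
    have p4 := norm_nonneg (12 * y)
    calc _ ≤ ‖y' * a (n + 4)‖ + ‖y' ^ 2 * a (n + 3)‖ + ‖(12 * y ^ 2 - 2 * z) * a (n + 2)‖
          + ‖12 * y * a (n + 1)‖ + ‖4 * a n‖ := by
          refine (norm_add_le _ _).trans ?_
          gcongr
          refine (norm_add_le _ _).trans ?_
          gcongr
          refine (norm_add_le _ _).trans ?_
          gcongr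
          exact norm_add_le _ _
      _ ≤ _ := by
          have q1 := hh y' (by linarith) (a (n + 4))
          have q2 := hh (y' ^ 2) (by linarith) (a (n + 3))
          have q3 := hh (12 * y ^ 2 - 2 * z) (by linarith) (a (n + 2))
          have q4 := hh (12 * y) (by linarith) (a (n + 1))
          have q5 := hh 4 (by simp only [Complex.norm_ofNat]; linarith) (a n)
          linarith
  rw [e, norm_div, hd, div_mul_eq_mul_div]
  gcongr
  nlinarith [(Nat.cast_nonneg n : (0 : ℝ) ≤ n)]

/-- Entire solutions exist with arbitrary `h y` and `h'' y`. -/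
theorem exists_isEntireSol (y y' z α β : ℂ) :
    ∃ h, IsEntireSol y y' z h ∧ h y = α ∧ deriv (deriv h) y = β := by
  set a := solCoeff y y' z α (β / 2) with ha'
  have ha := isEntireCoeff_solCoeff y y' z α (β / 2)
  rw [← ha'] at ha
  have hd : ∀ {b : ℕ → ℂ}, IsEntireCoeff b →
      deriv (fun x => seriesSum b (x - y)) = fun x => seriesSum (derivCoeff b) (x - y) := by
    intro b hb
    ext x
    exact ((hasDerivAt_seriesSum hb (x - y)).comp_sub_const x y).deriv
  have h0 : a 0 = α := by simp only [a]; rw [solCoeff]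
  have h1 : a 1 = -y' * α := by simp only [a]; rw [solCoeff]
  have h2 : a 2 = β / 2 := by simp only [a]; rw [solCoeff]
  have h3 : a 3 = (y' * (β / 2) + y' ^ 2 * (-y' * α) + (12 * y ^ 2 - 2 * z) * α) / 3 := by
    simp only [a]; rw [solCoeff]
  have h4 : a 4 = (y' * a 3 + y' ^ 2 * (β / 2) + (12 * y ^ 2 - 2 * z) * (-y' * α)
      + 12 * y * α) / 8 := by
    simp only [h3, a]; rw [solCoeff, solCoeff]
  have h5 : ∀ n, a (n + 5) = (y' * a (n + 4) + y' ^ 2 * a (n + 3)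
      + (12 * y ^ 2 - 2 * z) * a (n + 2) + 12 * y * a (n + 1) + 4 * a n) / ((n + 5) * (n + 3)) := by
    intro n; simp only [a]; rw [solCoeff]
  refine ⟨fun x => seriesSum a (x - y), ⟨?_, fun x => ?_⟩, ?_, ?_⟩
  · exact fun x => ((hasDerivAt_seriesSum ha (x - y)).comp_sub_const x y).differentiableAt
  · rw [hd ha, hd ha.derivCoeff]
    set t := x - y with ht
    have hG : G y y' z x = y' + y' ^ 2 * t + (12 * y ^ 2 - 2 * z) * t ^ 2 + 12 * y * t ^ 3
        + 4 * t ^ 4 := by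
      have : x = y + t := by rw [ht]; ring
      rw [G, ← ht, this]; ring
    have s1 := ha.shiftCoeff
    have s2 := s1.shiftCoeff
    have s3 := s2.shiftCoeff
    have s4 := s3.shiftCoeff
    have key : t * seriesSum (derivCoeff (derivCoeff a)) t = seriesSum (derivCoeff a) t
        + (y' * seriesSum a t + y' ^ 2 * seriesSum (shiftCoeff a) t
          + (12 * y ^ 2 - 2 * z) * seriesSum (shiftCoeff (shiftCoeff a)) t
          + 12 * y * seriesSum (shiftCoeff (shiftCoeff (shiftCoeff a))) t
          + 4 * seriesSum (shiftCoeff (shiftCoeff (shiftCoeff (shiftCoeff a)))) t) := by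
      rw [← seriesSum_shiftCoeff ha.derivCoeff.derivCoeff]
      refine HasSum.unique (ha.derivCoeff.derivCoeff.shiftCoeff.summable t).hasSum ?_
      have S := (ha.derivCoeff.summable t).hasSum.add
        ((((((ha.summable t).hasSum.mul_left y').add ((s1.summable t).hasSum.mul_left (y' ^ 2))).add
        ((s2.summable t).hasSum.mul_left (12 * y ^ 2 - 2 * z))).add
        ((s3.summable t).hasSum.mul_left (12 * y))).add ((s4.summable t).hasSum.mul_left 4))
      convert S using 1
      on_goal 2 => rfl
      ext n
      match n with
      | 0 => simp [shiftCoeff, derivCoeff, h0, h1]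
      | 1 => simp [shiftCoeff, derivCoeff, h0, h1, h2]; ring
      | 2 => simp [shiftCoeff, derivCoeff, h0, h1, h2, h3]; ring
      | 3 => simp [shiftCoeff, derivCoeff, h0, h1, h2, h4]; ring
      | n + 4 =>
        have e1 : ((n : ℂ) + 5) ≠ 0 := by exact_mod_cast Nat.succ_ne_zero (n + 4)
        have e2 : ((n : ℂ) + 3) ≠ 0 := by exact_mod_cast Nat.succ_ne_zero (n + 2)
        have r : (n + 5) * (n + 3) * a (n + 5) = y' * a (n + 4) + y' ^ 2 * a (n + 3)
            + (12 * y ^ 2 - 2 * z) * a (n + 2) + 12 * y * a (n + 1) + 4 * a n := by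
          rw [h5]; field_simp
        simp only [shiftCoeff, derivCoeff]
        push_cast
        linear_combination t ^ (n + 4) * r
    rw [key, seriesSum_shiftCoeff s3, seriesSum_shiftCoeff s2, seriesSum_shiftCoeff s1,
      seriesSum_shiftCoeff ha, hG]
    ring
  · simp [seriesSum_zero, h0]
  · rw [hd ha, hd ha.derivCoeff]
    simp only [sub_self, seriesSum_zero, derivCoeff]
    norm_num
    rw [h2]; ring

/-- `Q` in terms of `G`. The second term is what the second derivative of `(x - y) ^ (-1/2)`
contributes. -/
theorem Q_eq {y y' z x : ℂ} (hx : x ≠ y) :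
    Q y y' z x = G y y' z x / (x - y) + 3 / 4 * (1 / (x - y)) ^ 2 := by
  have := sub_ne_zero.2 hx
  rw [Q, G]; field_simp; ring

/-! ### The two-dimensional space of entire solutions -/

section
variable {y y' z : ℂ}

theorem IsEntireSol.deriv_differentiable {h : ℂ → ℂ} (hh : IsEntireSol y y' z h) :
    Differentiable ℂ (deriv h) := hh.differentiable.deriv

theorem IsEntireSol.hasDerivAt {h : ℂ → ℂ} (hh : IsEntireSol y y' z h) (x : ℂ) :
    HasDerivAt h (deriv h x) x := (hh.differentiable x).hasDerivAt

theorem IsEntireSol.hasDerivAt_deriv {h : ℂ → ℂ} (hh : IsEntireSol y y' z h) (x : ℂ) :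
    HasDerivAt (deriv h) (deriv (deriv h) x) x := (hh.deriv_differentiable x).hasDerivAt

theorem deriv_linearComb {g h : ℂ → ℂ} (hg : Differentiable ℂ g) (hh : Differentiable ℂ h)
    (a b : ℂ) : deriv (fun x => a * g x + b * h x) = fun x => a * deriv g x + b * deriv h x := by
  ext x
  exact (((hg x).hasDerivAt.const_mul a).add ((hh x).hasDerivAt.const_mul b)).deriv

theorem IsEntireSol.linearComb {g h : ℂ → ℂ} (hg : IsEntireSol y y' z g)
    (hh : IsEntireSol y y' z h) (a b : ℂ) : IsEntireSol y y' z fun x => a * g x + b * h x := by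
  refine ⟨(hg.differentiable.const_mul a).add (hh.differentiable.const_mul b), fun x => ?_⟩
  rw [deriv_linearComb hg.differentiable hh.differentiable,
    deriv_linearComb hg.deriv_differentiable hh.deriv_differentiable]
  linear_combination a * hg.eq x + b * hh.eq x

theorem IsEntireSol.const_mul {h : ℂ → ℂ} (hh : IsEntireSol y y' z h) (a : ℂ) :
    IsEntireSol y y' z fun x => a * h x := by
  simpa using hh.linearComb hh a 0

/-- The symplectic form on entire solutions: the Wronskian of `g` and `h` is `omega y g h` times
`x - y`. -/
def omega (y : ℂ) (g h : ℂ → ℂ) : ℂ := g y * deriv (deriv h) y - deriv (deriv g) y * h y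

theorem omega_swap (y : ℂ) (g h : ℂ → ℂ) : omega y h g = -omega y g h := by
  rw [omega, omega]; ring

theorem omega_self (y : ℂ) (g : ℂ → ℂ) : omega y g g = 0 := by
  rw [omega]; ring

theorem omega_linearComb_left {g h : ℂ → ℂ} (hg : IsEntireSol y y' z g)
    (hh : IsEntireSol y y' z h) (a b : ℂ) (k : ℂ → ℂ) :
    omega y (fun x => a * g x + b * h x) k = a * omega y g k + b * omega y h k := by
  simp only [omega]
  rw [deriv_linearComb hg.differentiable hh.differentiable,
    deriv_linearComb hg.deriv_differentiable hh.deriv_differentiable]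
  ring

/-- A function with `(x - y) w' = w` on a preconnected open set without `y` is a multiple of
`x - y`. -/
theorem exists_eq_mul_sub {D : Set ℂ} (hD : IsOpen D) (hD' : IsPreconnected D) (hy : y ∉ D)
    {w w' : ℂ → ℂ} (hw : ∀ x ∈ D, HasDerivAt w (w' x) x) (h : ∀ x ∈ D, (x - y) * w' x = w x) :
    ∃ c, ∀ x ∈ D, w x = c * (x - y) := by
  have hne : ∀ x ∈ D, x - y ≠ 0 := fun x hx h0 => hy (by rwa [← sub_eq_zero.1 h0])
  have hd : ∀ x ∈ D, HasDerivAt (fun x => w x / (x - y)) 0 x := fun x hx => by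
    refine ((hw x hx).div ((hasDerivAt_id x).sub_const y) (hne x hx)).congr_deriv ?_
    rw [← h x hx]; simp only [id]; ring
  obtain ⟨c, hc⟩ := hD.exists_is_const_of_deriv_eq_zero hD'
    (fun x hx => (hd x hx).differentiableAt.differentiableWithinAt)
    (fun x hx => (hd x hx).deriv)
  refine ⟨c, fun x hx => ?_⟩
  rw [← hc x hx, div_mul_cancel₀ _ (hne x hx)]

theorem IsEntireSol.wronskian {g h : ℂ → ℂ} (hg : IsEntireSol y y' z g)
    (hh : IsEntireSol y y' z h) (x : ℂ) :
    g x * deriv h x - deriv g x * h x = omega y g h * (x - y) := by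
  have hd : ∀ x, HasDerivAt (fun x => g x * deriv h x - deriv g x * h x)
      (g x * deriv (deriv h) x - deriv (deriv g) x * h x) x := fun x => by
    refine (((hg.hasDerivAt x).mul (hh.hasDerivAt_deriv x)).sub
      ((hg.hasDerivAt_deriv x).mul (hh.hasDerivAt x))).congr_deriv ?_
    ring
  have hconn : IsPreconnected ({y}ᶜ : Set ℂ) :=
    (isConnected_compl_singleton_of_one_lt_rank (by simp) y).isPreconnected
  obtain ⟨c, hc⟩ := exists_eq_mul_sub (y := y) isOpen_compl_singleton hconn (by simp)
    (fun x _ => hd x) (fun x _ => by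
      linear_combination g x * hh.eq x - h x * hg.eq x)
  have hc' : (fun x => g x * deriv h x - deriv g x * h x) = fun x => c * (x - y) := by
    refine Continuous.ext_on (dense_compl_singleton y) ?_ (by fun_prop) fun x hx => hc x hx
    exact (hg.differentiable.continuous.mul hh.deriv_differentiable.continuous).sub
      (hg.deriv_differentiable.continuous.mul hh.differentiable.continuous)
  have hω : omega y g h = c := by
    have h1 := (hd y).deriv
    rw [hc'] at h1
    rw [omega, ← h1]
    simp
  rw [hω]
  exact congrFun hc' x

/-- Local form of the two-dimensionality of the solution space: a solution `χ` of the equation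
`(x - y) χ'' = χ' + G χ` on a domain is the restriction of an entire solution. -/
theorem exists_isEntireSol_eqOn {D : Set ℂ} (hD : IsOpen D) (hD' : IsPreconnected D) (hy : y ∉ D)
    {χ χ' χ'' : ℂ → ℂ} (h1 : ∀ x ∈ D, HasDerivAt χ (χ' x) x)
    (h2 : ∀ x ∈ D, HasDerivAt χ' (χ'' x) x)
    (h : ∀ x ∈ D, (x - y) * χ'' x = χ' x + G y y' z x * χ x) :
    ∃ k, IsEntireSol y y' z k ∧ ∀ x ∈ D, χ x = k x := by
  obtain ⟨g₁, hg₁, e1, e2⟩ := exists_isEntireSol y y' z 1 0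
  obtain ⟨g₂, hg₂, e3, e4⟩ := exists_isEntireSol y y' z 0 1
  have hω : omega y g₁ g₂ = 1 := by rw [omega, e1, e2, e3, e4]; ring
  have W : ∀ {g : ℂ → ℂ}, IsEntireSol y y' z g →
      ∃ c, ∀ x ∈ D, χ x * deriv g x - χ' x * g x = c * (x - y) := fun {g} hg =>
    exists_eq_mul_sub hD hD' hy (w' := fun x => χ x * deriv (deriv g) x - χ'' x * g x)
      (fun x hx => by
        refine (((h1 x hx).mul (hg.hasDerivAt_deriv x)).sub
          ((h2 x hx).mul (hg.hasDerivAt x))).congr_deriv ?_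
        ring)
      (fun x hx => by linear_combination χ x * hg.eq x - g x * h x hx)
  obtain ⟨c₁, hc₁⟩ := W hg₁
  obtain ⟨c₂, hc₂⟩ := W hg₂
  refine ⟨_, hg₁.linearComb hg₂ c₂ (-c₁), fun x hx => ?_⟩
  have hne : x - y ≠ 0 := fun h0 => hy (by rwa [← sub_eq_zero.1 h0])
  have w := hg₁.wronskian hg₂ x
  rw [hω] at w
  -- expand the vanishing determinant with rows `(χ, g₁, g₂)`, `(χ, g₁, g₂)`, `(χ', g₁', g₂')`
  apply mul_left_cancel₀ hne
  linear_combination (-χ x) * w + g₁ x * hc₂ x hx - g₂ x * hc₁ x hx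

/-- Two entire solutions with non-zero Wronskian span the space of entire solutions. -/
theorem IsEntireSol.eq_linearComb {g h k : ℂ → ℂ} (hk : IsEntireSol y y' z k)
    (hg : IsEntireSol y y' z g) (hh : IsEntireSol y y' z h) (x : ℂ) :
    omega y g h * k x = omega y k h * g x - omega y k g * h x := by
  have key : (fun x => omega y g h * k x) = fun x => omega y k h * g x - omega y k g * h x := by
    refine Continuous.ext_on (dense_compl_singleton y) ?_ ?_ fun x hx => ?_
    · exact hk.differentiable.continuous.const_mul _
    · exact (hg.differentiable.continuous.const_mul _).sub
        (hh.differentiable.continuous.const_mul _)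
    · apply mul_left_cancel₀ (sub_ne_zero.2 (show x ≠ y from hx))
      linear_combination (-k x) * hg.wronskian hh x + g x * hk.wronskian hh x
        - h x * hk.wronskian hg x
  exact congrFun key x

end

/-! ### A priori estimates for the amplitudes -/

/-- Backward Gronwall estimate. If `a' = -f` and `b' = p b + f` on `[0, 1]`, where `Re p ≥ 0` and
`f` is small compared to `(a, b)`, then `(a, b)` at `0` is controlled by its value at `1`. -/
theorem amplitude_segment_estimate {a b f p : ℝ → ℂ} {κ k : ℝ → ℝ}
    (ha : ∀ s ∈ Set.Icc (0 : ℝ) 1, HasDerivAt a (-(f s)) s)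
    (hb : ∀ s ∈ Set.Icc (0 : ℝ) 1, HasDerivAt b (p s * b s + f s) s)
    (hp : ∀ s ∈ Set.Icc (0 : ℝ) 1, 0 ≤ (p s).re)
    (hκ : ∀ s ∈ Set.Icc (0 : ℝ) 1, HasDerivAt κ (k s) s)
    (hf : ∀ s ∈ Set.Icc (0 : ℝ) 1, ‖f s‖ ≤ k s * (‖a s‖ + ‖b s‖))
    (hk : ∀ s ∈ Set.Icc (0 : ℝ) 1, 0 ≤ k s) {J M : ℝ} (hJ : κ 1 - κ 0 ≤ J)
    (hM : M = Real.exp (4 * J) * (‖a 1‖ ^ 2 + ‖b 1‖ ^ 2)) :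
    ‖a 0‖ ^ 2 + ‖b 0‖ ^ 2 ≤ M ∧ ‖a 0 - a 1‖ ≤ 2 * J * √M ∧
      ‖b 0‖ ^ 2 ≤ ‖b 1‖ ^ 2 + 4 * J * M := by
  have h01 : (0 : ℝ) ∈ Set.Icc (0 : ℝ) 1 := ⟨le_rfl, zero_le_one⟩
  have h11 : (1 : ℝ) ∈ Set.Icc (0 : ℝ) 1 := ⟨zero_le_one, le_rfl⟩
  have hint : ∀ {s : ℝ}, s ∈ interior (Set.Icc (0 : ℝ) 1) → s ∈ Set.Icc (0 : ℝ) 1 :=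
    fun hs => interior_subset hs
  have hκm : MonotoneOn κ (Set.Icc 0 1) := by
    refine monotoneOn_of_deriv_nonneg (convex_Icc 0 1)
      (fun s hs => (hκ s hs).continuousAt.continuousWithinAt)
      (fun s hs => (hκ s (hint hs)).differentiableAt.differentiableWithinAt) fun s hs => ?_
    rw [(hκ s (hint hs)).deriv]
    exact hk s (hint hs)
  have hJ0 : 0 ≤ J := (sub_nonneg.2 (hκm h01 h11 zero_le_one)).trans hJ
  have ha2 : ∀ s ∈ Set.Icc (0 : ℝ) 1,
      HasDerivAt (fun s => ‖a s‖ ^ 2) (2 * inner ℝ (a s) (-(f s))) s :=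
    fun s hs => (ha s hs).norm_sq
  have hb2 : ∀ s ∈ Set.Icc (0 : ℝ) 1,
      HasDerivAt (fun s => ‖b s‖ ^ 2) (2 * inner ℝ (b s) (p s * b s + f s)) s :=
    fun s hs => (hb s hs).norm_sq
  have hbound : ∀ u v : ℂ, -(‖u‖ * ‖v‖) ≤ inner ℝ u v := fun u v =>
    neg_le_of_abs_le (abs_real_inner_le_norm u v)
  have hpb : ∀ s ∈ Set.Icc (0 : ℝ) 1, 0 ≤ inner ℝ (b s) (p s * b s) := fun s hs => by
    have : inner ℝ (b s) (p s * b s) = (p s).re * ‖b s‖ ^ 2 := by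
      rw [Complex.inner, mul_assoc, Complex.mul_conj, Complex.normSq_eq_norm_sq,
        Complex.re_mul_ofReal]
    rw [this]
    exact mul_nonneg (hp s hs) (sq_nonneg _)
  -- the energy `(|a|² + |b|²) exp (4 κ)` is nondecreasing
  have hmono : MonotoneOn (fun s => (‖a s‖ ^ 2 + ‖b s‖ ^ 2) * Real.exp (4 * κ s))
      (Set.Icc 0 1) := by
    have hd : ∀ s ∈ Set.Icc (0 : ℝ) 1,
        HasDerivAt (fun s => (‖a s‖ ^ 2 + ‖b s‖ ^ 2) * Real.exp (4 * κ s))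
        ((2 * inner ℝ (a s) (-(f s)) + 2 * inner ℝ (b s) (p s * b s + f s)) * Real.exp (4 * κ s)
          + (‖a s‖ ^ 2 + ‖b s‖ ^ 2) * (Real.exp (4 * κ s) * (4 * k s))) s := fun s hs =>
      ((ha2 s hs).add (hb2 s hs)).mul ((hκ s hs).const_mul 4).exp
    refine monotoneOn_of_deriv_nonneg (convex_Icc 0 1)
      (fun s hs => (hd s hs).continuousAt.continuousWithinAt)
      (fun s hs => (hd s (hint hs)).differentiableAt.differentiableWithinAt) fun s hs => ?_
    replace hs := hint hs
    rw [(hd s hs).deriv]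
    have e1 := hbound (a s) (-(f s))
    have e2 := hbound (b s) (f s)
    have e3 := hpb s hs
    have e4 := hf s hs
    have e5 := hk s hs
    rw [norm_neg] at e1
    rw [inner_add_right]
    have na := norm_nonneg (a s)
    have nb := norm_nonneg (b s)
    have e6 : (‖a s‖ + ‖b s‖) * ‖f s‖ ≤ k s * (2 * (‖a s‖ ^ 2 + ‖b s‖ ^ 2)) := by
      calc (‖a s‖ + ‖b s‖) * ‖f s‖ ≤ (‖a s‖ + ‖b s‖) * (k s * (‖a s‖ + ‖b s‖)) := by gcongr
        _ = k s * (‖a s‖ + ‖b s‖) ^ 2 := by ring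
        _ ≤ _ := by gcongr; nlinarith [sq_nonneg (‖a s‖ - ‖b s‖)]
    have e7 : 0 ≤ 2 * inner ℝ (a s) (-(f s)) + 2 * (inner ℝ (b s) (p s * b s)
        + inner ℝ (b s) (f s)) + (‖a s‖ ^ 2 + ‖b s‖ ^ 2) * (4 * k s) := by linarith
    have := mul_nonneg e7 (Real.exp_pos (4 * κ s)).le
    linarith
  have hN : ∀ s ∈ Set.Icc (0 : ℝ) 1, ‖a s‖ ^ 2 + ‖b s‖ ^ 2 ≤ M := fun s hs => by
    have h1 := hmono hs h11 hs.2
    have h2 : 4 * κ 1 ≤ 4 * J + 4 * κ s := by linarith [hκm h01 hs hs.1]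
    have h3 : (‖a s‖ ^ 2 + ‖b s‖ ^ 2) * Real.exp (4 * κ s) ≤ M * Real.exp (4 * κ s) := by
      refine h1.trans ?_
      rw [hM, mul_right_comm, ← Real.exp_add, mul_comm (Real.exp _)]
      exact mul_le_mul_of_nonneg_left (Real.exp_le_exp.2 h2) (by positivity)
    exact le_of_mul_le_mul_right h3 (Real.exp_pos _)
  have hM0 : 0 ≤ M := by rw [hM]; positivity
  have hsum : ∀ s ∈ Set.Icc (0 : ℝ) 1, ‖a s‖ + ‖b s‖ ≤ 2 * √M := fun s hs => by
    have h1 : ‖a s‖ ≤ √M := Real.le_sqrt_of_sq_le (by nlinarith [hN s hs, sq_nonneg ‖b s‖])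
    have h2 : ‖b s‖ ≤ √M := Real.le_sqrt_of_sq_le (by nlinarith [hN s hs, sq_nonneg ‖a s‖])
    linarith
  refine ⟨hN 0 h01, ?_, ?_⟩
  · have h := image_norm_le_of_norm_deriv_right_le_deriv_boundary' (a := 0) (b := 1)
      (f := fun s => a s - a 0) (f' := fun s => -(f s)) (B := fun s => 2 * √M * (κ s - κ 0))
      (B' := fun s => 2 * √M * k s)
      (fun s hs => ((ha s hs).continuousAt.sub continuousAt_const).continuousWithinAt)
      (fun s hs => ((ha s ⟨hs.1, hs.2.le⟩).sub_const _).hasDerivWithinAt) (by simp)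
      (fun s hs => ((hκ s hs).continuousAt.sub continuousAt_const).const_mul _
        |>.continuousWithinAt)
      (fun s hs => (((hκ s ⟨hs.1, hs.2.le⟩).sub_const _).const_mul _).hasDerivWithinAt)
      (fun s hs => by
        have hs' : s ∈ Set.Icc (0 : ℝ) 1 := ⟨hs.1, hs.2.le⟩
        rw [norm_neg]
        refine (hf s hs').trans ?_
        rw [mul_comm (2 * √M)]
        exact mul_le_mul_of_nonneg_left (hsum s hs') (hk s hs')) h11
    rw [norm_sub_rev]
    refine h.trans ?_
    have := mul_le_mul_of_nonneg_left hJ (show 0 ≤ 2 * √M by positivity)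
    linarith
  · have hd : ∀ s ∈ Set.Icc (0 : ℝ) 1, HasDerivAt (fun s => ‖b s‖ ^ 2 + 4 * M * κ s)
        (2 * inner ℝ (b s) (p s * b s + f s) + 4 * M * k s) s := fun s hs =>
      (hb2 s hs).add ((hκ s hs).const_mul _)
    have hm : MonotoneOn (fun s => ‖b s‖ ^ 2 + 4 * M * κ s) (Set.Icc 0 1) := by
      refine monotoneOn_of_deriv_nonneg (convex_Icc 0 1)
        (fun s hs => (hd s hs).continuousAt.continuousWithinAt)
        (fun s hs => (hd s (hint hs)).differentiableAt.differentiableWithinAt) fun s hs => ?_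
      replace hs := hint hs
      rw [(hd s hs).deriv, inner_add_right]
      have e2 := hbound (b s) (f s)
      have e3 := hpb s hs
      have e5 := hk s hs
      have na := norm_nonneg (a s)
      have nb := norm_nonneg (b s)
      have e6 : ‖b s‖ * ‖f s‖ ≤ k s * (2 * M) := by
        calc ‖b s‖ * ‖f s‖ ≤ ‖b s‖ * (k s * (‖a s‖ + ‖b s‖)) := by gcongr; exact hf s hs
          _ = k s * (‖b s‖ * (‖a s‖ + ‖b s‖)) := by ring
          _ ≤ _ := by
            refine mul_le_mul_of_nonneg_left ?_ e5
            nlinarith [sq_nonneg (‖a s‖ - ‖b s‖), hN s hs]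
      linarith
    have h := hm h01 h11 zero_le_one
    have h2 := mul_le_mul_of_nonneg_left hJ (show 0 ≤ 4 * M by positivity)
    simp only at h
    linarith

/-- Along a segment from a point `ξ` of the cone `-κ |ξ| ≤ Re ξ` to a positive real `T ≥ |ξ|`, the
modulus stays comparable with its linear interpolation. -/
theorem norm_segment_ge {κ : ℝ} (hκ0 : 0 ≤ κ) (hκ1 : κ < 1) {ξ : ℂ} (hξ : -(κ * ‖ξ‖) ≤ ξ.re)
    {T s : ℝ} (hT : 0 ≤ T) (hs : s ∈ Set.Icc (0 : ℝ) 1) :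
    √((1 - κ) / 2) * (‖ξ‖ + s * (T - ‖ξ‖)) ≤ ‖ξ + s * (T - ξ)‖ := by
  obtain ⟨hs0, hs1⟩ := hs
  have hn := norm_nonneg ξ
  have e1 : ‖ξ + s * (T - ξ)‖ ^ 2 = (1 - s) ^ 2 * ‖ξ‖ ^ 2 + s ^ 2 * T ^ 2
      + 2 * ((1 - s) * s * T) * ξ.re := by
    rw [← Complex.normSq_eq_norm_sq, ← Complex.normSq_eq_norm_sq, Complex.normSq_apply,
      Complex.normSq_apply]
    simp
    ring
  have h1 : 0 ≤ (1 - s) * s * T := by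
    have : 0 ≤ 1 - s := by linarith
    positivity
  have h2 := mul_le_mul_of_nonneg_left hξ h1
  refine abs_le_of_sq_le_sq' ?_ (norm_nonneg _) |>.2
  rw [mul_pow, Real.sq_sqrt (by linarith), e1]
  nlinarith [sq_nonneg ((1 - s) * ‖ξ‖ - s * T), mul_nonneg (mul_nonneg h1 hn) hκ0]

theorem segment_mem_slitPlane {κ : ℝ} (hκ1 : κ < 1) {ξ : ℂ} (h0 : ξ ≠ 0)
    (hξ : -(κ * ‖ξ‖) ≤ ξ.re) {T s : ℝ} (hT : 0 < T) (hs : s ∈ Set.Icc (0 : ℝ) 1) :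
    ξ + s * (T - ξ) ∈ Complex.slitPlane := by
  obtain ⟨hs0, hs1⟩ := hs
  rw [Complex.mem_slitPlane_iff]
  have hn := norm_pos_iff.2 h0
  by_cases hi : ξ.im = 0
  · left
    have hr : 0 < ξ.re := by
      have habs : |ξ.re| = ‖ξ‖ := by
        rw [← Complex.re_add_im ξ, hi]; simp
      rcases lt_or_ge 0 ξ.re with h | h
      · exact h
      · rw [abs_of_nonpos h] at habs
        nlinarith
    simp
    rcases eq_or_lt_of_le hs0 with rfl | hs0
    · simpa using hr
    · nlinarith [mul_pos hs0 hT, mul_nonneg (sub_nonneg.2 hs1) hr.le]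
  · rcases eq_or_lt_of_le hs1 with rfl | hs1
    · left; simpa using hT
    · right
      simp
      intro h
      apply hi
      have : (1 - s) * ξ.im = 0 := by linarith
      rcases mul_eq_zero.1 this with h | h
      · linarith
      · exact h

/-- The derivative of the phase `S = ς ((4/5) x ^ (5/2) - z x ^ (1/2))` with respect to
`l = log x`. -/
def phaseDeriv (z ς l : ℂ) : ℂ :=
  ς * (2 * Complex.exp (5 * l / 2) - z / 2 * Complex.exp (l / 2))

/-- `(A, B)` are the amplitudes of a solution of a perturbed second-order equation: `A` multiplies
`exp (-S)` and `B exp (-2S)` multiplies `exp S`. They satisfy a first order system in `l = log x`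
in which everything but the growth `2 S'` of `B` is small as `Re l → ∞`. -/
structure IsAmplitude (z ς : ℂ) (L C : ℝ) (A B : ℂ → ℂ) : Prop where
  exists_error : ∃ F : ℂ → ℂ, ∀ l : ℂ, L < l.re → HasDerivAt A (-(F l)) l ∧
    HasDerivAt B (2 * phaseDeriv z ς l * B l + F l) l ∧
    ‖F l‖ ≤ C * Real.exp (-l.re / 2) * (‖A l‖ + ‖B l‖)

/-- The point `l = log x` with `x = exp (iγ) ξ ^ (2/5)`. -/
def logPoint (γ : ℝ) (ξ : ℂ) : ℂ := Complex.I * γ + 2 / 5 * Complex.log ξ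

theorem logPoint_re (γ : ℝ) (ξ : ℂ) : (logPoint γ ξ).re = 2 / 5 * Real.log ‖ξ‖ := by
  have : (2 / 5 : ℂ) = ((2 / 5 : ℝ) : ℂ) := by norm_num
  rw [logPoint, Complex.add_re, this, Complex.re_ofReal_mul, Complex.log_re]
  simp

theorem exp_logPoint {γ : ℝ} {ξ : ℂ} (hξ : ξ ≠ 0) :
    Complex.exp (5 * logPoint γ ξ / 2) = Complex.exp (5 * γ / 2 * Complex.I) * ξ := by
  rw [logPoint, show 5 * (Complex.I * γ + 2 / 5 * Complex.log ξ) / 2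
    = 5 * γ / 2 * Complex.I + Complex.log ξ by ring, Complex.exp_add, Complex.exp_log hξ]

theorem exp_neg_logPoint_re (γ : ℝ) {ξ : ℂ} (hξ : ξ ≠ 0) :
    Real.exp (-(logPoint γ ξ).re / 2) = ‖ξ‖ ^ (-(1 / 5) : ℝ) := by
  rw [logPoint_re, Real.rpow_def_of_pos (norm_pos_iff.2 hξ)]
  congr 1; ring

theorem hasDerivAt_logPoint {γ : ℝ} {ξ : ℂ} (hξ : ξ ∈ Complex.slitPlane) :
    HasDerivAt (logPoint γ) (2 / 5 / ξ) ξ := by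
  refine (((Complex.hasDerivAt_log hξ).const_mul (2 / 5)).const_add (Complex.I * γ)).congr_deriv ?_
  ring

/-- On a cone, the amplitudes at `ξ` are controlled by their values at all large real `T`: the
straight segment from `ξ` to `T` is a path along which the phase grows. -/
theorem amplitude_cone_estimate (z ς : ℂ) (hς : ‖ς‖ = 1) (L C γ κ : ℝ) (hC : 0 ≤ C)
    (hγ : 0 < (ς * Complex.exp (5 * γ / 2 * Complex.I)).re) (hκ0 : 0 ≤ κ) (hκ1 : κ < 1) :
    ∃ R K : ℝ, 1 ≤ R ∧ 0 ≤ K ∧ ∀ ξ : ℂ, R ≤ ‖ξ‖ → -(κ * ‖ξ‖) ≤ ξ.re →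
      ∀ᶠ T : ℝ in atTop, ∀ A B, IsAmplitude z ς L C A B → ∀ J M : ℝ,
        J = K * ‖ξ‖ ^ (-(1 / 5) : ℝ) →
        M = Real.exp (4 * K) * (‖A (logPoint γ T)‖ ^ 2 + ‖B (logPoint γ T)‖ ^ 2) →
        ‖A (logPoint γ ξ)‖ ^ 2 + ‖B (logPoint γ ξ)‖ ^ 2 ≤ M ∧
        ‖A (logPoint γ ξ) - A (logPoint γ T)‖ ≤ 2 * J * √M ∧
        ‖B (logPoint γ ξ)‖ ^ 2 ≤ ‖B (logPoint γ T)‖ ^ 2 + 4 * J * M := by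
  set c₀ := ς * Complex.exp (5 * γ / 2 * Complex.I) with hc₀
  have hc₀n : ‖c₀‖ = 1 := by
    rw [hc₀, norm_mul, hς, one_mul]
    have : (5 * γ / 2 * Complex.I : ℂ) = ((5 * γ / 2 : ℝ) : ℂ) * Complex.I := by push_cast; ring
    rw [this, Complex.norm_exp_ofReal_mul_I]
  set r := c₀.re with hr
  have hr1 : r ≤ 1 := (Complex.re_le_norm _).trans hc₀n.le
  set c := √((1 - κ) / 2) with hc
  have hc0 : 0 < c := Real.sqrt_pos.2 (by linarith)
  have hc1 : c ≤ 1 := Real.sqrt_le_one.2 (by linarith)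
  -- `R₁` bounds `|x|^(5/2)` from below where the system holds and `S'` is close to its leading term
  obtain ⟨R₁, hR₁⟩ : ∃ R₁ : ℝ, 1 ≤ R₁ ∧ ∀ ξ : ℂ, R₁ ≤ ‖ξ‖ → L < (logPoint γ ξ).re ∧
      ‖z / 2 * Complex.exp (-2 * logPoint γ ξ)‖ ≤ r := by
    have t1 : Tendsto (fun ρ : ℝ => 2 / 5 * Real.log ρ) atTop atTop :=
      Real.tendsto_log_atTop.const_mul_atTop (by norm_num)
    have t2 : Tendsto (fun ρ : ℝ => ‖z / 2‖ * Real.exp (-(2 * (2 / 5 * Real.log ρ)))) atTop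
        (𝓝 0) := by
      rw [← mul_zero ‖z / 2‖]
      exact (Real.tendsto_exp_neg_atTop_nhds_zero.comp
        (t1.const_mul_atTop (by norm_num : (0 : ℝ) < 2))).const_mul _
    obtain ⟨R₁, h⟩ := eventually_atTop.1 ((t1.eventually_gt_atTop L).and
      (t2.eventually (eventually_le_nhds hγ)))
    refine ⟨max R₁ 1, le_max_right _ _, fun ξ hξ => ?_⟩
    obtain ⟨h1, h2⟩ := h ‖ξ‖ ((le_max_left _ _).trans hξ)
    refine ⟨by rwa [logPoint_re], ?_⟩
    rw [norm_mul, Complex.norm_exp]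
    rw [← logPoint_re γ] at h2
    rwa [show (-2 * logPoint γ ξ).re = -(2 * (logPoint γ ξ).re) by simp]
  obtain ⟨hR₁1, hR₁⟩ := hR₁
  set K₁ := 4 / 5 * C * c ^ (-(6 / 5) : ℝ) with hK₁
  have hK₁0 : 0 ≤ K₁ := by positivity
  refine ⟨R₁ / c, 5 * K₁, by rw [le_div_iff₀ hc0]; linarith, by positivity, ?_⟩
  intro ξ hξR hξ
  have hξn : 0 < ‖ξ‖ := by
    have : 0 < R₁ / c := by positivity
    linarith
  have hcξ : R₁ ≤ c * ‖ξ‖ := by rwa [div_le_iff₀' hc0] at hξR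
  have hξ1 : 1 ≤ ‖ξ‖ := by nlinarith
  filter_upwards [eventually_ge_atTop (3 * ‖ξ‖), eventually_ge_atTop ((2 / r + 1) * ‖ξ‖)]
    with T hT1 hT2 A B hAB J M hJ hM
  obtain ⟨F, hF⟩ := hAB.exists_error
  have hT0 : 0 < T := by linarith
  set β := T - ‖ξ‖ with hβ
  have hβ0 : 0 < β := by linarith
  set P : ℝ → ℂ := fun s => ξ + s * (T - ξ) with hP
  set m : ℝ → ℝ := fun s => ‖ξ‖ + s * β with hm
  have hmpos : ∀ s ∈ Set.Icc (0 : ℝ) 1, ‖ξ‖ ≤ m s := fun s hs => by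
    have := mul_nonneg hs.1 hβ0.le
    simp only [hm]; linarith
  have hPge : ∀ s ∈ Set.Icc (0 : ℝ) 1, c * m s ≤ ‖P s‖ := fun s hs =>
    norm_segment_ge hκ0 hκ1 hξ hT0.le hs
  have hPR : ∀ s ∈ Set.Icc (0 : ℝ) 1, R₁ ≤ ‖P s‖ := fun s hs =>
    hcξ.trans ((mul_le_mul_of_nonneg_left (hmpos s hs) hc0.le).trans (hPge s hs))
  have hPslit : ∀ s ∈ Set.Icc (0 : ℝ) 1, P s ∈ Complex.slitPlane := fun s hs =>
    segment_mem_slitPlane hκ1 (norm_pos_iff.1 hξn) hξ hT0 hs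
  have hP0 : ∀ s ∈ Set.Icc (0 : ℝ) 1, P s ≠ 0 := fun s hs => Complex.slitPlane_ne_zero (hPslit s hs)
  have hPd : ∀ s : ℝ, HasDerivAt P (T - ξ) s := fun s => by
    refine (((Complex.ofRealCLM.hasDerivAt (x := s)).mul_const ((T : ℂ) - ξ)).const_add
      ξ).congr_deriv ?_
    simp
  set l : ℝ → ℂ := fun s => logPoint γ (P s) with hl
  have hld : ∀ s ∈ Set.Icc (0 : ℝ) 1, HasDerivAt l (2 / 5 / P s * (T - ξ)) s := fun s hs =>
    (hasDerivAt_logPoint (hPslit s hs)).comp s (hPd s)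
  have hTξ : ‖(T : ℂ) - ξ‖ ≤ 2 * β := by
    refine (norm_sub_le _ _).trans ?_
    rw [Complex.norm_real, Real.norm_of_nonneg hT0.le]
    linarith
  have est := amplitude_segment_estimate (a := fun s => A (l s)) (b := fun s => B (l s))
    (f := fun s => F (l s) * (2 / 5 / P s * (T - ξ)))
    (p := fun s => 2 * phaseDeriv z ς (l s) * (2 / 5 / P s * (T - ξ)))
    (κ := fun s => -(5 * K₁) * m s ^ (-(1 / 5) : ℝ))
    (k := fun s => K₁ * β * m s ^ (-(6 / 5) : ℝ)) (J := J)
    (M := Real.exp (4 * J) * (‖A (l 1)‖ ^ 2 + ‖B (l 1)‖ ^ 2))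
    (fun s hs => ?_) (fun s hs => ?_) (fun s hs => ?_) (fun s hs => ?_) (fun s hs => ?_)
    (fun s hs => ?_) ?_ rfl
  · have hl0 : l 0 = logPoint γ ξ := by simp [hl, hP]
    have hl1 : l 1 = logPoint γ T := by simp [hl, hP]
    rw [hl0, hl1] at est
    have hJ0 : 0 ≤ J := by rw [hJ]; positivity
    have hJK : J ≤ 5 * K₁ := by
      rw [hJ]
      refine mul_le_of_le_one_right (by positivity) ?_
      exact Real.rpow_le_one_of_one_le_of_nonpos hξ1 (by norm_num)
    have hMM : Real.exp (4 * J) * (‖A (logPoint γ T)‖ ^ 2 + ‖B (logPoint γ T)‖ ^ 2) ≤ M := by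
      rw [hM]; gcongr
    obtain ⟨e1, e2, e3⟩ := est
    refine ⟨e1.trans hMM, e2.trans ?_, e3.trans ?_⟩
    · gcongr
    · gcongr
  · have h := (hF (l s) (hR₁ _ (hPR s hs)).1).1
    refine (h.comp s (hld s hs)).congr_deriv ?_
    ring
  · have h := (hF (l s) (hR₁ _ (hPR s hs)).1).2.1
    refine (h.comp s (hld s hs)).congr_deriv ?_
    ring
  · -- the phase grows along the segment because its direction tends to the positive real axis
    have e1 : 2 * phaseDeriv z ς (l s) * (2 / 5 / P s * (T - ξ))
        = ((4 / 5 : ℝ) : ℂ) * (c₀ * (2 - z / 2 * Complex.exp (-2 * l s)) * (T - ξ)) := by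
      have e2 : Complex.exp (5 * l s / 2) = Complex.exp (5 * γ / 2 * Complex.I) * P s :=
        exp_logPoint (hP0 s hs)
      have e3 : Complex.exp (l s / 2) = Complex.exp (5 * l s / 2) * Complex.exp (-2 * l s) := by
        rw [← Complex.exp_add]; congr 1; ring
      rw [phaseDeriv, e3, e2, hc₀]
      have := hP0 s hs
      push_cast
      field_simp
      ring
    rw [e1, Complex.re_ofReal_mul]
    refine mul_nonneg (by norm_num) ?_
    set η := z / 2 * Complex.exp (-2 * l s) with hη
    have hηr : ‖η‖ ≤ r := (hR₁ _ (hPR s hs)).2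
    have e4 : (c₀ * (2 - η) * (T - ξ)).re = 2 * r * T - (2 * c₀ * ξ).re
        - (c₀ * η * (T - ξ)).re := by
      rw [show c₀ * (2 - η) * (T - ξ) = ((2 * T : ℝ) : ℂ) * c₀ - 2 * c₀ * ξ - c₀ * η * (T - ξ) by
        push_cast; ring, Complex.sub_re, Complex.sub_re, Complex.re_ofReal_mul]
      ring
    have e5 : (2 * c₀ * ξ).re ≤ 2 * ‖ξ‖ := by
      refine (Complex.re_le_norm _).trans ?_
      rw [norm_mul, norm_mul, hc₀n]; simp
    have e6 : (c₀ * η * (T - ξ)).re ≤ r * (T + ‖ξ‖) := by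
      refine (Complex.re_le_norm _).trans ?_
      rw [norm_mul, norm_mul, hc₀n, one_mul]
      refine mul_le_mul hηr ((norm_sub_le _ _).trans ?_) (norm_nonneg _) hγ.le
      rw [Complex.norm_real, Real.norm_of_nonneg hT0.le]
    have e7 : (2 + r) * ‖ξ‖ ≤ r * T := by
      have := mul_le_mul_of_nonneg_left hT2 hγ.le
      have h2 : r * ((2 / r + 1) * ‖ξ‖) = (2 + r) * ‖ξ‖ := by field_simp
      linarith
    rw [e4]
    linarith
  · have hm0 : m s ≠ 0 := (hξn.trans_le (hmpos s hs)).ne'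
    have h1 : HasDerivAt m β s :=
      (((hasDerivAt_id s).mul_const β).const_add ‖ξ‖).congr_deriv (one_mul β)
    refine ((h1.rpow_const (p := (-(1 / 5) : ℝ)) (Or.inl hm0)).const_mul (-(5 * K₁))).congr_deriv ?_
    rw [show (-(1 / 5) - 1 : ℝ) = -(6 / 5) by norm_num]
    ring
  · have h := (hF (l s) (hR₁ _ (hPR s hs)).1).2.2
    have hmp := hξn.trans_le (hmpos s hs)
    have hPp : 0 < ‖P s‖ := norm_pos_iff.2 (hP0 s hs)
    rw [exp_neg_logPoint_re γ (hP0 s hs)] at h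
    have e1 : ‖(2 / 5 / P s * (T - ξ) : ℂ)‖ ≤ 4 / 5 * β * ‖P s‖ ^ (-1 : ℝ) := by
      rw [norm_mul, norm_div, Real.rpow_neg_one]
      have : ‖(2 / 5 : ℂ)‖ = 2 / 5 := by simp
      rw [this]
      calc 2 / 5 / ‖P s‖ * ‖(T : ℂ) - ξ‖ ≤ 2 / 5 / ‖P s‖ * (2 * β) := by gcongr
        _ = 4 / 5 * β * ‖P s‖⁻¹ := by ring
    have e2 : ‖P s‖ ^ (-(1 / 5) : ℝ) * ‖P s‖ ^ (-1 : ℝ) ≤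
        c ^ (-(6 / 5) : ℝ) * m s ^ (-(6 / 5) : ℝ) := by
      rw [← Real.rpow_add hPp, ← Real.mul_rpow hc0.le hmp.le]
      rw [show (-(1 / 5) + -1 : ℝ) = -(6 / 5) by norm_num]
      exact Real.rpow_le_rpow_of_nonpos (by positivity) (hPge s hs) (by norm_num)
    rw [norm_mul]
    calc ‖F (l s)‖ * ‖(2 / 5 / P s * (T - ξ) : ℂ)‖
        ≤ C * ‖P s‖ ^ (-(1 / 5) : ℝ) * (‖A (l s)‖ + ‖B (l s)‖) *
          (4 / 5 * β * ‖P s‖ ^ (-1 : ℝ)) := by gcongr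
      _ = 4 / 5 * C * β * (‖A (l s)‖ + ‖B (l s)‖) *
          (‖P s‖ ^ (-(1 / 5) : ℝ) * ‖P s‖ ^ (-1 : ℝ)) := by ring
      _ ≤ 4 / 5 * C * β * (‖A (l s)‖ + ‖B (l s)‖) *
          (c ^ (-(6 / 5) : ℝ) * m s ^ (-(6 / 5) : ℝ)) := by gcongr
      _ = K₁ * β * m s ^ (-(6 / 5) : ℝ) * (‖A (l s)‖ + ‖B (l s)‖) := by rw [hK₁]; ring
  · have := hξn.trans_le (hmpos s hs)
    positivity
  · rw [hJ]
    have h0 : m 0 = ‖ξ‖ := by simp [hm]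
    have : 0 ≤ m 1 ^ (-(1 / 5) : ℝ) :=
      Real.rpow_nonneg (hξn.le.trans (hmpos 1 ⟨zero_le_one, le_rfl⟩)) _
    simp only [h0]
    have := mul_nonneg (mul_nonneg (by norm_num : (0 : ℝ) ≤ 5) hK₁0) this
    linarith

/-! ### Recessive amplitudes in wide sectors -/

/-- In the variable `l = log x`, the filter of points going to infinity inside the sector
`|arg x - γ| < ρ`. -/
def logSector (γ ρ : ℝ) : Filter ℂ :=
  comap Complex.re atTop ⊓ 𝓟 {l | |l.im - γ| < ρ}

/-- The amplitudes are those of the recessive solution along the ray `arg x = γ`. -/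
def IsRecessiveAlong (γ : ℝ) (A B : ℂ → ℂ) : Prop :=
  Tendsto (fun t : ℝ => A (Complex.I * γ + t)) atTop (𝓝 1) ∧
  Tendsto (fun t : ℝ => B (Complex.I * γ + t)) atTop (𝓝 0)

theorem logSector_mono {γ ρ γ' ρ' : ℝ} (h : |γ - γ'| + ρ ≤ ρ') :
    logSector γ ρ ≤ logSector γ' ρ' := by
  refine inf_le_inf_left _ (principal_mono.2 fun l hl => ?_)
  have := abs_sub_le l.im γ γ'
  simp only [Set.mem_ofPred_eq] at hl ⊢
  linarith

theorem tendsto_ray_logSector {γ γ' ρ : ℝ} (h : |γ' - γ| < ρ) :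
    Tendsto (fun t : ℝ => Complex.I * γ' + t) atTop (logSector γ ρ) := by
  refine tendsto_inf.2 ⟨tendsto_comap_iff.2 ?_, tendsto_principal.2 (Eventually.of_forall ?_)⟩
  · refine tendsto_id.congr fun t => ?_
    simp
  · intro t
    simpa using h

theorem logSector_neBot {γ ρ : ℝ} (h : 0 < ρ) : (logSector γ ρ).NeBot :=
  (tendsto_ray_logSector (γ' := γ) (by simpa using h)).neBot

theorem logPoint_ofReal {γ T : ℝ} (hT : 0 < T) :
    logPoint γ T = Complex.I * γ + (2 / 5 * Real.log T : ℝ) := by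
  rw [logPoint, ← Complex.ofReal_log hT.le]; push_cast; ring

theorem tendsto_two_fifths_log : Tendsto (fun T : ℝ => 2 / 5 * Real.log T) atTop atTop :=
  Real.tendsto_log_atTop.const_mul_atTop (by norm_num)

theorem IsRecessiveAlong.tendsto_logPoint {γ : ℝ} {A B : ℂ → ℂ} (h : IsRecessiveAlong γ A B) :
    Tendsto (fun T : ℝ => A (logPoint γ T)) atTop (𝓝 1) ∧
    Tendsto (fun T : ℝ => B (logPoint γ T)) atTop (𝓝 0) := by
  refine ⟨(h.1.comp tendsto_two_fifths_log).congr' ?_, (h.2.comp tendsto_two_fifths_log).congr' ?_⟩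
  all_goals
    filter_upwards [eventually_gt_atTop 0] with T hT
    rw [logPoint_ofReal hT]; rfl

/-- Recessiveness along the ray `arg x = γ` propagates to the sector of half-width `2π/5` about
it. -/
theorem IsRecessiveAlong.tendsto {z ς : ℂ} (hς : ‖ς‖ = 1) {L C γ ρ : ℝ} (hC : 0 ≤ C)
    (hγ : 0 < (ς * Complex.exp (5 * γ / 2 * Complex.I)).re) (hρ0 : 0 < ρ)
    (hρ : ρ < 2 * Real.pi / 5) {A B : ℂ → ℂ} (hAB : IsAmplitude z ς L C A B)
    (h : IsRecessiveAlong γ A B) :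
    Tendsto A (logSector γ ρ) (𝓝 1) ∧ Tendsto B (logSector γ ρ) (𝓝 0) := by
  -- in the variable `ξ = x ^ (5/2)` the sector is contained in the cone `-κ |ξ| ≤ Re ξ`
  set κ := max 0 (-Real.cos (5 / 2 * ρ)) with hκ
  have hκ1 : κ < 1 := by
    refine max_lt one_pos ?_
    have := Real.cos_lt_cos_of_nonneg_of_le_pi (x := 5 / 2 * ρ) (y := Real.pi) (by positivity)
      le_rfl (by linarith)
    rw [Real.cos_pi] at this
    linarith
  obtain ⟨R, K, hR, hK, est⟩ := amplitude_cone_estimate z ς hς L C γ κ hC hγ (le_max_left _ _) hκ1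
  obtain ⟨hA, hB⟩ := h.tendsto_logPoint
  set E := Real.exp (4 * K) with hE
  have hM : Tendsto (fun T : ℝ => E * (‖A (logPoint γ T)‖ ^ 2 + ‖B (logPoint γ T)‖ ^ 2)) atTop
      (𝓝 E) := by
    have := ((hA.norm.pow 2).add (hB.norm.pow 2)).const_mul E
    simpa using this
  have bound : ∀ᶠ l in logSector γ ρ, ‖A l - 1‖ ≤ 2 * (K * Real.exp (-l.re / 2)) * √E ∧
      ‖B l‖ ^ 2 ≤ 4 * (K * Real.exp (-l.re / 2)) * E := by
    have hre : ∀ᶠ l in comap Complex.re atTop, Real.log R ≤ l.re :=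
      tendsto_comap.eventually (eventually_ge_atTop (Real.log R))
    filter_upwards [hre.filter_mono inf_le_left, mem_inf_of_right (mem_principal_self _)]
      with l hl1 hl2
    replace hl2 : |l.im - γ| < ρ := hl2
    set ξ := Complex.exp (5 / 2 * (l - Complex.I * γ)) with hξ
    have him : (5 / 2 * (l - Complex.I * γ)).im = 5 / 2 * (l.im - γ) := by
      rw [show (5 / 2 : ℂ) = ((5 / 2 : ℝ) : ℂ) by norm_num, Complex.im_ofReal_mul]; simp
    have hre : (5 / 2 * (l - Complex.I * γ)).re = 5 / 2 * l.re := by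
      rw [show (5 / 2 : ℂ) = ((5 / 2 : ℝ) : ℂ) by norm_num, Complex.re_ofReal_mul]; simp
    have habs : |5 / 2 * (l.im - γ)| ≤ 5 / 2 * ρ := by
      rw [abs_mul, abs_of_pos (by norm_num : (0 : ℝ) < 5 / 2)]; linarith
    have hlog : logPoint γ ξ = l := by
      rw [logPoint, hξ, Complex.log_exp]
      · ring
      · rw [him]; linarith [(abs_le.1 habs).1]
      · rw [him]; linarith [(abs_le.1 habs).2]
    have hξ0 : ξ ≠ 0 := Complex.exp_ne_zero _
    have hn : ‖ξ‖ = Real.exp (5 / 2 * l.re) := by rw [hξ, Complex.norm_exp, hre]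
    have hRξ : R ≤ ‖ξ‖ := by
      rw [hn, ← Real.log_le_iff_le_exp (by linarith)]
      linarith [Real.log_nonneg hR]
    have hcone : -(κ * ‖ξ‖) ≤ ξ.re := by
      have e : ξ.re = ‖ξ‖ * Real.cos (5 / 2 * (l.im - γ)) := by
        rw [hξ, Complex.exp_re, Complex.norm_exp, him]
      have hc : Real.cos (5 / 2 * ρ) ≤ Real.cos (5 / 2 * (l.im - γ)) := by
        rw [← Real.cos_abs (5 / 2 * (l.im - γ))]
        exact Real.cos_le_cos_of_nonneg_of_le_pi (abs_nonneg _) (by linarith) habs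
      have hk : -Real.cos (5 / 2 * ρ) ≤ κ := le_max_right _ _
      rw [e]
      nlinarith [norm_nonneg ξ]
    have ev := (est ξ hRξ hcone).mono fun T h => h A B hAB
    have hJ : K * ‖ξ‖ ^ (-(1 / 5) : ℝ) = K * Real.exp (-l.re / 2) := by
      rw [← exp_neg_logPoint_re γ hξ0, hlog]
    simp only [hJ, hlog] at ev
    constructor
    · refine le_of_tendsto_of_tendsto (hA.const_sub (A l)).norm (hM.sqrt.const_mul _)
        (ev.mono fun T hT => (hT _ _ rfl rfl).2.1)
    · have h2 := (hB.norm.pow 2).add (hM.const_mul (4 * (K * Real.exp (-l.re / 2))))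
      simp only [norm_zero, ne_eq, OfNat.ofNat_ne_zero, not_false_eq_true, zero_pow, zero_add] at h2
      exact ge_of_tendsto h2 (ev.mono fun T hT => (hT _ _ rfl rfl).2.2)
  have hexp : Tendsto (fun l : ℂ => Real.exp (-l.re / 2)) (logSector γ ρ) (𝓝 0) := by
    have h1 : Tendsto (fun l : ℂ => l.re) (logSector γ ρ) atTop :=
      tendsto_comap.mono_left inf_le_left
    have h2 := Real.tendsto_exp_neg_atTop_nhds_zero.comp (h1.atTop_div_const (two_pos))
    refine h2.congr fun l => ?_
    simp [neg_div]
  constructor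
  · rw [tendsto_iff_norm_sub_tendsto_zero]
    refine squeeze_zero' (Eventually.of_forall fun _ => norm_nonneg _)
      (bound.mono fun l h => h.1) ?_
    simpa using ((hexp.const_mul K).const_mul 2).mul_const √E
  · have : Tendsto (fun l => ‖B l‖ ^ 2) (logSector γ ρ) (𝓝 0) := by
      refine squeeze_zero' (Eventually.of_forall fun _ => sq_nonneg _)
        (bound.mono fun l h => h.2) ?_
      simpa using ((hexp.const_mul K).const_mul 4).mul_const E
    rw [tendsto_zero_iff_norm_tendsto_zero]
    have h2 := this.sqrt
    simpa using h2

/-- In a two-dimensional space of amplitudes there is a recessive one: it is a limit of the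
amplitudes normalised to `(1, 0)` at points going to infinity. -/
theorem exists_isRecessiveAlong {z ς : ℂ} (hς : ‖ς‖ = 1) {L C γ : ℝ} (hC : 0 ≤ C)
    (hγ : 0 < (ς * Complex.exp (5 * γ / 2 * Complex.I)).re) {A₁ B₁ A₂ B₂ : ℂ → ℂ}
    (hAB : ∀ a b : ℂ, IsAmplitude z ς L C (fun l => a * A₁ l + b * A₂ l)
      (fun l => a * B₁ l + b * B₂ l))
    (hdet : ∀ l : ℂ, L < l.re → A₁ l * B₂ l - A₂ l * B₁ l ≠ 0) :
    ∃ a b : ℂ, IsRecessiveAlong γ (fun l => a * A₁ l + b * A₂ l)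
      (fun l => a * B₁ l + b * B₂ l) := by
  obtain ⟨R, K, hR, hK, est⟩ := amplitude_cone_estimate z ς hς L C γ 0 hC hγ le_rfl one_pos
  obtain ⟨T₁, hT₁⟩ := eventually_atTop.1 (tendsto_two_fifths_log.eventually_gt_atTop L)
  have hdet' : ∀ T : ℝ, T₁ ≤ T → 0 < T →
      A₁ (logPoint γ T) * B₂ (logPoint γ T) - A₂ (logPoint γ T) * B₁ (logPoint γ T) ≠ 0 := by
    intro T h1 h2
    refine hdet _ ?_
    rw [logPoint_re, Complex.norm_real, Real.norm_of_nonneg h2.le]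
    exact hT₁ T h1
  set d : ℝ → ℂ := fun T =>
    A₁ (logPoint γ T) * B₂ (logPoint γ T) - A₂ (logPoint γ T) * B₁ (logPoint γ T) with hd
  -- coefficients for which the amplitudes at `logPoint γ n` are `(1, 0)`
  set u : ℕ → ℂ × ℂ := fun n => (B₂ (logPoint γ (n : ℝ)) / d n, -B₁ (logPoint γ (n : ℝ)) / d n)
    with hu
  have hcone : ∀ t : ℝ, R ≤ t → R ≤ ‖(t : ℂ)‖ ∧ -(0 * ‖(t : ℂ)‖) ≤ (t : ℂ).re := fun t ht => by
    rw [Complex.norm_real, Real.norm_of_nonneg (by linarith)]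
    refine ⟨ht, ?_⟩
    simp; linarith
  set E := Real.exp (4 * K) with hE
  have hnorm : ∀ᶠ n : ℕ in atTop,
      (u n).1 * A₁ (logPoint γ (n : ℝ)) + (u n).2 * A₂ (logPoint γ (n : ℝ)) = 1 ∧
      (u n).1 * B₁ (logPoint γ (n : ℝ)) + (u n).2 * B₂ (logPoint γ (n : ℝ)) = 0 := by
    filter_upwards [(tendsto_natCast_atTop_atTop (R := ℝ)).eventually_ge_atTop T₁,
      eventually_gt_atTop 0] with n hn hn0
    have hdn : d n ≠ 0 := hdet' n hn (by exact_mod_cast hn0)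
    simp only [hu]
    constructor
    · field_simp
      simp only [hd]
      ring
    · field_simp
      ring
  have bound : ∀ t : ℝ, R ≤ t → ∀ᶠ n : ℕ in atTop,
      ‖(u n).1 * A₁ (logPoint γ t) + (u n).2 * A₂ (logPoint γ t)‖ ^ 2
        + ‖(u n).1 * B₁ (logPoint γ t) + (u n).2 * B₂ (logPoint γ t)‖ ^ 2 ≤ E ∧
      ‖(u n).1 * A₁ (logPoint γ t) + (u n).2 * A₂ (logPoint γ t) - 1‖
        ≤ 2 * (K * t ^ (-(1 / 5) : ℝ)) * √E ∧
      ‖(u n).1 * B₁ (logPoint γ t) + (u n).2 * B₂ (logPoint γ t)‖ ^ 2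
        ≤ 4 * (K * t ^ (-(1 / 5) : ℝ)) * E := by
    intro t ht
    obtain ⟨h1, h2⟩ := hcone t ht
    filter_upwards [hnorm, tendsto_natCast_atTop_atTop.eventually (est t h1 h2)] with n hn hn2
    have h := hn2 _ _ (hAB (u n).1 (u n).2) _ _ rfl rfl
    simp only [hn.1, hn.2, norm_one, norm_zero, Complex.norm_real,
      Real.norm_of_nonneg (show 0 ≤ t by linarith)] at h
    norm_num at h
    simpa using h
  set t₀ := max R T₁ with ht₀
  have ht₀R : R ≤ t₀ := le_max_left _ _
  have hd₀ : d t₀ ≠ 0 := hdet' t₀ (le_max_right _ _) (by linarith)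
  -- the coefficients stay bounded because the amplitudes at the fixed point `t₀` do
  obtain ⟨c, hc⟩ : ∃ c : ℝ, ∀ᶠ n in atTop, u n ∈ Metric.closedBall (0 : ℂ × ℂ) c := by
    set m₁ := ‖A₁ (logPoint γ t₀)‖
    set m₂ := ‖A₂ (logPoint γ t₀)‖
    set m₃ := ‖B₁ (logPoint γ t₀)‖
    set m₄ := ‖B₂ (logPoint γ t₀)‖
    refine ⟨(√E * (m₁ + m₂ + m₃ + m₄)) / ‖d t₀‖, ?_⟩
    filter_upwards [bound t₀ ht₀R] with n hn
    set a := (u n).1 * A₁ (logPoint γ t₀) + (u n).2 * A₂ (logPoint γ t₀) with ha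
    set b := (u n).1 * B₁ (logPoint γ t₀) + (u n).2 * B₂ (logPoint γ t₀) with hb
    have ha' : ‖a‖ ≤ √E := Real.le_sqrt_of_sq_le (by nlinarith [hn.1, sq_nonneg ‖b‖])
    have hb' : ‖b‖ ≤ √E := Real.le_sqrt_of_sq_le (by nlinarith [hn.1, sq_nonneg ‖a‖])
    have hd₀' : 0 < ‖d t₀‖ := norm_pos_iff.2 hd₀
    have hE0 : 0 ≤ √E := Real.sqrt_nonneg _
    have n1 : 0 ≤ m₁ := norm_nonneg _
    have n2 : 0 ≤ m₂ := norm_nonneg _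
    have n3 : 0 ≤ m₃ := norm_nonneg _
    have n4 : 0 ≤ m₄ := norm_nonneg _
    have e1 : (u n).1 * d t₀ = a * B₂ (logPoint γ t₀) - b * A₂ (logPoint γ t₀) := by
      rw [ha, hb]; simp only [hd]; ring
    have e2 : (u n).2 * d t₀ = b * A₁ (logPoint γ t₀) - a * B₁ (logPoint γ t₀) := by
      rw [ha, hb]; simp only [hd]; ring
    rw [mem_closedBall_zero_iff, Prod.norm_def, max_le_iff]
    constructor
    · rw [le_div_iff₀ hd₀', ← norm_mul, e1]
      refine (norm_sub_le _ _).trans ?_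
      rw [norm_mul, norm_mul]
      have q1 := mul_le_mul_of_nonneg_right ha' n4
      have q2 := mul_le_mul_of_nonneg_right hb' n2
      nlinarith [mul_nonneg hE0 n1, mul_nonneg hE0 n3]
    · rw [le_div_iff₀ hd₀', ← norm_mul, e2]
      refine (norm_sub_le _ _).trans ?_
      rw [norm_mul, norm_mul]
      have q1 := mul_le_mul_of_nonneg_right ha' n3
      have q2 := mul_le_mul_of_nonneg_right hb' n1
      nlinarith [mul_nonneg hE0 n2, mul_nonneg hE0 n4]
  obtain ⟨v, -, φ, hφ, hv⟩ := (isCompact_closedBall (0 : ℂ × ℂ) c).tendsto_subseq' hc.frequently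
  refine ⟨v.1, v.2, ?_⟩
  have lim : ∀ x y : ℂ, Tendsto (fun n => (u (φ n)).1 * x + (u (φ n)).2 * y) atTop
      (𝓝 (v.1 * x + v.2 * y)) := fun x y =>
    (((continuous_fst.tendsto v).comp hv).mul_const x).add
      (((continuous_snd.tendsto v).comp hv).mul_const y)
  have bound' : ∀ t : ℝ, R ≤ t →
      ‖v.1 * A₁ (logPoint γ t) + v.2 * A₂ (logPoint γ t) - 1‖
        ≤ 2 * (K * t ^ (-(1 / 5) : ℝ)) * √E ∧
      ‖v.1 * B₁ (logPoint γ t) + v.2 * B₂ (logPoint γ t)‖ ^ 2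
        ≤ 4 * (K * t ^ (-(1 / 5) : ℝ)) * E := fun t ht =>
    ⟨le_of_tendsto ((lim _ _).sub_const 1).norm
      ((hφ.tendsto_atTop.eventually (bound t ht)).mono fun n h => h.2.1),
     le_of_tendsto ((lim _ _).norm.pow 2)
      ((hφ.tendsto_atTop.eventually (bound t ht)).mono fun n h => h.2.2)⟩
  -- points `I γ + t` of the ray are the points `logPoint γ (exp (5 t / 2))`
  have hpt : ∀ t : ℝ, logPoint γ (Real.exp (5 / 2 * t)) = Complex.I * γ + t := fun t => by
    rw [logPoint_ofReal (Real.exp_pos _), Real.log_exp]; push_cast; ring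
  have hpow : Tendsto (fun t : ℝ => (Real.exp (5 / 2 * t)) ^ (-(1 / 5) : ℝ)) atTop (𝓝 0) :=
    (tendsto_rpow_neg_atTop (by norm_num : (0 : ℝ) < 1 / 5)).comp
      (Real.tendsto_exp_atTop.comp (tendsto_id.const_mul_atTop (by norm_num)))
  have hev : ∀ᶠ t : ℝ in atTop, R ≤ Real.exp (5 / 2 * t) :=
    (Real.tendsto_exp_atTop.comp (tendsto_id.const_mul_atTop (by norm_num))).eventually_ge_atTop R
  constructor
  · rw [tendsto_iff_norm_sub_tendsto_zero]
    refine squeeze_zero' (Eventually.of_forall fun _ => norm_nonneg _)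
      (hev.mono fun t ht => ?_) (g := fun t =>
        2 * (K * (Real.exp (5 / 2 * t)) ^ (-(1 / 5) : ℝ)) * √E) ?_
    · simpa only [hpt] using (bound' _ ht).1
    · simpa using ((hpow.const_mul K).const_mul 2).mul_const √E
  · have : Tendsto (fun t : ℝ => ‖v.1 * B₁ (Complex.I * γ + t) + v.2 * B₂ (Complex.I * γ + t)‖ ^ 2)
        atTop (𝓝 0) := by
      refine squeeze_zero' (Eventually.of_forall fun _ => sq_nonneg _)
        (hev.mono fun t ht => ?_) (g := fun t =>
          4 * (K * (Real.exp (5 / 2 * t)) ^ (-(1 / 5) : ℝ)) * E) ?_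
      · simpa only [hpt] using (bound' _ ht).2
      · simpa using ((hpow.const_mul K).const_mul 4).mul_const E
    rw [tendsto_zero_iff_norm_tendsto_zero]
    simpa using this.sqrt

/-! ### WKB amplitudes of entire solutions -/

/-- The phase `S = ς ((4/5) x ^ (5/2) - z x ^ (1/2))` in the variable `l = log x`. -/
def phase (z ς l : ℂ) : ℂ :=
  ς * (4 / 5 * Complex.exp (5 * l / 2) - z * Complex.exp (l / 2))

/-- The function `x ^ (1/4) h x` in the variable `l = log x`; this is, up to a factor tending to
`1`, `x ^ (3/4)` times the solution `(x - y) ^ (-1/2) h` of the oscillator equation. -/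
def scaled (h : ℂ → ℂ) (l : ℂ) : ℂ := Complex.exp (l / 4) * h (Complex.exp l)

/-- The derivative of `scaled h`. -/
def scaledDeriv (h : ℂ → ℂ) (l : ℂ) : ℂ :=
  Complex.exp (l / 4) * (h (Complex.exp l) / 4 + Complex.exp l * deriv h (Complex.exp l))

/-- The amplitude of `exp (-S)` in `scaled h`. -/
def ampA (z ς : ℂ) (h : ℂ → ℂ) (l : ℂ) : ℂ :=
  Complex.exp (phase z ς l) * (phaseDeriv z ς l * scaled h l - scaledDeriv h l) /
    (2 * phaseDeriv z ς l)

/-- The amplitude of `exp S` in `scaled h`, multiplied by `exp (2 S)`. -/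
def ampB (z ς : ℂ) (h : ℂ → ℂ) (l : ℂ) : ℂ :=
  Complex.exp (phase z ς l) * (scaledDeriv h l + phaseDeriv z ς l * scaled h l) /
    (2 * phaseDeriv z ς l)

theorem hasDerivAt_exp_quarter (l : ℂ) :
    HasDerivAt (fun l : ℂ => Complex.exp (l / 4)) (Complex.exp (l / 4) / 4) l := by
  refine (((hasDerivAt_id l).div_const 4).cexp).congr_deriv ?_
  simp only [id]; ring

theorem hasDerivAt_exp_half (l : ℂ) :
    HasDerivAt (fun l : ℂ => Complex.exp (l / 2)) (Complex.exp (l / 2) / 2) l := by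
  refine (((hasDerivAt_id l).div_const 2).cexp).congr_deriv ?_
  simp only [id]; ring

theorem hasDerivAt_exp_five_halves (l : ℂ) :
    HasDerivAt (fun l : ℂ => Complex.exp (5 * l / 2)) (5 / 2 * Complex.exp (5 * l / 2)) l := by
  refine ((((hasDerivAt_id l).const_mul 5).div_const 2).cexp).congr_deriv ?_
  simp only [id]; ring

theorem hasDerivAt_phase (z ς l : ℂ) : HasDerivAt (phase z ς) (phaseDeriv z ς l) l := by
  refine ((((hasDerivAt_exp_five_halves l).const_mul (4 / 5)).sub
    ((hasDerivAt_exp_half l).const_mul z)).const_mul ς).congr_deriv ?_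
  rw [phaseDeriv]; ring

theorem hasDerivAt_phaseDeriv (z ς l : ℂ) : HasDerivAt (phaseDeriv z ς)
    (ς * (5 * Complex.exp (5 * l / 2) - z / 4 * Complex.exp (l / 2))) l := by
  refine ((((hasDerivAt_exp_five_halves l).const_mul 2).sub
    ((hasDerivAt_exp_half l).const_mul (z / 2))).const_mul ς).congr_deriv ?_
  ring

section
variable {y y' z : ℂ}

theorem IsEntireSol.hasDerivAt_scaled {h : ℂ → ℂ} (hh : IsEntireSol y y' z h) (l : ℂ) :
    HasDerivAt (scaled h) (scaledDeriv h l) l := by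
  refine ((hasDerivAt_exp_quarter l).mul
    ((hh.hasDerivAt _).comp l (Complex.hasDerivAt_exp l))).congr_deriv ?_
  rw [scaledDeriv, Function.comp_apply]; ring

theorem IsEntireSol.hasDerivAt_scaledDeriv {h : ℂ → ℂ} (hh : IsEntireSol y y' z h) {l : ℂ}
    (hl : Complex.exp l - y ≠ 0) :
    HasDerivAt (scaledDeriv h)
      ((5 / 2 + y / (Complex.exp l - y)) * (scaledDeriv h l - scaled h l / 4)
      + (1 / 16 + Complex.exp l ^ 2 * G y y' z (Complex.exp l) / (Complex.exp l - y))
        * scaled h l) l := by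
  have h1 := (hh.hasDerivAt _).comp l (Complex.hasDerivAt_exp l)
  have h2 := (hh.hasDerivAt_deriv _).comp l (Complex.hasDerivAt_exp l)
  refine ((hasDerivAt_exp_quarter l).mul
    ((h1.div_const 4).add ((Complex.hasDerivAt_exp l).mul h2))).congr_deriv ?_
  simp only [Function.comp_apply, Pi.mul_apply, Pi.add_apply]
  have e := hh.eq (Complex.exp l)
  set x := Complex.exp l
  have e' : deriv (deriv h) x = (deriv h x + G y y' z x * h x) / (x - y) := by
    rw [← e]; field_simp
  rw [scaledDeriv, scaled, e']
  field_simp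
  ring

/-- The WKB estimate: in the variable `l = log x` the phase solves the Riccati equation up to
integrable errors. -/
theorem exists_isAmplitude (y y' z ς : ℂ) (hς : ς ^ 2 = 1) :
    ∃ L C : ℝ, 0 ≤ C ∧ (∀ l : ℂ, L < l.re → phaseDeriv z ς l ≠ 0 ∧ Complex.exp l - y ≠ 0) ∧
      ∀ h, IsEntireSol y y' z h → IsAmplitude z ς L C (ampA z ς h) (ampB z ς h) := by
  have hςn : ‖ς‖ = 1 := by
    have := congrArg norm hς
    rw [norm_pow, norm_one] at this
    exact (pow_eq_one_iff_of_nonneg (norm_nonneg _) two_ne_zero).1 this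
  set c := 2 * z * y - 4 * y ^ 3 + y' ^ 2 with hc
  -- for `|x| ^ (1/2) ≥ m` the leading terms of `x - y` and of `S'` dominate the other ones
  set m := 2 * (‖y‖ + ‖z‖ + 1) with hm
  have py := norm_nonneg y
  have pz := norm_nonneg z
  have hm0 : 0 < m := by positivity
  set K := 4 + ‖y‖ + 2 * ‖y'‖ + ‖z‖ ^ 2 + ‖c‖ with hK
  have basic : ∀ l : ℂ, 2 * Real.log m < l.re → ∀ ρ : ℝ, ρ = ‖Complex.exp (l / 2)‖ →
      m ≤ ρ ∧ ρ⁻¹ = Real.exp (-l.re / 2) ∧ ρ ^ 2 / 2 ≤ ‖Complex.exp l - y‖ ∧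
      ρ ^ 5 ≤ ‖phaseDeriv z ς l‖ := by
    intro l hl ρ hρ
    have e1 : (l / 2).re = l.re / 2 := by
      rw [show l / 2 = ((1 / 2 : ℝ) : ℂ) * l by push_cast; ring, Complex.re_ofReal_mul]; ring
    have hρ' : ρ = Real.exp (l.re / 2) := by rw [hρ, Complex.norm_exp, e1]
    have hmρ : m ≤ ρ := by
      rw [hρ', ← Real.log_le_iff_le_exp hm0]; linarith
    have hρ1 : 1 ≤ ρ := by linarith
    refine ⟨hmρ, ?_, ?_, ?_⟩
    · rw [hρ', ← Real.exp_neg]; congr 1; ring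
    · have e2 : ‖Complex.exp l‖ = ρ ^ 2 := by
        rw [hρ, ← norm_pow, ← Complex.exp_nat_mul]; congr 2; push_cast; ring
      have e3 := norm_sub_norm_le (Complex.exp l) y
      rw [e2] at e3
      nlinarith
    · have e2 : phaseDeriv z ς l =
          ς * (2 * Complex.exp (l / 2) ^ 5 - z / 2 * Complex.exp (l / 2)) := by
        rw [phaseDeriv, ← Complex.exp_nat_mul]; congr 4; push_cast; ring
      have e3 := norm_sub_norm_le (2 * Complex.exp (l / 2) ^ 5) (z / 2 * Complex.exp (l / 2))
      rw [e2, norm_mul, hςn, one_mul]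
      refine le_trans ?_ e3
      rw [norm_mul, norm_mul, norm_pow, norm_div, ← hρ]
      simp only [Complex.norm_ofNat]
      have : ρ ≤ ρ ^ 4 := le_self_pow₀ hρ1 (by norm_num)
      nlinarith
  -- the error is what remains of the second order equation once the growth of `exp (-S)` and `exp S`
  -- is split off
  refine ⟨2 * Real.log m, ‖z‖ + ‖y‖ + K, by positivity, fun l hl => ?_, fun h hh => ⟨fun l =>
    1 / 2 * (5 / 2 + y / (Complex.exp l - y)
      - ς * (5 * Complex.exp (5 * l / 2) - z / 4 * Complex.exp (l / 2)) / phaseDeriv z ς l)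
      * (ampB z ς h l - ampA z ς h l)
    + (1 / 16 + Complex.exp l ^ 2 * G y y' z (Complex.exp l) / (Complex.exp l - y)
      - (5 / 2 + y / (Complex.exp l - y)) / 4 - phaseDeriv z ς l ^ 2) / (2 * phaseDeriv z ς l)
      * (ampA z ς h l + ampB z ς h l), fun l hl => ?_⟩⟩
  · obtain ⟨h1, -, h2, h3⟩ := basic l hl _ rfl
    have hρ : 0 < ‖Complex.exp (l / 2)‖ := by linarith
    exact ⟨norm_pos_iff.1 ((pow_pos hρ 5).trans_le h3),
      norm_pos_iff.1 (lt_of_lt_of_le (by positivity) h2)⟩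
  · obtain ⟨h1, h4, h2, h3⟩ := basic l hl _ rfl
    have hρ : 0 < ‖Complex.exp (l / 2)‖ := by linarith
    have hS : phaseDeriv z ς l ≠ 0 := norm_pos_iff.1 ((pow_pos hρ 5).trans_le h3)
    have ht : Complex.exp l - y ≠ 0 := norm_pos_iff.1 (lt_of_lt_of_le (by positivity) h2)
    have d1 := hh.hasDerivAt_scaled l
    have d2 := hh.hasDerivAt_scaledDeriv ht
    have d3 := hasDerivAt_phase z ς l
    have d4 := hasDerivAt_phaseDeriv z ς l
    refine ⟨?_, ?_, ?_⟩
    · refine (((d3.cexp).mul ((d4.mul d1).sub d2)).div (d4.const_mul 2)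
        (mul_ne_zero two_ne_zero hS)).congr_deriv ?_
      simp only [ampA, ampB, Pi.mul_apply, Pi.sub_apply]
      field_simp
      ring
    · refine (((d3.cexp).mul (d2.add (d4.mul d1))).div (d4.const_mul 2)
        (mul_ne_zero two_ne_zero hS)).congr_deriv ?_
      simp only [ampA, ampB, Pi.mul_apply, Pi.add_apply]
      field_simp
      ring
    · beta_reduce
      set E := Complex.exp (l / 2) with hE
      set ρ := ‖E‖ with hρE
      have hρ1 : 1 ≤ ρ := by linarith
      have eE2 : Complex.exp l = E ^ 2 := by
        rw [hE, ← Complex.exp_nat_mul]; congr 1; push_cast; ring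
      have eE5 : Complex.exp (5 * l / 2) = E ^ 5 := by
        rw [hE, ← Complex.exp_nat_mul]; congr 1; push_cast; ring
      have eS : phaseDeriv z ς l = ς * (2 * E ^ 5 - z / 2 * E) := by rw [phaseDeriv, eE5]
      rw [eE2] at h2 ht
      rw [eE2, eE5, ← h4]
      set S := phaseDeriv z ς l with hSdef
      -- the two coefficients, with their leading terms cancelled
      have f1 : 5 / 2 + y / (E ^ 2 - y) - ς * (5 * E ^ 5 - z / 4 * E) / S
          = y / (E ^ 2 - y) - ς * z * E / S := by
        have : ς * (5 * E ^ 5 - z / 4 * E) / S = 5 / 2 + ς * z * E / S := by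
          rw [div_eq_iff hS, add_mul, div_mul_cancel₀ _ hS, eS]; ring
        rw [this]; ring
      have f2 : 1 / 16 + (E ^ 2) ^ 2 * G y y' z (E ^ 2) / (E ^ 2 - y)
          - (5 / 2 + y / (E ^ 2 - y)) / 4 - S ^ 2
          = -(9 / 16) + y' * E ^ 4 / (E ^ 2 - y) + c * E ^ 4 - z ^ 2 / 4 * E ^ 2
            - y / (E ^ 2 - y) / 4 := by
        have : S ^ 2 = (2 * E ^ 5 - z / 2 * E) ^ 2 := by rw [eS, mul_pow, hς, one_mul]
        rw [this, G, hc]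
        field_simp
        ring
      rw [f1, f2]
      have hδ : ‖y / (E ^ 2 - y)‖ ≤ 2 * ‖y‖ / ρ ^ 2 := by
        rw [norm_div, div_le_div_iff₀ (by positivity) (by positivity)]
        nlinarith
      have b1 : ‖y / (E ^ 2 - y) - ς * z * E / S‖ ≤ 2 * (‖y‖ + ‖z‖) * ρ⁻¹ := by
        have q1 : ‖ς * z * E / S‖ ≤ ‖z‖ * ρ⁻¹ := by
          rw [norm_div, norm_mul, norm_mul, hςn, one_mul, ← hρE, ← div_eq_mul_inv]
          rw [div_le_div_iff₀ (by positivity) hρ]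
          have : ρ * ρ ≤ ρ ^ 5 := by
            rw [← sq]; exact pow_le_pow_right₀ hρ1 (by norm_num)
          nlinarith
        have q2 : 2 * ‖y‖ / ρ ^ 2 ≤ 2 * ‖y‖ * ρ⁻¹ := by
          rw [← div_eq_mul_inv]
          gcongr
          exact le_self_pow₀ hρ1 two_ne_zero
        have : 0 ≤ ‖z‖ * ρ⁻¹ := by positivity
        refine (norm_sub_le _ _).trans ?_
        linarith
      have p2 : 1 ≤ ρ ^ 2 := one_le_pow₀ hρ1
      have p4 : ρ ^ 2 ≤ ρ ^ 4 := pow_le_pow_right₀ hρ1 (by norm_num)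
      have b2 : ‖-(9 / 16) + y' * E ^ 4 / (E ^ 2 - y) + c * E ^ 4 - z ^ 2 / 4 * E ^ 2
            - y / (E ^ 2 - y) / 4‖ ≤ K * ρ ^ 4 := by
        have q1 : ‖y' * E ^ 4 / (E ^ 2 - y)‖ ≤ 2 * ‖y'‖ * ρ ^ 4 := by
          rw [norm_div, norm_mul, norm_pow, ← hρE, div_le_iff₀ (by positivity)]
          have : 0 ≤ ‖y'‖ * ρ ^ 4 := by positivity
          nlinarith
        have q2 : ‖c * E ^ 4‖ = ‖c‖ * ρ ^ 4 := by rw [norm_mul, norm_pow]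
        have q3 : ‖z ^ 2 / 4 * E ^ 2‖ ≤ ‖z‖ ^ 2 * ρ ^ 4 := by
          rw [norm_mul, norm_div, norm_pow, norm_pow, ← hρE]
          have : ‖z‖ ^ 2 / ‖(4 : ℂ)‖ ≤ ‖z‖ ^ 2 := by
            rw [Complex.norm_ofNat]; linarith [sq_nonneg ‖z‖]
          gcongr
        have q4 : ‖y / (E ^ 2 - y) / 4‖ ≤ ‖y‖ * ρ ^ 4 := by
          rw [norm_div, Complex.norm_ofNat]
          have h5 : 2 * ‖y‖ / ρ ^ 2 ≤ 2 * ‖y‖ := div_le_self (by positivity) p2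
          have h6 : ‖y‖ * 1 ≤ ‖y‖ * ρ ^ 4 := by gcongr; linarith
          linarith
        have q5 : ‖(-(9 / 16) : ℂ)‖ ≤ ρ ^ 4 := by
          rw [norm_neg]; norm_num; linarith
        calc _ ≤ ‖(-(9 / 16) : ℂ)‖ + ‖y' * E ^ 4 / (E ^ 2 - y)‖ + ‖c * E ^ 4‖
              + ‖z ^ 2 / 4 * E ^ 2‖ + ‖y / (E ^ 2 - y) / 4‖ := by
              refine (norm_sub_le _ _).trans ?_
              gcongr
              refine (norm_sub_le _ _).trans ?_
              gcongr
              refine (norm_add_le _ _).trans ?_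
              gcongr
              exact norm_add_le _ _
          _ ≤ _ := by rw [hK]; linarith
      have b3 : ∀ X : ℂ, ‖X‖ ≤ K * ρ ^ 4 → ‖X / (2 * S)‖ ≤ K * ρ⁻¹ := by
        intro X hX
        have hK0 : 0 ≤ K := by positivity
        rw [norm_div, norm_mul, Complex.norm_ofNat, ← div_eq_mul_inv,
          div_le_div_iff₀ (by positivity) hρ]
        calc ‖X‖ * ρ ≤ K * ρ ^ 4 * ρ := by gcongr
          _ = K * ρ ^ 5 := by ring
          _ ≤ K * (2 * ‖S‖) := by gcongr; linarith [norm_nonneg S]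
      set a := ampA z ς h l
      set b := ampB z ς h l
      refine (norm_add_le _ _).trans ?_
      rw [norm_mul, norm_mul (_ / (2 * S)), norm_mul (1 / 2 : ℂ)]
      have n1 : ‖b - a‖ ≤ ‖a‖ + ‖b‖ := by rw [add_comm]; exact norm_sub_le _ _
      have n2 : ‖a + b‖ ≤ ‖a‖ + ‖b‖ := norm_add_le _ _
      have n3 : ‖(1 / 2 : ℂ)‖ = 1 / 2 := by norm_num
      rw [n3]
      calc _ ≤ 1 / 2 * (2 * (‖y‖ + ‖z‖) * ρ⁻¹) * (‖a‖ + ‖b‖) + K * ρ⁻¹ * (‖a‖ + ‖b‖) := by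
            gcongr
            exact b3 _ b2
        _ = _ := by ring

end

/-! ### Subdominant entire solutions -/

section
variable {y y' z : ℂ}

theorem ampA_add_ampB {z ς l : ℂ} (hS : phaseDeriv z ς l ≠ 0) (h : ℂ → ℂ) :
    ampA z ς h l + ampB z ς h l = Complex.exp (phase z ς l) * scaled h l := by
  rw [ampA, ampB]; field_simp; ring

theorem scaled_linearComb (g h : ℂ → ℂ) (a b l : ℂ) :
    scaled (fun x => a * g x + b * h x) l = a * scaled g l + b * scaled h l := by
  rw [scaled, scaled, scaled]; ring

theorem scaledDeriv_linearComb {g h : ℂ → ℂ} (hg : IsEntireSol y y' z g)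
    (hh : IsEntireSol y y' z h) (a b l : ℂ) :
    scaledDeriv (fun x => a * g x + b * h x) l = a * scaledDeriv g l + b * scaledDeriv h l := by
  rw [scaledDeriv, deriv_linearComb hg.differentiable hh.differentiable, scaledDeriv, scaledDeriv]
  ring

theorem ampA_linearComb {g h : ℂ → ℂ} (hg : IsEntireSol y y' z g)
    (hh : IsEntireSol y y' z h) (ς a b : ℂ) :
    ampA z ς (fun x => a * g x + b * h x) = fun l => a * ampA z ς g l + b * ampA z ς h l := by
  ext l
  rw [ampA, scaled_linearComb, scaledDeriv_linearComb hg hh, ampA, ampA]; ring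

theorem ampB_linearComb {g h : ℂ → ℂ} (hg : IsEntireSol y y' z g)
    (hh : IsEntireSol y y' z h) (ς a b : ℂ) :
    ampB z ς (fun x => a * g x + b * h x) = fun l => a * ampB z ς g l + b * ampB z ς h l := by
  ext l
  rw [ampB, scaled_linearComb, scaledDeriv_linearComb hg hh, ampB, ampB]; ring

theorem amp_det {g h : ℂ → ℂ} (hg : IsEntireSol y y' z g) (hh : IsEntireSol y y' z h) {ς l : ℂ}
    (hS : phaseDeriv z ς l ≠ 0) :
    ampA z ς g l * ampB z ς h l - ampA z ς h l * ampB z ς g l =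
      Complex.exp (phase z ς l) ^ 2 / (2 * phaseDeriv z ς l) * Complex.exp (l / 4) ^ 2
        * Complex.exp l * (omega y g h * (Complex.exp l - y)) := by
  rw [← hg.wronskian hh, ampA, ampB, ampA, ampB, scaledDeriv, scaledDeriv, scaled, scaled]
  field_simp
  ring

/-- The sign of `x ^ (1/2)` in the exponent of the `n`-th subdominant solution, when the sectors are
numbered by `n : ℤ` on the logarithmic covering. -/
def sgn (n : ℤ) : ℂ := (((-1 : ℤˣ) ^ n : ℤˣ) : ℤ)

theorem sgn_sq (n : ℤ) : sgn n ^ 2 = 1 := by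
  rw [sgn]
  rcases Int.units_eq_one_or ((-1 : ℤˣ) ^ n) with h | h <;> rw [h] <;> simp

theorem sgn_add_one (n : ℤ) : sgn (n + 1) = -sgn n := by
  rw [sgn, sgn, zpow_add_one]; simp

theorem sgn_zero : sgn 0 = 1 := by simp [sgn]

theorem sgn_eq_exp (n : ℤ) : sgn n = Complex.exp (Real.pi * n * Complex.I) := by
  induction n with
  | zero => simp [sgn_zero]
  | succ n ih =>
    rw [sgn_add_one, ih]; push_cast
    rw [show (Real.pi * (n + 1) * Complex.I : ℂ) = Real.pi * n * Complex.I + Real.pi * Complex.I by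
      ring, Complex.exp_add, Complex.exp_pi_mul_I]; ring
  | pred n ih =>
    have h := sgn_add_one (-n - 1)
    rw [sub_add_cancel, ih] at h
    rw [← neg_eq_iff_eq_neg.2 h]; push_cast
    rw [show (Real.pi * (-n : ℂ) * Complex.I : ℂ)
      = Real.pi * (-n - 1) * Complex.I + Real.pi * Complex.I by
      ring, Complex.exp_add, Complex.exp_pi_mul_I]; ring

/-- The central direction of the `n`-th Stokes sector on the logarithmic covering. -/
def angle (n : ℤ) : ℝ := 2 * Real.pi * n / 5

/-- The entire solution `h` is the `n`-th subdominant one: with `l = log x`,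
`h x ∼ x ^ (-1/4) exp (-S)` in `|Im l - 2πn/5| < 3π/5 - ε`. -/
def IsRecessive (z : ℂ) (n : ℤ) (h : ℂ → ℂ) : Prop :=
  ∀ ε : ℝ, 0 < ε → Tendsto (fun l => Complex.exp (phase z (sgn n) l) * scaled h l)
    (logSector (angle n) (3 * Real.pi / 5 - ε)) (𝓝 1)

theorem sgn_mul_exp_angle (n : ℤ) (θ : ℝ) :
    (sgn n * Complex.exp (5 * (angle n + θ : ℝ) / 2 * Complex.I)).re = Real.cos (5 * θ / 2) := by
  have e : Complex.exp (5 * (angle n + θ : ℝ) / 2 * Complex.I)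
      = sgn n * Complex.exp ((5 * θ / 2 : ℝ) * Complex.I) := by
    rw [sgn_eq_exp, ← Complex.exp_add, angle]; congr 1; push_cast; ring
  rw [e, ← mul_assoc, ← sq, sgn_sq, one_mul, Complex.exp_ofReal_mul_I_re]

/-- Every Stokes sector has a subdominant entire solution, whose asymptotics hold in the sector of
half-width `3π/5`. It is recessive along the central ray; two rays close to the boundary of the
Stokes sector carry the asymptotics to both ends of the large sector. -/
theorem exists_isRecessive (y y' z : ℂ) (n : ℤ) :
    ∃ h, IsEntireSol y y' z h ∧ IsRecessive z n h := by
  have hς := sgn_sq n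
  have hςn : ‖sgn n‖ = 1 := by
    have := congrArg norm hς
    rw [norm_pow, norm_one] at this
    exact (pow_eq_one_iff_of_nonneg (norm_nonneg _) two_ne_zero).1 this
  obtain ⟨L, C, hC, hne, hamp⟩ := exists_isAmplitude y y' z (sgn n) hς
  obtain ⟨g₁, hg₁, e1, e2⟩ := exists_isEntireSol y y' z 1 0
  obtain ⟨g₂, hg₂, e3, e4⟩ := exists_isEntireSol y y' z 0 1
  have hω : omega y g₁ g₂ = 1 := by rw [omega, e1, e2, e3, e4]; ring
  have hγ : ∀ θ : ℝ, |θ| < Real.pi / 5 →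
      0 < (sgn n * Complex.exp (5 * (angle n + θ : ℝ) / 2 * Complex.I)).re := fun θ hθ => by
    rw [sgn_mul_exp_angle]
    rw [abs_lt] at hθ
    exact Real.cos_pos_of_mem_Ioo ⟨by linarith, by linarith⟩
  have hpi := Real.pi_pos
  have h0 := hγ 0 (by simpa using by positivity)
  rw [add_zero] at h0
  obtain ⟨a, b, hrec⟩ := exists_isRecessiveAlong hςn hC h0
    (A₁ := ampA z (sgn n) g₁) (B₁ := ampB z (sgn n) g₁) (A₂ := ampA z (sgn n) g₂)
    (B₂ := ampB z (sgn n) g₂) (fun a b => by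
      rw [← ampA_linearComb hg₁ hg₂, ← ampB_linearComb hg₁ hg₂]
      exact hamp _ (hg₁.linearComb hg₂ a b))
    (fun l hl => by
      rw [amp_det hg₁ hg₂ (hne l hl).1, hω, one_mul]
      exact mul_ne_zero (mul_ne_zero (mul_ne_zero (div_ne_zero
        (pow_ne_zero 2 (Complex.exp_ne_zero _)) (mul_ne_zero two_ne_zero (hne l hl).1))
        (pow_ne_zero 2 (Complex.exp_ne_zero _))) (Complex.exp_ne_zero l)) (hne l hl).2)
  rw [← ampA_linearComb hg₁ hg₂, ← ampB_linearComb hg₁ hg₂] at hrec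
  set h : ℂ → ℂ := fun x => a * g₁ x + b * g₂ x
  have hh : IsEntireSol y y' z h := hg₁.linearComb hg₂ a b
  refine ⟨h, hh, fun ε₀ hε₀ => ?_⟩
  have t₀ := hrec.tendsto hςn hC h0 (ρ := 3 * Real.pi / 10) (by positivity) (by linarith)
    (hamp h hh)
  set ε := min ε₀ (Real.pi / 5) with hε
  have hε0 : 0 < ε := lt_min hε₀ (by positivity)
  have hε1 : ε ≤ Real.pi / 5 := min_le_right _ _
  have hε2 : ε ≤ ε₀ := min_le_left _ _
  -- propagation along the rays `± θ`
  have side : ∀ θ : ℝ, |θ| = Real.pi / 5 - ε / 2 →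
      Tendsto (fun l => ampA z (sgn n) h l + ampB z (sgn n) h l)
        (logSector (angle n + θ) (2 * Real.pi / 5 - ε / 2)) (𝓝 1) := fun θ hθ => by
    have hr : IsRecessiveAlong (angle n + θ) (ampA z (sgn n) h) (ampB z (sgn n) h) := by
      have : Tendsto (fun t : ℝ => Complex.I * (angle n + θ : ℝ) + t) atTop
          (logSector (angle n) (3 * Real.pi / 10)) := tendsto_ray_logSector (by
        rw [add_sub_cancel_left, hθ]; linarith)
      exact ⟨t₀.1.comp this, t₀.2.comp this⟩
    have t := hr.tendsto hςn hC (hγ θ (by rw [hθ]; linarith)) (ρ := 2 * Real.pi / 5 - ε / 2)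
      (by linarith) (by linarith) (hamp h hh)
    simpa using t.1.add t.2
  have t₁ := side (Real.pi / 5 - ε / 2) (abs_of_nonneg (by linarith))
  have t₂ := side (-(Real.pi / 5 - ε / 2)) (by rw [abs_neg]; exact abs_of_nonneg (by linarith))
  have hle : logSector (angle n) (3 * Real.pi / 5 - ε₀) ≤
      logSector (angle n + (Real.pi / 5 - ε / 2)) (2 * Real.pi / 5 - ε / 2) ⊔
      logSector (angle n + -(Real.pi / 5 - ε / 2)) (2 * Real.pi / 5 - ε / 2) := by
    rw [logSector, logSector, logSector, ← inf_sup_left, sup_principal]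
    refine inf_le_inf_left _ (principal_mono.2 fun l hl => ?_)
    replace hl : |l.im - angle n| < 3 * Real.pi / 5 - ε₀ := hl
    rw [abs_lt] at hl
    rcases le_total (angle n) l.im with h | h
    · left
      show |l.im - (angle n + (Real.pi / 5 - ε / 2))| < _
      rw [abs_lt]; constructor <;> linarith
    · right
      show |l.im - (angle n + -(Real.pi / 5 - ε / 2))| < _
      rw [abs_lt]; constructor <;> linarith
  have t := (t₁.sup t₂).mono_left hle
  have hre : ∀ᶠ l in logSector (angle n) (3 * Real.pi / 5 - ε₀), L < l.re :=
    (tendsto_comap.eventually (eventually_gt_atTop L)).filter_mono inf_le_left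
  exact t.congr' (hre.mono fun l hl => ampA_add_ampB (hne l hl).1 h)

end

/-! ### Linear relations between the subdominant solutions -/

section
variable {y y' z : ℂ}

theorem angle_add_one (n : ℤ) : angle (n + 1) = angle n + 2 * Real.pi / 5 := by
  rw [angle, angle]; push_cast; ring

theorem phase_neg (z ς l : ℂ) : phase z (-ς) l = -phase z ς l := by
  rw [phase, phase]; ring

theorem phase_sgn_add_one (z : ℂ) (n : ℤ) (l : ℂ) :
    phase z (sgn (n + 1)) l = -phase z (sgn n) l := by
  rw [sgn_add_one, phase_neg]

/-- `exp (-2 S)` decays inside the Stokes sector. -/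
theorem tendsto_exp_neg_two_phase (z : ℂ) (n : ℤ) {ρ : ℝ} (hρ0 : 0 < ρ) (hρ : ρ < Real.pi / 5) :
    Tendsto (fun l => Complex.exp (-2 * phase z (sgn n) l)) (logSector (angle n) ρ) (𝓝 0) := by
  set κ := Real.cos (5 / 2 * ρ) with hκ
  have hκ0 : 0 < κ := Real.cos_pos_of_mem_Ioo ⟨by linarith, by linarith⟩
  have hre : Tendsto Complex.re (logSector (angle n) ρ) atTop :=
    tendsto_comap.mono_left inf_le_left
  have hsmall : ∀ᶠ l in logSector (angle n) ρ, ‖z‖ * Real.exp (-(2 * l.re)) ≤ κ / 5 := by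
    have : Tendsto (fun l : ℂ => ‖z‖ * Real.exp (-(2 * l.re))) (logSector (angle n) ρ) (𝓝 0) := by
      rw [← mul_zero ‖z‖]
      exact (Real.tendsto_exp_neg_atTop_nhds_zero.comp
        (hre.const_mul_atTop two_pos)).const_mul _
    exact this.eventually (eventually_le_nhds (by positivity))
  have hlow : ∀ᶠ l in logSector (angle n) ρ,
      3 / 5 * κ * Real.exp (5 / 2 * l.re) ≤ (phase z (sgn n) l).re := by
    filter_upwards [hsmall, mem_inf_of_right (mem_principal_self _)] with l h1 h2
    replace h2 : |l.im - angle n| < ρ := h2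
    set θ := 5 / 2 * (l.im - angle n) with hθ
    have e1 : phase z (sgn n) l = ((Real.exp (5 / 2 * l.re) : ℝ) : ℂ) *
        (Complex.exp (θ * Complex.I) * (4 / 5 - z * Complex.exp (-(2 * l)))) := by
      have e2 : sgn n * Complex.exp (5 * l / 2)
          = (Real.exp (5 / 2 * l.re) : ℝ) * Complex.exp (θ * Complex.I) := by
        have hs : sgn n = sgn n ^ 2 * sgn (-n) := by
          rw [sgn_sq, one_mul, sgn, sgn, zpow_neg]; simp
        rw [hs, sgn_sq, one_mul, sgn_eq_exp, Complex.ofReal_exp, ← Complex.exp_add,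
          ← Complex.exp_add]
        congr 1
        rw [hθ, angle]
        conv_lhs => rw [← Complex.re_add_im l]
        push_cast; ring
      have e3 : Complex.exp (l / 2) = Complex.exp (5 * l / 2) * Complex.exp (-(2 * l)) := by
        rw [← Complex.exp_add]; congr 1; ring
      rw [← mul_assoc, ← e2, phase, e3]; ring
    rw [e1, Complex.re_ofReal_mul, mul_comm]
    refine mul_le_mul_of_nonneg_left ?_ (Real.exp_pos _).le
    have hcos : κ ≤ Real.cos θ := by
      have habs : |θ| ≤ 5 / 2 * ρ := by
        rw [hθ, abs_mul, abs_of_pos (by norm_num : (0 : ℝ) < 5 / 2)]; linarith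
      rw [← Real.cos_abs θ]
      exact Real.cos_le_cos_of_nonneg_of_le_pi (abs_nonneg _) (by linarith [Real.pi_pos]) habs
    have hn : ‖z * Complex.exp (-(2 * l))‖ ≤ κ / 5 := by
      rw [norm_mul, Complex.norm_exp]
      simpa using h1
    have e4 : (Complex.exp (θ * Complex.I) * (4 / 5 - z * Complex.exp (-(2 * l)))).re
        = 4 / 5 * Real.cos θ
          - (Complex.exp (θ * Complex.I) * (z * Complex.exp (-(2 * l)))).re := by
      rw [mul_sub, Complex.sub_re, mul_comm _ (4 / 5 : ℂ),
        show (4 / 5 : ℂ) = ((4 / 5 : ℝ) : ℂ) by norm_num, Complex.re_ofReal_mul,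
        Complex.exp_ofReal_mul_I_re]
    have e5 : (Complex.exp (θ * Complex.I) * (z * Complex.exp (-(2 * l)))).re ≤ κ / 5 := by
      refine (Complex.re_le_norm _).trans ?_
      rw [norm_mul, Complex.norm_exp_ofReal_mul_I, one_mul]
      exact hn
    rw [e4]
    linarith
  have hS : Tendsto (fun l => (phase z (sgn n) l).re) (logSector (angle n) ρ) atTop := by
    refine tendsto_atTop_mono' _ hlow ?_
    exact (Real.tendsto_exp_atTop.comp (hre.const_mul_atTop (by norm_num))).const_mul_atTop
      (by positivity)
  rw [tendsto_zero_iff_norm_tendsto_zero]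
  refine (Real.tendsto_exp_neg_atTop_nhds_zero.comp (hS.const_mul_atTop two_pos)).congr fun l => ?_
  rw [Complex.norm_exp]
  simp

theorem IsRecessive.tendsto {n : ℤ} {h : ℂ → ℂ} (hh : IsRecessive z n h) {γ ρ : ℝ}
    (hρ : |γ - angle n| + ρ < 3 * Real.pi / 5) :
    Tendsto (fun l => Complex.exp (phase z (sgn n) l) * scaled h l) (logSector γ ρ) (𝓝 1) :=
  (hh (3 * Real.pi / 5 - (|γ - angle n| + ρ)) (by linarith)).mono_left
    (logSector_mono (by linarith))

theorem IsRecessive.ne_zero {n : ℤ} {h : ℂ → ℂ} (hh : IsRecessive z n h) : ∃ x, h x ≠ 0 := by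
  by_contra! h0
  have t := hh.tendsto (γ := angle n) (ρ := 1) (by
    rw [sub_self, abs_zero]; linarith [Real.pi_gt_three])
  simp only [scaled, h0, mul_zero] at t
  have := logSector_neBot (γ := angle n) (ρ := 1) one_pos
  exact zero_ne_one (tendsto_nhds_unique tendsto_const_nhds t)

/-- In the `n`-th Stokes sector only the component along the dominant solution is visible. -/
theorem tendsto_dominant {n : ℤ} {g h : ℂ → ℂ} (hh : IsRecessive z n h)
    (hg : IsRecessive z (n + 1) g) (a b : ℂ) {ρ : ℝ} (hρ0 : 0 < ρ) (hρ : ρ < Real.pi / 5) :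
    Tendsto (fun l => Complex.exp (-phase z (sgn n) l) * (a * scaled h l + b * scaled g l))
      (logSector (angle n) ρ) (𝓝 b) := by
  have t1 := hh.tendsto (γ := angle n) (ρ := ρ) (by
    rw [sub_self, abs_zero]; linarith [Real.pi_pos])
  have t2 := hg.tendsto (γ := angle n) (ρ := ρ) (by
    rw [angle_add_one, sub_add_cancel_left, abs_neg, abs_of_pos (by positivity)]; linarith)
  have t3 := tendsto_exp_neg_two_phase z n hρ0 hρ
  have t := ((t3.mul t1).const_mul a).add (t2.const_mul b)
  simp only [mul_zero, zero_add, mul_one] at t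
  refine t.congr fun l => ?_
  rw [phase_sgn_add_one,
    show -phase z (sgn n) l = -2 * phase z (sgn n) l + phase z (sgn n) l by ring,
    Complex.exp_add]
  ring

theorem IsRecessive.omega_ne_zero {n : ℤ} {g h : ℂ → ℂ} (hh : IsEntireSol y y' z h)
    (hg : IsEntireSol y y' z g) (hh' : IsRecessive z n h) (hg' : IsRecessive z (n + 1) g) :
    omega y h g ≠ 0 := by
  intro h0
  -- otherwise `h` is orthogonal to every entire solution
  obtain ⟨g₁, hg₁, e1, e2⟩ := exists_isEntireSol y y' z 1 0
  obtain ⟨g₂, hg₂, e3, e4⟩ := exists_isEntireSol y y' z 0 1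
  have hω : omega y g₁ g₂ = 1 := by rw [omega, e1, e2, e3, e4]; ring
  have hpi := Real.pi_pos
  have nb := logSector_neBot (γ := angle n) (ρ := Real.pi / 10) (by positivity)
  have rel : ∀ k, IsEntireSol y y' z k → omega y k h = 0 := fun k hk => by
    have h1 : ∀ x, omega y k g * h x + -omega y k h * g x = 0 := fun x => by
      have := hk.eq_linearComb hh hg x
      rw [h0] at this
      linear_combination -this
    have t := tendsto_dominant hh' hg' (omega y k g) (-omega y k h) (ρ := Real.pi / 10)
      (by positivity) (by linarith)
    simp only [← scaled_linearComb, h1] at t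
    simp only [scaled, mul_zero] at t
    simpa using (tendsto_nhds_unique tendsto_const_nhds t).symm
  obtain ⟨x, hx⟩ := hh'.ne_zero
  apply hx
  have := hh.eq_linearComb hg₁ hg₂ x
  rw [hω, omega_swap, rel g₂ hg₂, omega_swap, rel g₁ hg₁] at this
  linear_combination this

/-- The `n`-th subdominant solution is unique. -/
theorem IsRecessive.unique {n : ℤ} {h k : ℂ → ℂ} (hh : IsEntireSol y y' z h)
    (hk : IsEntireSol y y' z k) (hh' : IsRecessive z n h) (hk' : IsRecessive z n k) : k = h := by
  obtain ⟨g, hg, hg'⟩ := exists_isRecessive y y' z (n + 1)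
  have hω := hh'.omega_ne_zero hh hg hg'
  have hpi := Real.pi_pos
  have nb := logSector_neBot (γ := angle n) (ρ := Real.pi / 10) (by positivity)
  set a := omega y k g / omega y h g with ha
  set b := -(omega y k h / omega y h g) with hb
  have e : ∀ x, k x = a * h x + b * g x := fun x => by
    have := hk.eq_linearComb hh hg x
    rw [ha, hb]
    field_simp
    linear_combination this
  have ek : k = fun x => a * h x + b * g x := funext e
  have t1 := tendsto_dominant hh' hg' a b (ρ := Real.pi / 10) (by positivity) (by linarith)
  simp only [← scaled_linearComb, ← ek] at t1
  have t2 := hk'.tendsto (γ := angle n) (ρ := Real.pi / 10) (by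
    rw [sub_self, abs_zero]; linarith)
  have t3 := (tendsto_exp_neg_two_phase z n (ρ := Real.pi / 10) (by positivity)
    (by linarith)).mul t2
  have hb0 : b = 0 := by
    rw [zero_mul] at t3
    refine tendsto_nhds_unique t1 (t3.congr fun l => ?_)
    rw [show -phase z (sgn n) l = -2 * phase z (sgn n) l + phase z (sgn n) l by ring,
      Complex.exp_add]
    ring
  have t4 := (hh'.tendsto (γ := angle n) (ρ := Real.pi / 10) (by
    rw [sub_self, abs_zero]; linarith)).const_mul a
  have ha1 : a = 1 := by
    rw [mul_one] at t4
    refine tendsto_nhds_unique t4 (t2.congr fun l => ?_)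
    rw [ek, scaled_linearComb, hb0]; ring
  rw [ek, ha1, hb0]; simp

/-- The Stokes relation `h_{n-1} = h_{n+1} + σ h_n`. -/
theorem exists_stokes_relation {n : ℤ} {f g h : ℂ → ℂ} (hf : IsEntireSol y y' z f)
    (hh : IsEntireSol y y' z h) (hg : IsEntireSol y y' z g) (hf' : IsRecessive z (n - 1) f)
    (hh' : IsRecessive z n h) (hg' : IsRecessive z (n + 1) g) :
    ∃ σ, ∀ x, f x = g x + σ * h x := by
  have hω := hh'.omega_ne_zero hh hg hg'
  have hpi := Real.pi_pos
  have nb := logSector_neBot (γ := angle n) (ρ := Real.pi / 10) (by positivity)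
  set a := omega y f g / omega y h g with ha
  set b := -(omega y f h / omega y h g) with hb
  have e : ∀ x, f x = a * h x + b * g x := fun x => by
    have := hf.eq_linearComb hh hg x
    rw [ha, hb]
    field_simp
    linear_combination this
  have ef : f = fun x => a * h x + b * g x := funext e
  have hn := angle_add_one (n - 1)
  have hs := phase_sgn_add_one z (n - 1)
  rw [sub_add_cancel] at hn hs
  have t1 := tendsto_dominant hh' hg' a b (ρ := Real.pi / 10) (by positivity) (by linarith)
  simp only [← scaled_linearComb, ← ef, hs, neg_neg] at t1
  have t2 := hf'.tendsto (γ := angle n) (ρ := Real.pi / 10) (by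
    rw [hn, add_sub_cancel_left, abs_of_pos (by positivity)]; linarith)
  have hb1 : b = 1 := tendsto_nhds_unique t1 t2
  exact ⟨a, fun x => by rw [e, hb1]; ring⟩

/-- Going once around infinity multiplies the normalisation `x ^ (-3/4)` by `i`, and the
factor `(x - y) ^ (-1/2)` by `-1`; hence `h_{n+5} = -i h_n`. -/
theorem IsRecessive.add_five {n : ℤ} {h : ℂ → ℂ} (hh : IsRecessive z n h) :
    IsRecessive z (n + 5) fun x => -Complex.I * h x := by
  intro ε hε
  have hang : angle (n + 5) = angle n + 2 * Real.pi := by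
    rw [angle, angle]; push_cast; ring
  have hsg : sgn (n + 5) = -sgn n := by
    rw [show n + 5 = n + 1 + 1 + 1 + 1 + 1 by ring]
    simp only [sgn_add_one]; ring
  have shift : Tendsto (fun l => l - 2 * Real.pi * Complex.I)
      (logSector (angle (n + 5)) (3 * Real.pi / 5 - ε))
      (logSector (angle n) (3 * Real.pi / 5 - ε)) := by
    refine tendsto_inf.2 ⟨tendsto_comap_iff.2 ?_, tendsto_principal.2 ?_⟩
    · have : Tendsto Complex.re (logSector (angle (n + 5)) (3 * Real.pi / 5 - ε)) atTop :=
        tendsto_comap.mono_left inf_le_left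
      refine this.congr fun l => ?_
      simp
    · filter_upwards [mem_inf_of_right (mem_principal_self _)] with l hl
      replace hl : |l.im - angle (n + 5)| < 3 * Real.pi / 5 - ε := hl
      show |(l - 2 * Real.pi * Complex.I).im - angle n| < _
      convert hl using 2
      rw [hang]; simp; ring
  refine ((hh ε hε).comp shift).congr fun l => ?_
  have hpI := Complex.exp_pi_mul_I
  have e1 : Complex.exp (5 * (l - 2 * Real.pi * Complex.I) / 2) = -Complex.exp (5 * l / 2) := by
    rw [show 5 * l / 2 = 5 * (l - 2 * Real.pi * Complex.I) / 2 + Real.pi * Complex.I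
      + 2 * Real.pi * Complex.I + 2 * Real.pi * Complex.I by ring, Complex.exp_add, Complex.exp_add,
      Complex.exp_add, hpI, Complex.exp_two_pi_mul_I]
    ring
  have e2 : Complex.exp ((l - 2 * Real.pi * Complex.I) / 2) = -Complex.exp (l / 2) := by
    rw [show l / 2 = (l - 2 * Real.pi * Complex.I) / 2 + Real.pi * Complex.I by ring,
      Complex.exp_add, hpI]
    ring
  have e3 : Complex.exp ((l - 2 * Real.pi * Complex.I) / 4) = -Complex.I * Complex.exp (l / 4) := by
    rw [show l / 4 = (l - 2 * Real.pi * Complex.I) / 4 + Real.pi / 2 * Complex.I by ring,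
      Complex.exp_add, Complex.exp_pi_div_two_mul_I]
    linear_combination Complex.exp ((l - 2 * Real.pi * Complex.I) / 4) * Complex.I_mul_I
  have e4 : Complex.exp (l - 2 * Real.pi * Complex.I) = Complex.exp l := by
    rw [Complex.exp_sub, Complex.exp_two_pi_mul_I, div_one]
  simp only [Function.comp_apply, scaled, phase, hsg, e1, e2, e3, e4]
  rw [show sgn n * (4 / 5 * -Complex.exp (5 * l / 2) - z * -Complex.exp (l / 2))
    = -sgn n * (4 / 5 * Complex.exp (5 * l / 2) - z * Complex.exp (l / 2)) by ring]
  ring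

variable (y y' z) in
/-- The `n`-th subdominant entire solution. -/
def subdom (n : ℤ) : ℂ → ℂ := (exists_isRecessive y y' z n).choose

theorem subdom_isEntireSol (n : ℤ) : IsEntireSol y y' z (subdom y y' z n) :=
  (exists_isRecessive y y' z n).choose_spec.1

theorem subdom_isRecessive (n : ℤ) : IsRecessive z n (subdom y y' z n) :=
  (exists_isRecessive y y' z n).choose_spec.2

theorem omega_subdom_ne_zero (n : ℤ) : omega y (subdom y y' z n) (subdom y y' z (n + 1)) ≠ 0 :=
  (subdom_isRecessive n).omega_ne_zero (subdom_isEntireSol n) (subdom_isEntireSol _)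
    (subdom_isRecessive _)

theorem subdom_add_five (n : ℤ) : subdom y y' z (n + 5) = fun x => -Complex.I * subdom y y' z n x :=
  IsRecessive.unique ((subdom_isEntireSol n).const_mul _) (subdom_isEntireSol _)
    (subdom_isRecessive n).add_five (subdom_isRecessive _)

variable (y y' z) in
theorem exists_subdom_relation (n : ℤ) :
    ∃ σ, ∀ x, subdom y y' z (n - 1) x = subdom y y' z (n + 1) x + σ * subdom y y' z n x :=
  exists_stokes_relation (subdom_isEntireSol _) (subdom_isEntireSol n) (subdom_isEntireSol _)
    (subdom_isRecessive _) (subdom_isRecessive n) (subdom_isRecessive _)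

variable (y y' z) in
/-- The Stokes multiplier of the entire subdominant solutions. -/
def stokes (n : ℤ) : ℂ := (exists_subdom_relation y y' z n).choose

theorem subdom_relation (n : ℤ) (x : ℂ) :
    subdom y y' z (n - 1) x = subdom y y' z (n + 1) x + stokes y y' z n * subdom y y' z n x :=
  (exists_subdom_relation y y' z n).choose_spec x

theorem subdom_relation' (n : ℤ) : subdom y y' z (n - 1) =
    fun x => 1 * subdom y y' z (n + 1) x + stokes y y' z n * subdom y y' z n x := by
  ext x; rw [subdom_relation]; ring

theorem omega_subdom_succ (n : ℤ) : omega y (subdom y y' z (n + 1)) (subdom y y' z (n + 2))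
    = -omega y (subdom y y' z n) (subdom y y' z (n + 1)) := by
  have h := subdom_relation' (y := y) (y' := y') (z := z) (n + 1)
  rw [add_sub_cancel_right, add_assoc, one_add_one_eq_two] at h
  rw [h, omega_linearComb_left (subdom_isEntireSol _) (subdom_isEntireSol _), omega_self,
    omega_swap y (subdom y y' z (n + 1))]
  ring

/-- The cross ratio of the four subdominant solutions other than the `n`-th one. The factor `i`
comes from closing up around infinity, `h_{n+3} = -i h_{n-2}`. -/
theorem stokes_eq (n : ℤ) :
    stokes y y' z n = Complex.I *
      (omega y (subdom y y' z (n + 1)) (subdom y y' z (n - 1))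
        * omega y (subdom y y' z (n - 2)) (subdom y y' z (n + 2)) /
      (omega y (subdom y y' z (n + 1)) (subdom y y' z (n + 2))
        * omega y (subdom y y' z (n - 2)) (subdom y y' z (n - 1)))) := by
  set w := omega y (subdom y y' z n) (subdom y y' z (n + 1)) with hw
  have hw0 : w ≠ 0 := omega_subdom_ne_zero n
  have h1 : omega y (subdom y y' z (n + 1)) (subdom y y' z (n + 2)) = -w := omega_subdom_succ n
  have h2 : omega y (subdom y y' z (n + 2)) (subdom y y' z (n + 3)) = w := by
    have := omega_subdom_succ (y := y) (y' := y') (z := z) (n + 1)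
    rw [show n + 1 + 1 = n + 2 by ring, show n + 1 + 2 = n + 3 by ring, h1, neg_neg] at this
    exact this
  have h3 : omega y (subdom y y' z (n - 1)) (subdom y y' z n) = -w := by
    have := omega_subdom_succ (y := y) (y' := y') (z := z) (n - 1)
    rw [show n - 1 + 1 = n by ring, show n - 1 + 2 = n + 1 by ring] at this
    rw [hw, this, neg_neg]
  have h4 : omega y (subdom y y' z (n - 2)) (subdom y y' z (n - 1)) = w := by
    have := omega_subdom_succ (y := y) (y' := y') (z := z) (n - 2)
    rw [show n - 2 + 1 = n - 1 by ring, show n - 2 + 2 = n by ring, h3] at this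
    exact (neg_injective this).symm
  have h5 : omega y (subdom y y' z (n + 1)) (subdom y y' z (n - 1)) = -(stokes y y' z n * w) := by
    rw [omega_swap, subdom_relation' n,
      omega_linearComb_left (subdom_isEntireSol _) (subdom_isEntireSol _), omega_self]
    ring
  have h6 : omega y (subdom y y' z (n - 2)) (subdom y y' z (n + 2)) = -Complex.I * w := by
    have e : subdom y y' z (n + 3) = fun x => -Complex.I * subdom y y' z (n - 2) x
        + 0 * subdom y y' z (n - 2) x := by
      rw [show n + 3 = n - 2 + 5 by ring, subdom_add_five]; simp
    rw [omega_swap, e, omega_linearComb_left (subdom_isEntireSol _) (subdom_isEntireSol _)] at h2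
    linear_combination (-Complex.I) * h2
      + omega y (subdom y y' z (n - 2)) (subdom y y' z (n + 2)) * Complex.I_mul_I
  rw [h1, h4, h5, h6]
  field_simp
  linear_combination stokes y y' z n * Complex.I_sq

end

/-! ### Solutions of the Schwarzian equation are quotients of entire solutions -/

section
variable {y y' z : ℂ}

theorem eventually_nhdsNE_of_codiscrete {p : ℂ → Prop} (h : ∀ᶠ x in codiscrete ℂ, p x) (x : ℂ) :
    ∀ᶠ t in 𝓝[≠] x, p t := by
  have := mem_codiscrete.1 h x
  rwa [disjoint_principal_right, compl_compl] at this

theorem eventually_nhdsNE_eq_zero_of_eventually {g : ℂ → ℂ} (hg : Meromorphic g) {x₀ : ℂ}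
    (h : ∀ᶠ t in 𝓝 x₀, g t = 0) (x : ℂ) : ∀ᶠ t in 𝓝[≠] x, g t = 0 := by
  rw [← meromorphicOrderAt_eq_top_iff]
  by_contra hx
  exact MeromorphicOn.meromorphicOrderAt_ne_top_of_isPreconnected (fun t _ => hg t)
    isPreconnected_univ (Set.mem_univ x) (Set.mem_univ x₀) hx
    (meromorphicOrderAt_eq_top_iff.2 (h.filter_mono nhdsWithin_le_nhds))

/-- There are points other than `y` near which a solution of the Schwarzian equation is analytic
with non-vanishing derivative, the equation holding everywhere in the neighbourhood. -/
theorem IsSchwarzianSolution.exists_regular {f : ℂ → ℂ} (hf : IsSchwarzianSolution y y' z f) :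
    ∃ x₀, ∀ᶠ x in 𝓝 x₀, AnalyticAt ℂ f x ∧ deriv f x ≠ 0 ∧
      schwarzian f x = -2 * Q y y' z x ∧ x ≠ y := by
  have h1 : ∀ᶠ x in 𝓝[≠] y, AnalyticAt ℂ f x := (hf.meromorphic y).eventually_analyticAt
  have h2 := eventually_nhdsNE_of_codiscrete hf.eq y
  rcases (hf.meromorphic y).deriv.eventually_eq_zero_or_eventually_ne_zero with h3 | h3
  · -- if `f'` vanishes identically near `y`, then `f` is constant on a disc, hence everywhere
    exfalso
    obtain ⟨x₀, hx₀⟩ := (eventually_nhdsNE_eventually_nhds_iff.2 (h1.and h3)).exists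
    obtain ⟨r, hr, hball⟩ := Metric.eventually_nhds_iff_ball.1 hx₀
    obtain ⟨c, hc⟩ := Metric.isOpen_ball.exists_is_const_of_deriv_eq_zero
      (convex_ball x₀ r).isPreconnected
      (fun x hx => (hball x hx).1.differentiableAt.differentiableWithinAt)
      (fun x hx => (hball x hx).2)
    apply hf.nonconstant
    refine ⟨c, mem_codiscrete.2 fun x => ?_⟩
    rw [disjoint_principal_right, compl_compl]
    have hm : Meromorphic fun x => f x - c := fun x => (hf.meromorphic x).sub (.const c x)
    have := eventually_nhdsNE_eq_zero_of_eventually hm (x₀ := x₀)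
      (Metric.eventually_nhds_iff_ball.2 ⟨r, hr, fun x hx => sub_eq_zero.2 (hc x hx)⟩) x
    exact this.mono fun t ht => sub_eq_zero.1 ht
  · exact (eventually_nhdsNE_eventually_nhds_iff.2
      (h1.and (h3.and (h2.and eventually_mem_nhdsWithin)))).exists

/-- If `f` solves the Schwarzian equation, then `(x - y) ^ (1/2) (f') ^ (-1/2)` and its product with
`f` solve the equation of the entire solutions. -/
theorem IsSchwarzianSolution.exists_quotient {f : ℂ → ℂ} (hf : IsSchwarzianSolution y y' z f) :
    ∃ g h, IsEntireSol y y' z g ∧ IsEntireSol y y' z h ∧ omega y g h ≠ 0 ∧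
      ∀ x, ∀ᶠ t in 𝓝[≠] x, f t * h t = g t := by
  obtain ⟨x₀, hx₀⟩ := hf.exists_regular
  obtain ⟨ha₀, hd₀, -, hy₀⟩ := hx₀.self_of_nhds
  -- `(x - y) / f'` is divided by its value at `x₀`, so that the principal logarithm gives a branch
  -- of its square root near `x₀`
  set c := (x₀ - y) / deriv f x₀ with hc
  have hc0 : c ≠ 0 := div_ne_zero (sub_ne_zero.2 hy₀) hd₀
  set u : ℂ → ℂ := fun x => (x - y) / deriv f x / c with hu
  have hu1 : u x₀ = 1 := div_self hc0
  have hslit : ∀ᶠ x in 𝓝 x₀, u x ∈ Complex.slitPlane := by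
    have hcont : ContinuousAt u x₀ :=
      (((continuousAt_id.sub continuousAt_const).div ha₀.deriv.continuousAt hd₀)).div_const c
    refine hcont.eventually_mem (Complex.isOpen_slitPlane.mem_nhds ?_)
    rw [hu1]; exact Complex.one_mem_slitPlane
  obtain ⟨r, hr, hball⟩ := Metric.eventually_nhds_iff_ball.1 (hx₀.and hslit)
  set D := Metric.ball x₀ r with hD
  have hyD : y ∉ D := fun hy => (hball y hy).1.2.2.2 rfl
  set χ : ℂ → ℂ := fun x => Complex.exp (1 / 2 * Complex.log (u x)) with hχ
  -- the logarithmic derivative of `u`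
  set p : ℂ → ℂ := fun x => 1 / (x - y) - deriv (deriv f) x / deriv f x with hp
  have f1 : ∀ x ∈ D, HasDerivAt f (deriv f x) x := fun x hx =>
    (hball x hx).1.1.differentiableAt.hasDerivAt
  have f2 : ∀ x ∈ D, HasDerivAt (deriv f) (deriv (deriv f) x) x := fun x hx =>
    (hball x hx).1.1.deriv.differentiableAt.hasDerivAt
  have f3 : ∀ x ∈ D, HasDerivAt (deriv (deriv f)) (deriv (deriv (deriv f)) x) x := fun x hx =>
    (hball x hx).1.1.deriv.deriv.differentiableAt.hasDerivAt
  have hxy : ∀ x ∈ D, x - y ≠ 0 := fun x hx => sub_ne_zero.2 (hball x hx).1.2.2.2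
  have c1 : ∀ x ∈ D, HasDerivAt χ (1 / 2 * p x * χ x) x := fun x hx => by
    have hd := (hball x hx).1.2.1
    have hxy := hxy x hx
    have hu' := ((((hasDerivAt_id x).sub_const y).div (f2 x hx) hd).div_const c)
    refine (((hu'.clog (hball x hx).2).const_mul (1 / 2)).cexp).congr_deriv ?_
    simp only [hχ, hp, hu, id, Pi.div_apply]
    field_simp
  have pd : ∀ x ∈ D, HasDerivAt p (-(1 / (x - y)) ^ 2 + 2 * Q y y' z x
      - 1 / 2 * (deriv (deriv f) x / deriv f x) ^ 2) x := fun x hx => by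
    have hd := (hball x hx).1.2.1
    have hxy := hxy x hx
    have hS := (hball x hx).1.2.2.1
    refine (((hasDerivAt_const x (1 : ℂ)).div ((hasDerivAt_id x).sub_const y) hxy).sub
      ((f3 x hx).div (f2 x hx) hd)).congr_deriv ?_
    have e : 2 * Q y y' z x = -(deriv (deriv (deriv f)) x / deriv f x
        - 3 / 2 * (deriv (deriv f) x / deriv f x) ^ 2) := by
      rw [schwarzian] at hS; linear_combination hS
    rw [e]
    simp only [id]
    field_simp
    ring
  have c2 : ∀ x ∈ D, HasDerivAt (fun x => 1 / 2 * p x * χ x)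
      (1 / 2 * (-(1 / (x - y)) ^ 2 + 2 * Q y y' z x
        - 1 / 2 * (deriv (deriv f) x / deriv f x) ^ 2) * χ x
        + 1 / 2 * p x * (1 / 2 * p x * χ x)) x := fun x hx =>
    ((pd x hx).const_mul (1 / 2)).mul (c1 x hx)
  have hχ0 : ∀ x, χ x ≠ 0 := fun x => Complex.exp_ne_zero _
  obtain ⟨h, hh, hχh⟩ := exists_isEntireSol_eqOn (y' := y') (z := z) Metric.isOpen_ball
    (convex_ball x₀ r).isPreconnected hyD c1 c2 (fun x hx => by
      have hd := (hball x hx).1.2.1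
      have hxy := hxy x hx
      rw [Q_eq (sub_ne_zero.1 hxy)]
      simp only [hp]
      field_simp
      ring)
  obtain ⟨g, hg, hfg⟩ := exists_isEntireSol_eqOn (y' := y') (z := z) Metric.isOpen_ball
    (convex_ball x₀ r).isPreconnected hyD (χ := fun x => f x * χ x)
    (fun x hx => (f1 x hx).mul (c1 x hx))
    (fun x hx => ((f2 x hx).mul (c1 x hx)).add ((f1 x hx).mul (c2 x hx))) (fun x hx => by
      have hd := (hball x hx).1.2.1
      have hxy := hxy x hx
      rw [Q_eq (sub_ne_zero.1 hxy)]
      simp only [hp]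
      field_simp
      ring)
  have hDn : D ∈ 𝓝 x₀ := Metric.ball_mem_nhds x₀ hr
  have hx₀D : x₀ ∈ D := Metric.mem_ball_self hr
  refine ⟨g, h, hg, hh, fun hω => ?_, fun x => ?_⟩
  · have e1 : deriv h x₀ = 1 / 2 * p x₀ * χ x₀ :=
      ((c1 x₀ hx₀D).congr_of_eventuallyEq (eventually_of_mem hDn fun x hx => (hχh x hx).symm)).deriv
    have e2 : deriv g x₀ = deriv f x₀ * χ x₀ + f x₀ * (1 / 2 * p x₀ * χ x₀) :=
      (((f1 x₀ hx₀D).mul (c1 x₀ hx₀D)).congr_of_eventuallyEq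
        (eventually_of_mem hDn fun x hx => (hfg x hx).symm)).deriv
    have e3 := hg.wronskian hh x₀
    rw [hω, e1, e2, ← hχh x₀ hx₀D, ← hfg x₀ hx₀D] at e3
    have : deriv f x₀ * χ x₀ ^ 2 = 0 := by linear_combination -e3
    exact (mul_ne_zero hd₀ (pow_ne_zero 2 (hχ0 x₀))) this
  · have hm : Meromorphic fun x => f x * h x - g x := fun x =>
      ((hf.meromorphic x).mul (hh.differentiable.analyticAt x).meromorphicAt).sub
        (hg.differentiable.analyticAt x).meromorphicAt
    have := eventually_nhdsNE_eq_zero_of_eventually hm (x₀ := x₀)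
      (eventually_of_mem hDn fun x hx => by rw [← hχh x hx, ← hfg x hx, sub_self]) x
    exact this.mono fun t ht => sub_eq_zero.1 ht

/-! ### Asymptotic values -/

open Classical in
/-- The point of the Riemann sphere with homogeneous coordinates `(a, b)`. -/
def point (a b : ℂ) : OnePoint ℂ := if b = 0 then OnePoint.infty else ((a / b : ℂ) : OnePoint ℂ)

theorem point_mul {c : ℂ} (hc : c ≠ 0) (a b : ℂ) : point (c * a) (c * b) = point a b := by
  rw [point, point]
  by_cases hb : b = 0
  · simp [hb]
  · rw [if_neg hb, if_neg (mul_ne_zero hc hb), mul_div_mul_left _ _ hc]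

theorem tendsto_point_one_zero : Tendsto (fun t : ℂ => point 1 t) (𝓝 0) (𝓝 OnePoint.infty) := by
  rw [← nhdsNE_sup_pure, tendsto_sup]
  constructor
  · have h : Tendsto (fun t : ℂ => ((t⁻¹ : ℂ) : OnePoint ℂ)) (𝓝[≠] 0) (𝓝 OnePoint.infty) := by
      refine OnePoint.tendsto_coe_infty.comp ?_
      rw [coclosedCompact_eq_cocompact, ← Metric.cobounded_eq_cocompact]
      exact tendsto_inv₀_nhdsNE_zero
    refine h.congr' ?_
    filter_upwards [self_mem_nhdsWithin] with t ht
    have ht' : t ≠ 0 := ht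
    rw [point, if_neg ht', one_div]
  · rw [tendsto_pure_left]
    intro s hs
    rw [point, if_pos rfl]
    exact mem_of_mem_nhds hs

theorem tendsto_point {α : Type*} {F : Filter α} {u v : α → ℂ} {a b : ℂ} (hu : Tendsto u F (𝓝 a))
    (hv : Tendsto v F (𝓝 b)) (hab : a ≠ 0 ∨ b ≠ 0) :
    Tendsto (fun t => point (u t) (v t)) F (𝓝 (point a b)) := by
  by_cases hb : b = 0
  · have ha : a ≠ 0 := hab.resolve_right (not_not.2 hb)
    have h : Tendsto (fun t => v t / u t) F (𝓝 0) := by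
      have h := hv.div hu ha
      rw [hb, zero_div] at h
      exact h
    have h2 := tendsto_point_one_zero.comp h
    rw [point, if_pos hb]
    refine h2.congr' ?_
    filter_upwards [hu.eventually_ne ha] with t ht
    rw [Function.comp_apply, ← point_mul ht, mul_one, mul_div_cancel₀ _ ht]
  · rw [point, if_neg hb]
    refine ((OnePoint.continuous_coe.tendsto _).comp (hu.div hv hb)).congr' ?_
    filter_upwards [hv.eventually_ne hb] with t ht
    rw [point, if_neg ht]; rfl

open Classical in
theorem bracket_point {a b c d : ℂ} (h1 : a ≠ 0 ∨ b ≠ 0) (h2 : c ≠ 0 ∨ d ≠ 0) :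
    bracket (point a b) (point c d) =
      (a * d - c * b) / ((if b = 0 then a else b) * (if d = 0 then c else d)) := by
  have e1 : bracket OnePoint.infty OnePoint.infty = 1 * 0 - 1 * 0 := rfl
  have e2 : ∀ p : ℂ, bracket OnePoint.infty p = 1 * 1 - p * 0 := fun _ => rfl
  have e3 : ∀ p : ℂ, bracket p OnePoint.infty = p * 0 - 1 * 1 := fun _ => rfl
  have e4 : ∀ p q : ℂ, bracket p q = p * 1 - q * 1 := fun _ _ => rfl
  rw [point, point]
  by_cases hb : b = 0 <;> by_cases hd : d = 0
  · rw [if_pos hb, if_pos hd, e1, hb, hd]; simp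
  · have ha : a ≠ 0 := h1.resolve_right (not_not.2 hb)
    rw [if_pos hb, if_neg hd, e2, if_pos hb, if_neg hd, hb]
    field_simp
    ring
  · have hc : c ≠ 0 := h2.resolve_right (not_not.2 hd)
    rw [if_neg hb, if_pos hd, e3, if_neg hb, if_pos hd, hd]
    field_simp
    ring
  · rw [if_neg hb, if_neg hd, e4, if_neg hb, if_neg hd]
    field_simp

/-- Off the singularity, the value on the sphere of a quotient of entire solutions has these
solutions as homogeneous coordinates. -/
theorem sphereValue_eq_point {f g h : ℂ → ℂ} (hf : Meromorphic f) (hg : IsEntireSol y y' z g)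
    (hh : IsEntireSol y y' z h) (hω : omega y g h ≠ 0)
    (e : ∀ x, ∀ᶠ t in 𝓝[≠] x, f t * h t = g t) {x : ℂ} (hx : x ≠ y) :
    sphereValue f x = point (g x) (h x) := by
  have cg : Tendsto g (𝓝[≠] x) (𝓝 (g x)) :=
    (hg.differentiable x).continuousAt.tendsto.mono_left nhdsWithin_le_nhds
  have ch : Tendsto h (𝓝[≠] x) (𝓝 (h x)) :=
    (hh.differentiable x).continuousAt.tendsto.mono_left nhdsWithin_le_nhds
  have mg := (hg.differentiable.analyticAt x).meromorphicAt
  have mh := (hh.differentiable.analyticAt x).meromorphicAt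
  by_cases hh0 : h x = 0
  · have hg0 : g x ≠ 0 := fun hg0 => by
      have := hg.wronskian hh x
      rw [hg0, hh0] at this
      exact mul_ne_zero hω (sub_ne_zero.2 hx) (by rw [← this]; ring)
    have o1 : meromorphicOrderAt g x = 0 :=
      (tendsto_ne_zero_iff_meromorphicOrderAt_eq_zero mg).1 ⟨g x, hg0, cg⟩
    have o2 : 0 < meromorphicOrderAt h x :=
      (tendsto_zero_iff_meromorphicOrderAt_pos mh).1 (by rwa [hh0] at ch)
    have o3 : meromorphicOrderAt f x + meromorphicOrderAt h x = 0 := by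
      rw [← fun_meromorphicOrderAt_mul (hf x) mh, ← o1]
      exact meromorphicOrderAt_congr (e x)
    have o4 : meromorphicOrderAt f x < 0 := by
      by_contra! h0
      exact (o2.trans_le (le_add_of_nonneg_left h0)).ne' o3
    rw [sphereValue, if_pos o4, point, if_pos hh0]
  · have lim : Tendsto f (𝓝[≠] x) (𝓝 (g x / h x)) := by
      refine (cg.div ch hh0).congr' ?_
      filter_upwards [e x, ch.eventually_ne hh0] with t h1 h2
      rw [Pi.div_apply, ← h1, mul_div_cancel_right₀ _ h2]
    have o := (tendsto_nhds_iff_meromorphicOrderAt_nonneg (hf x)).1 ⟨_, lim⟩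
    rw [sphereValue, if_neg (not_lt.2 o), point, if_neg hh0, lim.limUnder_eq]

theorem direction_intCast (n : ℤ) :
    direction (n : ZMod 5) = Complex.exp (Complex.I * angle n) := by
  have h1 : (((n : ZMod 5).val : ℕ) : ℤ) = n % 5 := ZMod.val_intCast n
  have h2 : (((n : ZMod 5).val : ℕ) : ℂ) = n - 5 * (n / 5 : ℤ) := by
    have h3 : (((n : ZMod 5).val : ℕ) : ℤ) = n - 5 * (n / 5) := by
      rw [h1, Int.emod_def]
    exact_mod_cast congrArg (Int.cast : ℤ → ℂ) h3
  rw [direction, h2, angle, Complex.exp_eq_exp_iff_exists_int]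
  exact ⟨-(n / 5), by push_cast; ring⟩

/-- The branch of the logarithm near the direction of the `n`-th sector. -/
def logAt (n : ℤ) (x : ℂ) : ℂ :=
  Complex.log (x / Complex.exp (Complex.I * angle n)) + Complex.I * angle n

theorem exp_logAt (n : ℤ) {x : ℂ} (hx : x ≠ 0) : Complex.exp (logAt n x) = x := by
  rw [logAt, Complex.exp_add, Complex.exp_log (div_ne_zero hx (Complex.exp_ne_zero _)),
    div_mul_cancel₀ _ (Complex.exp_ne_zero _)]

theorem logAt_im (n : ℤ) (x : ℂ) :
    (logAt n x).im - angle n = Complex.arg (x / Complex.exp (Complex.I * angle n)) := by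
  rw [logAt, Complex.add_im, Complex.log_im]; simp

theorem logAt_re (n : ℤ) (x : ℂ) : (logAt n x).re = Real.log ‖x‖ := by
  rw [logAt, Complex.add_re, Complex.log_re, norm_div, Complex.norm_exp]; simp

theorem mem_sector_iff {n : ℤ} {θ : ℝ} {x : ℂ} :
    x ∈ sector (n : ZMod 5) θ ↔ x ≠ 0 ∧ |(logAt n x).im - angle n| < θ := by
  rw [logAt_im, ← direction_intCast]; rfl

theorem tendsto_logAt (n : ℤ) (θ : ℝ) :
    Tendsto (logAt n) (Bornology.cobounded ℂ ⊓ 𝓟 (sector (n : ZMod 5) θ))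
      (logSector (angle n) θ) := by
  refine tendsto_inf.2 ⟨tendsto_comap_iff.2 ?_, tendsto_principal.2 ?_⟩
  · have : Tendsto (fun x : ℂ => Real.log ‖x‖) (Bornology.cobounded ℂ) atTop :=
      Real.tendsto_log_atTop.comp tendsto_norm_cobounded_atTop
    exact (this.mono_left inf_le_left).congr fun x => (logAt_re n x).symm
  · filter_upwards [mem_inf_of_right (mem_principal_self _)] with x hx
    exact (mem_sector_iff.1 hx).2

/-- The `n`-th asymptotic value of `g / h`: where the `n`-th subdominant solution decays, a solution
`k` is asymptotic to `omega y k (subdom y y' z n)` times a dominant one. -/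
def asymValue (y y' z : ℂ) (g h : ℂ → ℂ) (n : ℤ) : OnePoint ℂ :=
  point (omega y g (subdom y y' z n)) (omega y h (subdom y y' z n))

theorem omega_subdom_ne_zero_or {g h : ℂ → ℂ} (hg : IsEntireSol y y' z g)
    (hh : IsEntireSol y y' z h) (hω : omega y g h ≠ 0) (n : ℤ) :
    omega y g (subdom y y' z n) ≠ 0 ∨ omega y h (subdom y y' z n) ≠ 0 := by
  by_contra! h0
  obtain ⟨x, hx⟩ := (subdom_isRecessive (y := y) (y' := y') (z := z) n).ne_zero
  have := (subdom_isEntireSol n).eq_linearComb hg hh x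
  rw [omega_swap y h (subdom y y' z n), omega_swap y g (subdom y y' z n), h0.1, h0.2] at this
  have h2 : omega y g h * subdom y y' z n x = 0 := by linear_combination this
  exact mul_ne_zero hω hx h2

/-- In the `n`-th Stokes sector both `g` and `h` are asymptotic to multiples of `exp S`, and these
multiples are the homogeneous coordinates of the limit of `g / h`. The two cannot vanish together,
since `g` and `h` are independent. -/
theorem isAsymptoticValue_asymValue {f g h : ℂ → ℂ} (hf : Meromorphic f)
    (hg : IsEntireSol y y' z g) (hh : IsEntireSol y y' z h) (hω : omega y g h ≠ 0)
    (e : ∀ x, ∀ᶠ t in 𝓝[≠] x, f t * h t = g t) (n : ℤ) :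
    IsAsymptoticValue f (n : ZMod 5) (asymValue y y' z g h n) := by
  intro δ hδ
  have hpi := Real.pi_pos
  set w := omega y (subdom y y' z n) (subdom y y' z (n + 1)) with hw
  have hw0 : w ≠ 0 := omega_subdom_ne_zero n
  have lim : ∀ k, IsEntireSol y y' z k →
      Tendsto (fun l => Complex.exp (-phase z (sgn n) l) * scaled k l)
        (logSector (angle n) (Real.pi / 5 - δ)) (𝓝 (-w⁻¹ * omega y k (subdom y y' z n))) := by
    intro k hk
    have ek : k = fun x => omega y k (subdom y y' z (n + 1)) / w * subdom y y' z n x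
        + -w⁻¹ * omega y k (subdom y y' z n) * subdom y y' z (n + 1) x := by
      ext x
      have := hk.eq_linearComb (subdom_isEntireSol n) (subdom_isEntireSol (n + 1)) x
      field_simp
      linear_combination this
    set a := omega y k (subdom y y' z (n + 1)) / w
    set b := -w⁻¹ * omega y k (subdom y y' z n)
    have t := tendsto_dominant (subdom_isRecessive (y := y) (y' := y') (z := z) n)
      (subdom_isRecessive (y := y) (y' := y') (z := z) (n + 1)) a b
      (ρ := max (Real.pi / 5 - δ) (Real.pi / 10)) (lt_max_of_lt_right (by positivity))
      (max_lt (by linarith) (by linarith))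
    simp only [← scaled_linearComb, ← ek] at t
    exact t.mono_left (logSector_mono (by rw [sub_self, abs_zero, zero_add]; exact le_max_left _ _))
  have hne := omega_subdom_ne_zero_or hg hh hω n
  have hwi : -w⁻¹ ≠ 0 := neg_ne_zero.2 (inv_ne_zero hw0)
  have t := (tendsto_point (lim g hg) (lim h hh)
    (hne.imp (mul_ne_zero hwi) (mul_ne_zero hwi))).comp (tendsto_logAt n _)
  rw [point_mul hwi] at t
  refine t.congr' ?_
  have hev : ∀ᶠ x in Bornology.cobounded ℂ, x ≠ 0 ∧ x ≠ y := by
    have : ∀ c : ℂ, ∀ᶠ x in Bornology.cobounded ℂ, x ≠ c := fun c =>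
      Bornology.isBounded_def.1 (Bornology.isBounded_singleton (x := c))
    exact (this 0).and (this y)
  filter_upwards [hev.filter_mono inf_le_left] with x hx
  rw [sphereValue_eq_point hf hg hh hω e hx.2]
  simp only [Function.comp_apply, scaled, exp_logAt n hx.1, ← mul_assoc]
  exact point_mul (mul_ne_zero (Complex.exp_ne_zero _) (Complex.exp_ne_zero _)) _ _

/-- On the Riemann sphere, the factor in `h_{n+5} = -i h_n` cancels. -/
theorem asymValue_add_five (g h : ℂ → ℂ) (n : ℤ) :
    asymValue y y' z g h (n + 5) = asymValue y y' z g h n := by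
  have hlin : ∀ k, omega y k (subdom y y' z (n + 5)) =
      -Complex.I * omega y k (subdom y y' z n) := by
    intro k
    have e : subdom y y' z (n + 5) = fun x => -Complex.I * subdom y y' z n x
        + 0 * subdom y y' z n x := by
      rw [subdom_add_five]; simp
    rw [omega_swap, e, omega_linearComb_left (subdom_isEntireSol _) (subdom_isEntireSol _),
      omega_swap y k]
    ring
  rw [asymValue, hlin, hlin, point_mul (neg_ne_zero.2 Complex.I_ne_zero)]
  rfl

theorem asymValue_emod (g h : ℂ → ℂ) (n : ℤ) :
    asymValue y y' z g h (((n : ZMod 5).val : ℕ) : ℤ) = asymValue y y' z g h n := by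
  have hper : Function.Periodic (asymValue y y' z g h) 5 := asymValue_add_five g h
  have h1 : (((n : ZMod 5).val : ℕ) : ℤ) = n % 5 := ZMod.val_intCast n
  rw [h1, Int.emod_def, mul_comm, ← smul_eq_mul, hper.sub_zsmul_eq]

open Classical in
/-- Up to factors that cancel in a cross ratio, the brackets of the asymptotic values are the
symplectic products of the subdominant solutions. -/
theorem exists_bracket_asymValue {g h : ℂ → ℂ} (hg : IsEntireSol y y' z g)
    (hh : IsEntireSol y y' z h) (hω : omega y g h ≠ 0) :
    ∃ c : ℤ → ℂ, (∀ n, c n ≠ 0) ∧ ∀ m n,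
      bracket (asymValue y y' z g h m) (asymValue y y' z g h n) =
        omega y g h * omega y (subdom y y' z m) (subdom y y' z n) / (c m * c n) := by
  refine ⟨fun n => if omega y h (subdom y y' z n) = 0 then omega y g (subdom y y' z n)
    else omega y h (subdom y y' z n), fun n => ?_, fun m n => ?_⟩
  · have := omega_subdom_ne_zero_or hg hh hω n
    by_cases h0 : omega y h (subdom y y' z n) = 0
    · simpa [h0] using this
    · simp [h0]
  · rw [asymValue, asymValue, bracket_point (omega_subdom_ne_zero_or hg hh hω m)
      (omega_subdom_ne_zero_or hg hh hω n)]
    congr 1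
    simp only [omega]; ring

theorem asymValue_ne_succ {g h : ℂ → ℂ} (hg : IsEntireSol y y' z g)
    (hh : IsEntireSol y y' z h) (hω : omega y g h ≠ 0) (n : ℤ) :
    asymValue y y' z g h n ≠ asymValue y y' z g h (n + 1) := by
  intro heq
  obtain ⟨c, hc, hb⟩ := exists_bracket_asymValue hg hh hω
  have h1 := hb n (n + 1)
  rw [← heq, bracket, mul_comm, sub_self] at h1
  exact div_ne_zero (mul_ne_zero hω (omega_subdom_ne_zero n)) (mul_ne_zero (hc _) (hc _)) h1.symm

/-- The Stokes multiplier of the entire subdominant solutions is `i` times the cross ratio of the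
asymptotic values. -/
theorem stokes_eq_crossRatio {g h : ℂ → ℂ} (hg : IsEntireSol y y' z g)
    (hh : IsEntireSol y y' z h) (hω : omega y g h ≠ 0) (n : ℤ) :
    stokes y y' z n = Complex.I *
      crossRatio (asymValue y y' z g h (n + 1)) (asymValue y y' z g h (n - 2))
        (asymValue y y' z g h (n - 1)) (asymValue y y' z g h (n + 2)) := by
  obtain ⟨c, hc, hb⟩ := exists_bracket_asymValue hg hh hω
  rw [stokes_eq, crossRatio, hb, hb, hb, hb]
  have h1 := hc (n + 1)
  have h2 := hc (n - 2)
  have h3 := hc (n - 1)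
  have h4 := hc (n + 2)
  congr 1
  have n1 : omega y (subdom y y' z (n + 1)) (subdom y y' z (n + 2)) ≠ 0 := by
    have := omega_subdom_ne_zero (y := y) (y' := y') (z := z) (n + 1)
    rwa [show n + 1 + 1 = n + 2 by ring] at this
  have n2 : omega y (subdom y y' z (n - 2)) (subdom y y' z (n - 1)) ≠ 0 := by
    have := omega_subdom_ne_zero (y := y) (y' := y') (z := z) (n - 2)
    rwa [show n - 2 + 1 = n - 1 by ring] at this
  field_simp

end

/-! ### Solutions on a cut plane -/

section
variable {y y' z : ℂ}

/-- On a connected set, two branches of an `n`-th root differ by a constant root of unity. -/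
theorem exists_eq_const_mul_of_pow_eq {S : Set ℂ} (hS : IsPreconnected S) {n : ℕ} (hn : 0 < n)
    {f g : ℂ → ℂ} (hf : ContinuousOn f S) (hg : ContinuousOn g S) (hg0 : ∀ x ∈ S, g x ≠ 0)
    (h : ∀ x ∈ S, f x ^ n = g x ^ n) : ∃ c : ℂ, c ^ n = 1 ∧ ∀ x ∈ S, f x = c * g x := by
  have hT : ({c : ℂ | c ^ n = 1}).Finite := by
    refine (Polynomial.nthRoots n (1 : ℂ)).toFinset.finite_toSet.subset fun c hc => ?_
    simpa [Polynomial.mem_nthRoots hn] using hc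
  obtain ⟨c, hc, hfc⟩ := hS.eqOn_const_of_mapsTo hT.isDiscrete (hf.div hg hg0)
    (fun x hx => show (f x / g x) ^ n = 1 by
      rw [div_pow, h x hx, div_self (pow_ne_zero n (hg0 x hx))]) ⟨1, one_pow n⟩
  exact ⟨c, hc, fun x hx => (div_eq_iff (hg0 x hx)).1 (hfc hx)⟩

theorem ne_zero_of_sq_eq {D : Set ℂ} (hy : y ∉ D) {s : ℂ → ℂ} (hsq : ∀ x, s x ^ 2 = x - y) {x : ℂ}
    (hx : x ∈ D) : s x ≠ 0 := fun h0 => by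
  have := hsq x
  rw [h0] at this
  exact hy (by rwa [show y = x by linear_combination this])

theorem hasDerivAt_of_sq_eq {D : Set ℂ} (hD : IsOpen D) (hy : y ∉ D) {s : ℂ → ℂ}
    (hs : ContinuousOn s D) (hsq : ∀ x, s x ^ 2 = x - y) {x : ℂ} (hx : x ∈ D) :
    HasDerivAt s ((s x)⁻¹ / 2) x := by
  have hs0 : s x ≠ 0 := ne_zero_of_sq_eq hy hsq hx
  have h1 : HasDerivAt (fun t : ℂ => t ^ 2 + y) (2 * s x) (s x) :=
    (((hasDerivAt_id (s x)).pow 2).add_const y).congr_deriv (by simp)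
  refine (h1.of_local_left_inverse (hs.continuousAt (hD.mem_nhds hx)) (by simpa using hs0)
    (Eventually.of_forall fun t => ?_)).congr_deriv (by rw [mul_inv]; ring)
  rw [hsq]; ring

/-- With a branch `s` of `(x - y) ^ (1/2)`, an entire solution `h` gives the solution `h / s` of the
oscillator equation. -/
theorem IsEntireSol.isSolutionOn {D : Set ℂ} (hD : IsOpen D) (hy : y ∉ D) {s h ψ : ℂ → ℂ}
    (hs : ContinuousOn s D) (hsq : ∀ x, s x ^ 2 = x - y) (hh : IsEntireSol y y' z h)
    (hψ : ∀ x ∈ D, ψ x = (s x)⁻¹ * h x) : IsSolutionOn y y' z D ψ := by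
  have hs0 : ∀ x ∈ D, s x ≠ 0 := fun x hx => ne_zero_of_sq_eq hy hsq hx
  have p1 : ∀ x ∈ D, HasDerivAt (fun x => (s x)⁻¹) (-(s x)⁻¹ ^ 3 / 2) x := fun x hx => by
    have := hs0 x hx
    refine ((hasDerivAt_of_sq_eq hD hy hs hsq hx).inv this).congr_deriv ?_
    field_simp
  have d1 : ∀ x ∈ D, HasDerivAt ψ (-(s x)⁻¹ ^ 3 / 2 * h x + (s x)⁻¹ * deriv h x) x := fun x hx =>
    ((p1 x hx).mul (hh.hasDerivAt x)).congr_of_eventuallyEq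
      (eventually_of_mem (hD.mem_nhds hx) hψ)
  refine ⟨fun x hx => (d1 x hx).differentiableAt.differentiableWithinAt, fun x hx => ?_⟩
  have e1 : deriv ψ =ᶠ[𝓝 x] fun x => -(s x)⁻¹ ^ 3 / 2 * h x + (s x)⁻¹ * deriv h x :=
    eventually_of_mem (hD.mem_nhds hx) fun t ht => (d1 t ht).deriv
  have d2 := ((((((p1 x hx).pow 3).neg).div_const 2).mul (hh.hasDerivAt x)).add
    ((p1 x hx).mul (hh.hasDerivAt_deriv x)))
  have e2 : deriv (fun x => -(s x)⁻¹ ^ 3 / 2 * h x + (s x)⁻¹ * deriv h x) x = _ := d2.deriv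
  rw [e1.deriv_eq, e2, hψ x hx, Q_eq (ne_of_mem_of_not_mem hx hy), ← hsq x]
  have h0 := hs0 x hx
  have := hh.eq x
  rw [← hsq x] at this
  simp only [Pi.neg_apply, Pi.pow_apply, Nat.cast_ofNat, Nat.add_one_sub_one]
  field_simp
  linear_combination 16 * s x ^ 2 * this

/-- Conversely, every solution of the oscillator equation on a domain with a branch of
`(x - y) ^ (1/2)` comes from an entire solution. -/
theorem IsSolutionOn.exists_isEntireSol {D : Set ℂ} (hD : IsOpen D) (hD' : IsPreconnected D)
    (hy : y ∉ D) {s ψ : ℂ → ℂ} (hs : ContinuousOn s D) (hsq : ∀ x, s x ^ 2 = x - y)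
    (hψ : IsSolutionOn y y' z D ψ) :
    ∃ h, IsEntireSol y y' z h ∧ ∀ x ∈ D, ψ x = (s x)⁻¹ * h x := by
  have hs0 : ∀ x ∈ D, s x ≠ 0 := fun x hx => ne_zero_of_sq_eq hy hsq hx
  have s1 : ∀ x ∈ D, HasDerivAt s ((s x)⁻¹ / 2) x := fun x hx =>
    hasDerivAt_of_sq_eq hD hy hs hsq hx
  have ψ1 : ∀ x ∈ D, HasDerivAt ψ (deriv ψ x) x := fun x hx =>
    (hψ.1.differentiableAt (hD.mem_nhds hx)).hasDerivAt
  have ψ2 : ∀ x ∈ D, HasDerivAt (deriv ψ) (Q y y' z x * ψ x) x := fun x hx => by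
    rw [← hψ.2 x hx]
    exact ((hψ.1.deriv hD).differentiableAt (hD.mem_nhds hx)).hasDerivAt
  obtain ⟨h, hh, e⟩ := exists_isEntireSol_eqOn (y' := y') (z := z) hD hD' hy
    (fun x hx => (s1 x hx).mul (ψ1 x hx))
    (fun x hx => ((((s1 x hx).inv (hs0 x hx)).div_const 2).mul (ψ1 x hx)).add
      ((s1 x hx).mul (ψ2 x hx))) (fun x hx => by
      have h0 := hs0 x hx
      rw [Q_eq (ne_of_mem_of_not_mem hx hy), ← hsq x]
      simp only [Pi.mul_apply, Pi.inv_apply]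
      field_simp
      ring)
  refine ⟨h, hh, fun x hx => ?_⟩
  rw [← e x hx, Pi.mul_apply, inv_mul_cancel_left₀ (hs0 x hx)]

end

/-! ### Sectors in the logarithmic variable -/

section
variable {y y' z : ℂ}

theorem logAt_exp {n : ℤ} {l : ℂ} (hl : |l.im - angle n| < Real.pi) :
    logAt n (Complex.exp l) = l := by
  have h := abs_lt.1 hl
  have e : (l - Complex.I * angle n).im = l.im - angle n := by simp
  rw [logAt, ← Complex.exp_sub, Complex.log_exp (by rw [e]; exact h.1) (by rw [e]; exact h.2.le)]
  ring

theorem exp_mem_sector {n : ℤ} {θ : ℝ} (hθ : θ ≤ Real.pi) {l : ℂ} (hl : |l.im - angle n| < θ) :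
    Complex.exp l ∈ sector (n : ZMod 5) θ := by
  rw [mem_sector_iff, logAt_exp (hl.trans_le hθ)]
  exact ⟨Complex.exp_ne_zero l, hl⟩

theorem tendsto_exp_logSector (n : ℤ) {θ : ℝ} (hθ : θ ≤ Real.pi) :
    Tendsto Complex.exp (logSector (angle n) θ)
      (Bornology.cobounded ℂ ⊓ 𝓟 (sector (n : ZMod 5) θ)) := by
  refine tendsto_inf.2 ⟨?_, tendsto_principal.2 ?_⟩
  · rw [← tendsto_norm_atTop_iff_cobounded]
    simp only [Complex.norm_exp]
    exact Real.tendsto_exp_atTop.comp (tendsto_comap.mono_left inf_le_left)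
  · filter_upwards [mem_inf_of_right (mem_principal_self _)] with l hl
    exact exp_mem_sector hθ hl

theorem tendsto_sector_iff {n : ℤ} {θ : ℝ} (hθ : θ ≤ Real.pi) {Φ : ℂ → ℂ} {F : Filter ℂ} :
    Tendsto Φ (Bornology.cobounded ℂ ⊓ 𝓟 (sector (n : ZMod 5) θ)) F ↔
      Tendsto (fun l => Φ (Complex.exp l)) (logSector (angle n) θ) F := by
  refine ⟨fun h => h.comp (tendsto_exp_logSector n hθ), fun h => ?_⟩
  refine (h.comp (tendsto_logAt n θ)).congr' ?_
  filter_upwards [mem_inf_of_right (mem_principal_self _)] with x hx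
  rw [Function.comp_apply, exp_logAt n (mem_sector_iff.1 hx).1]

theorem convex_strip (γ ρ : ℝ) : Convex ℝ {l : ℂ | |l.im - γ| < ρ} := by
  have : {l : ℂ | |l.im - γ| < ρ} = Complex.imLm ⁻¹' Metric.ball γ ρ := by
    ext l; simp [Real.dist_eq]
  rw [this]
  exact (convex_ball γ ρ).linear_preimage _

theorem convex_halfStrip (γ ρ L : ℝ) : Convex ℝ {l : ℂ | |l.im - γ| < ρ ∧ L < l.re} := by
  have : {l : ℂ | |l.im - γ| < ρ ∧ L < l.re} =
      {l : ℂ | |l.im - γ| < ρ} ∩ Complex.reLm ⁻¹' Set.Ioi L := by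
    ext l; simp
  rw [this]
  exact (convex_strip γ ρ).inter ((convex_Ioi L).linear_preimage _)

/-- A branch of the fourth root on the cut plane, in the logarithmic variable. -/
theorem IsFourthRootBranch.exists_eq {n : ℤ} {q : ℂ → ℂ} (hq : IsFourthRootBranch (n : ZMod 5) q) :
    ∃ c : ℂ, c ^ 4 = 1 ∧ ∀ l : ℂ, |l.im - angle n| < Real.pi →
      q (Complex.exp l) = c * Complex.exp (l / 4) := by
  refine exists_eq_const_mul_of_pow_eq (convex_strip (angle n) Real.pi).isPreconnected (n := 4)
    (by norm_num) (f := fun l => q (Complex.exp l))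
    (hq.continuousOn.comp Complex.continuous_exp.continuousOn fun l hl => exp_mem_sector le_rfl hl)
    (by fun_prop) (fun l _ => Complex.exp_ne_zero _) fun l hl => ?_
  rw [hq.pow_eq _ (exp_mem_sector le_rfl hl), ← Complex.exp_nat_mul]
  congr 1; push_cast; ring

/-- The branch `(-1) ^ n exp (l / 2)` of the square root has a positive fifth power on the central
ray of the `n`-th sector. -/
theorem sgn_mul_exp_ray (n : ℤ) (t : ℝ) :
    sgn n * Complex.exp (5 * (Complex.I * angle n + t) / 2) = (Real.exp (5 / 2 * t) : ℝ) := by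
  have := sgn_sq n
  have e : Complex.exp (5 * (Complex.I * angle n + t) / 2) =
      sgn n * (Real.exp (5 / 2 * t) : ℝ) := by
    rw [sgn_eq_exp, Complex.ofReal_exp, ← Complex.exp_add, angle]
    congr 1; push_cast; ring
  rw [e]
  linear_combination (Real.exp (5 / 2 * t) : ℂ) * this

theorem mul_direction_eq (n : ℤ) {t : ℝ} (ht : 0 < t) :
    (t : ℂ) * direction (n : ZMod 5) = Complex.exp (Complex.I * angle n + (Real.log t : ℝ)) := by
  rw [direction_intCast, Complex.exp_add, ← Complex.ofReal_exp, Real.exp_log ht, mul_comm]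

theorem ray_im (n : ℤ) (t : ℝ) : (Complex.I * angle n + t : ℂ).im = angle n := by simp

/-- The branch of the square root attached to the `n`-th sector is `(-1) ^ n exp (l / 2)`. -/
theorem IsSqrtBranch.eq {n : ℤ} {r : ℂ → ℂ} (hr : IsSqrtBranch (n : ZMod 5) r) {l : ℂ}
    (hl : |l.im - angle n| < 3 * Real.pi / 5) :
    r (Complex.exp l) = sgn n * Complex.exp (l / 2) := by
  have hpi := Real.pi_pos
  have hθ : 3 * Real.pi / 5 ≤ Real.pi := by linarith
  obtain ⟨c, hc, e⟩ := exists_eq_const_mul_of_pow_eq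
    (convex_strip (angle n) (3 * Real.pi / 5)).isPreconnected (n := 2)
    (by norm_num) (f := fun l => r (Complex.exp l)) (g := fun l => Complex.exp (l / 2))
    (hr.continuousOn.comp Complex.continuous_exp.continuousOn fun l hl => exp_mem_sector hθ hl)
    (by fun_prop) (fun l _ => Complex.exp_ne_zero _) (fun l hl => by
      rw [hr.sq_eq _ (exp_mem_sector hθ hl), ← Complex.exp_nat_mul]
      congr 1; push_cast; ring)
  have hs := sgn_sq n
  have hcs : c = sgn n ∨ c = -sgn n := sq_eq_sq_iff_eq_or_eq_neg.1 (hc.trans hs.symm)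
  rcases hcs with rfl | rfl
  · exact e l hl
  exfalso
  obtain ⟨t, ht0, ht⟩ := ((eventually_gt_atTop (0 : ℝ)).and
    (hr.tendsto_re.eventually_gt_atTop 0)).exists
  have e1 := e (Complex.I * angle n + (Real.log t : ℝ)) (by
    have : |(Complex.I * angle n + (Real.log t : ℝ) : ℂ).im - angle n| < 3 * Real.pi / 5 := by
      rw [ray_im, sub_self, abs_zero]; positivity
    exact this)
  have e2 := sgn_mul_exp_ray n (Real.log t)
  have e3 : Complex.exp ((Complex.I * angle n + (Real.log t : ℝ)) / 2) ^ 5 =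
      Complex.exp (5 * (Complex.I * angle n + (Real.log t : ℝ)) / 2) := by
    rw [← Complex.exp_nat_mul]; congr 1; push_cast; ring
  have e4 : r (t * direction n) ^ 5 = ((-Real.exp (5 / 2 * Real.log t) : ℝ) : ℂ) := by
    rw [mul_direction_eq n ht0, e1, mul_pow, e3, Complex.ofReal_neg, ← e2]
    linear_combination (-sgn n * (sgn n ^ 2 + 1)
      * Complex.exp (5 * (Complex.I * angle n + (Real.log t : ℝ)) / 2)) * hs
  rw [e4, Complex.ofReal_re] at ht
  linarith [Real.exp_pos (5 / 2 * Real.log t)]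

theorem exists_isSqrtBranch (n : ℤ) : ∃ r, IsSqrtBranch (n : ZMod 5) r := by
  have hpi := Real.pi_pos
  refine ⟨fun x => sgn n * Complex.exp (logAt n x / 2), ?_, fun x hx => ?_, ?_⟩
  · have : ContinuousOn (logAt n) (sector (n : ZMod 5) (3 * Real.pi / 5)) := by
      refine ContinuousOn.add (ContinuousOn.clog (by fun_prop) fun x hx => ?_) continuousOn_const
      obtain ⟨h0, h1⟩ := mem_sector_iff.1 hx
      rw [logAt_im] at h1
      rw [Complex.mem_slitPlane_iff_arg]
      refine ⟨fun h2 => ?_, div_ne_zero h0 (Complex.exp_ne_zero _)⟩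
      rw [h2, abs_of_pos hpi] at h1
      linarith
    exact continuousOn_const.mul (this.div_const 2).cexp
  · show (sgn n * Complex.exp (logAt n x / 2)) ^ 2 = x
    rw [mul_pow, sgn_sq, one_mul, ← Complex.exp_nat_mul]
    conv_rhs => rw [← exp_logAt n (mem_sector_iff.1 hx).1]
    congr 1; push_cast; ring
  · have h : Tendsto (fun t : ℝ => Real.exp (5 / 2 * Real.log t)) atTop atTop :=
      Real.tendsto_exp_atTop.comp (Real.tendsto_log_atTop.const_mul_atTop (by norm_num))
    refine h.congr' ?_
    filter_upwards [eventually_gt_atTop 0] with t ht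
    rw [mul_direction_eq n ht, logAt_exp (by rw [ray_im, sub_self, abs_zero]; exact hpi),
      mul_pow, ← Complex.exp_nat_mul, show sgn n ^ 5 = sgn n * (sgn n ^ 2) ^ 2 by ring, sgn_sq,
      one_pow, mul_one, show (5 : ℕ) * ((Complex.I * angle n + (Real.log t : ℝ)) / 2) =
        5 * (Complex.I * angle n + (Real.log t : ℝ)) / 2 by push_cast; ring, sgn_mul_exp_ray,
      Complex.ofReal_re]

/-- On the cut plane, a branch `s` of `(x - y) ^ (1/2)` is asymptotic to a constant times
`exp (l / 2)`, with the same constant in all sectors. -/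
theorem IsCutPlane.exists_tendsto_sqrt {n : ℤ} {D : Set ℂ} (hD : IsCutPlane y (n : ZMod 5) D)
    {s : ℂ → ℂ} (hs : ContinuousOn s D) (hsq : ∀ x, s x ^ 2 = x - y) :
    ∃ c : ℂ, c ≠ 0 ∧ ∀ δ > 0, Tendsto (fun l => s (Complex.exp l) * Complex.exp (-(l / 2)))
      (logSector (angle n) (Real.pi - δ)) (𝓝 c) := by
  have hpi := Real.pi_pos
  -- the constant exists for each `δ`, by comparison with the branch `exp (log (1 - y / x) / 2)`
  have key : ∀ δ > 0, ∃ c : ℂ, c ≠ 0 ∧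
      Tendsto (fun l => s (Complex.exp l) * Complex.exp (-(l / 2)))
        (logSector (angle n) (Real.pi - δ)) (𝓝 c) := by
    intro δ hδ
    obtain ⟨R, hR⟩ : ∃ R : ℝ, ∀ x : ℂ, R < ‖x‖ → x ∈ sector (n : ZMod 5) (Real.pi - δ) → x ∈ D := by
      have h := hD.eventually_mem δ hδ
      rw [← comap_norm_atTop, eventually_comap] at h
      obtain ⟨R, hR⟩ := eventually_atTop.1 h
      exact ⟨R, fun x hx => hR _ hx.le x rfl⟩
    set L := max R ‖y‖ with hL
    set S := {l : ℂ | |l.im - angle n| < Real.pi - δ ∧ L < l.re} with hS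
    have hn : ∀ l ∈ S, L < ‖Complex.exp l‖ := fun l hl => by
      rw [Complex.norm_exp]
      linarith [hl.2, Real.add_one_le_exp l.re]
    have hSD : ∀ l ∈ S, Complex.exp l ∈ D := fun l hl =>
      hR _ ((le_max_left _ _).trans_lt (hn l hl)) (exp_mem_sector (by linarith) hl.1)
    have hslit : ∀ l ∈ S, 1 - y * Complex.exp (-l) ∈ Complex.slitPlane := fun l hl => by
      have h1 : ‖y * Complex.exp (-l)‖ < 1 := by
        rw [Complex.exp_neg, ← div_eq_mul_inv, norm_div,
          div_lt_one (norm_pos_iff.2 (Complex.exp_ne_zero l))]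
        exact (le_max_right _ _).trans_lt (hn l hl)
      left
      have := (Complex.re_le_norm (y * Complex.exp (-l))).trans_lt h1
      rw [Complex.sub_re, Complex.one_re]; linarith
    obtain ⟨c, hc, e⟩ := exists_eq_const_mul_of_pow_eq
      (convex_halfStrip (angle n) (Real.pi - δ) L).isPreconnected (n := 2)
      (by norm_num) (f := fun l => s (Complex.exp l) * Complex.exp (-(l / 2)))
      (g := fun l => Complex.exp (Complex.log (1 - y * Complex.exp (-l)) / 2))
      ((hs.comp Complex.continuous_exp.continuousOn hSD).mul (by fun_prop))
      (((ContinuousOn.clog (by fun_prop) hslit).div_const 2).cexp)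
      (fun l _ => Complex.exp_ne_zero _) (fun l hl => by
        rw [mul_pow, hsq, ← Complex.exp_nat_mul, ← Complex.exp_nat_mul,
          show ((2 : ℕ) : ℂ) * (Complex.log (1 - y * Complex.exp (-l)) / 2) =
            Complex.log (1 - y * Complex.exp (-l)) by push_cast; ring,
          Complex.exp_log (Complex.slitPlane_ne_zero (hslit l hl)),
          show ((2 : ℕ) : ℂ) * (-(l / 2)) = -l by push_cast; ring, sub_mul, ← Complex.exp_add,
          add_neg_cancel, Complex.exp_zero])
    refine ⟨c, fun h0 => by simp [h0] at hc, ?_⟩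
    have t1 : Tendsto (fun l => Complex.exp (-l)) (logSector (angle n) (Real.pi - δ)) (𝓝 0) := by
      rw [tendsto_zero_iff_norm_tendsto_zero]
      simp only [Complex.norm_exp, Complex.neg_re]
      exact Real.tendsto_exp_neg_atTop_nhds_zero.comp (tendsto_comap.mono_left inf_le_left)
    have t2 : Tendsto (fun w : ℂ => c * Complex.exp (Complex.log (1 - y * w) / 2)) (𝓝 0) (𝓝 c) := by
      have : ContinuousAt (fun w : ℂ => c * Complex.exp (Complex.log (1 - y * w) / 2)) 0 := by
        have : ContinuousAt (fun w : ℂ => Complex.log (1 - y * w)) 0 :=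
          ContinuousAt.clog (by fun_prop) (by simp)
        fun_prop
      simpa [ContinuousAt] using this
    refine (t2.comp t1).congr' ?_
    have : S ∈ logSector (angle n) (Real.pi - δ) := by
      refine inter_mem (mem_inf_of_right (mem_principal_self _)) (mem_inf_of_left ?_)
      exact tendsto_comap.eventually (eventually_gt_atTop L)
    filter_upwards [this] with l hl
    exact (e l hl).symm
  -- it does not depend on `δ`, because the sectors for different `δ` overlap
  obtain ⟨c, hc, t⟩ := key (Real.pi / 2) (by positivity)
  refine ⟨c, hc, fun δ hδ => ?_⟩
  obtain ⟨c', hc', t'⟩ := key (min δ (Real.pi / 2)) (lt_min hδ (by positivity))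
  have le : ∀ δ' ≥ min δ (Real.pi / 2), logSector (angle n) (Real.pi - δ') ≤
      logSector (angle n) (Real.pi - min δ (Real.pi / 2)) := fun δ' h =>
    logSector_mono (by rw [sub_self, abs_zero, zero_add]; linarith)
  have nb := logSector_neBot (γ := angle n) (ρ := Real.pi - Real.pi / 2) (by linarith)
  have : c' = c := tendsto_nhds_unique (t'.mono_left (le _ (min_le_right _ _))) t
  exact this ▸ t'.mono_left (le _ (min_le_left _ _))

end

/-! ### Stokes multipliers on a cut plane -/

section
variable {y y' z : ℂ}

theorem tendsto_mul_iff_of_tendsto_one {α : Type*} {F : Filter α} {m g : α → ℂ}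
    (hm : Tendsto m F (𝓝 1)) :
    Tendsto (fun l => m l * g l) F (𝓝 1) ↔ Tendsto g F (𝓝 1) := by
  refine ⟨fun h => ?_, fun h => by simpa using hm.mul h⟩
  have t := h.div hm one_ne_zero
  rw [div_one] at t
  refine t.congr' ?_
  filter_upwards [hm.eventually_ne one_ne_zero] with l hl
  rw [Pi.div_apply, mul_div_cancel_left₀ _ hl]

/-- Near infinity, the sectors adjacent to the `n`-th one fit in the plane cut opposite to it,
without changing the branch of the logarithm. -/
theorem logSector_le_cutPlane {n j : ℤ} (hj : |angle j - angle n| ≤ 2 * Real.pi / 5) (ε : ℝ) :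
    logSector (angle j) (3 * Real.pi / 5 - ε) ≤ logSector (angle n) (Real.pi - ε) :=
  logSector_mono (by linarith)

theorem IsCutPlane.eventually_exp_mem {n : ℤ} {D : Set ℂ} (hD : IsCutPlane y (n : ZMod 5) D)
    {δ : ℝ} (hδ : 0 < δ) : ∀ᶠ l in logSector (angle n) (Real.pi - δ), Complex.exp l ∈ D := by
  refine (tendsto_exp_logSector n (by linarith)).eventually ?_
  rw [eventually_inf_principal]
  exact hD.eventually_mem δ hδ

/-- The normalisation of subdominant solutions on the cut plane, expressed by the entire solution.
The constant `κ` collects the constants of the branches of `(x - y) ^ (1/2)` and `x ^ (1/4)`. -/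
theorem tendsto_one_iff_scaled {n j : ℤ} (hj : |angle j - angle n| ≤ 2 * Real.pi / 5) {D : Set ℂ}
    (hD : IsCutPlane y (n : ZMod 5) D) {s q r ψ h : ℂ → ℂ} {a c : ℂ} (hs0 : ∀ x ∈ D, s x ≠ 0)
    (ha : a ≠ 0) (hs : ∀ δ > 0, Tendsto (fun l => s (Complex.exp l) * Complex.exp (-(l / 2)))
      (logSector (angle n) (Real.pi - δ)) (𝓝 a)) (hc : c ≠ 0)
    (hq : ∀ l : ℂ, |l.im - angle n| < Real.pi → q (Complex.exp l) = c * Complex.exp (l / 4))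
    (hr : IsSqrtBranch (j : ZMod 5) r) (hψ : ∀ x ∈ D, ψ x = (s x)⁻¹ * h x) {ε : ℝ} (hε : 0 < ε) :
    Tendsto (fun x => ψ x / ((q x ^ 3)⁻¹ * Complex.exp (-(4 / 5) * r x ^ 5 + z * r x)))
      (Bornology.cobounded ℂ ⊓ 𝓟 (sector (j : ZMod 5) (3 * Real.pi / 5 - ε))) (𝓝 1) ↔
    Tendsto (fun l => Complex.exp (phase z (sgn j) l) * scaled (fun x => c ^ 3 / a * h x) l)
      (logSector (angle j) (3 * Real.pi / 5 - ε)) (𝓝 1) := by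
  have hpi := Real.pi_pos
  have hle := logSector_le_cutPlane hj ε
  rw [tendsto_sector_iff (by linarith)]
  have hm : Tendsto (fun l => a * (s (Complex.exp l) * Complex.exp (-(l / 2)))⁻¹)
      (logSector (angle j) (3 * Real.pi / 5 - ε)) (𝓝 1) := by
    have := (((hs ε hε).mono_left hle).inv₀ ha).const_mul a
    rwa [mul_inv_cancel₀ ha] at this
  refine Iff.trans ?_ (tendsto_mul_iff_of_tendsto_one hm)
  refine tendsto_congr' ?_
  have h1 := (hD.eventually_exp_mem hε).filter_mono hle
  have h2 : ∀ᶠ l : ℂ in logSector (angle n) (Real.pi - ε), |l.im - angle n| < Real.pi := by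
    filter_upwards [mem_inf_of_right (mem_principal_self _)] with l hl
    exact lt_trans (show |l.im - angle n| < Real.pi - ε from hl) (by linarith)
  have h3 : ∀ᶠ l : ℂ in logSector (angle j) (3 * Real.pi / 5 - ε),
      |l.im - angle j| < 3 * Real.pi / 5 := by
    filter_upwards [mem_inf_of_right (mem_principal_self _)] with l hl
    exact lt_trans (show |l.im - angle j| < 3 * Real.pi / 5 - ε from hl) (by linarith)
  filter_upwards [h1, h2.filter_mono hle, h3] with l hl1 hl2 hl3
  have e1 : -(4 / 5) * r (Complex.exp l) ^ 5 + z * r (Complex.exp l) = -phase z (sgn j) l := by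
    rw [hr.eq hl3, phase, mul_pow, ← Complex.exp_nat_mul,
      show sgn j ^ 5 = sgn j * (sgn j ^ 2) ^ 2 by ring, sgn_sq,
      show ((5 : ℕ) : ℂ) * (l / 2) = 5 * l / 2 by push_cast; ring]
    ring
  have e2 : Complex.exp (l / 4) ^ 3 = Complex.exp (l / 2) * Complex.exp (l / 4) := by
    rw [← Complex.exp_nat_mul, ← Complex.exp_add]; congr 1; push_cast; ring
  rw [e1, hψ _ hl1, hq l hl2, mul_pow, e2, scaled, Complex.exp_neg, Complex.exp_neg]
  have := hs0 _ hl1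
  have n1 := Complex.exp_ne_zero (l / 4)
  have n2 := Complex.exp_ne_zero (l / 2)
  have n3 := Complex.exp_ne_zero (phase z (sgn j) l)
  field_simp

/-- On the cut plane, the subdominant solutions of the three sectors around the `n`-th one are the
entire ones, multiplied by one and the same function. -/
theorem IsCutPlane.exists_isSubdominant_iff {n : ℤ} {D : Set ℂ} (hD : IsCutPlane y (n : ZMod 5) D)
    {q : ℂ → ℂ} (hq : IsFourthRootBranch (n : ZMod 5) q) :
    ∃ s : ℂ → ℂ, (∀ x ∈ D, s x ≠ 0) ∧ ∀ j : ℤ, |angle j - angle n| ≤ 2 * Real.pi / 5 →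
      ∀ ψ, IsSubdominant y y' z D q (j : ZMod 5) ψ ↔ ∀ x ∈ D, ψ x = s x * subdom y y' z j x := by
  have hxy : ∀ x ∈ D, x - y ≠ 0 := fun x hx => sub_ne_zero.2 (ne_of_mem_of_not_mem hx hD.notMem)
  obtain ⟨s, hs, hsq⟩ := Complex.exists_continuousOn_pow_eq hD.isSimplyConnected hD.isOpen
    (g := fun x => x - y) (by fun_prop) (fun ⟨x, hx, h0⟩ => hxy x hx h0) two_ne_zero
  have hs0 : ∀ x ∈ D, s x ≠ 0 := fun x hx => ne_zero_of_sq_eq hD.notMem hsq hx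
  obtain ⟨a, ha, hsa⟩ := hD.exists_tendsto_sqrt hs hsq
  obtain ⟨c, hc, hqc⟩ := hq.exists_eq
  have hc0 : c ≠ 0 := fun h0 => by simp [h0] at hc
  have hκ : c ^ 3 / a ≠ 0 := div_ne_zero (pow_ne_zero 3 hc0) ha
  refine ⟨fun x => (s x)⁻¹ * (c ^ 3 / a)⁻¹,
    fun x hx => mul_ne_zero (inv_ne_zero (hs0 x hx)) (inv_ne_zero hκ),
    fun j hj ψ => ⟨?_, fun h => ?_⟩⟩
  · rintro ⟨hψ, r, hr, ht⟩ x hx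
    obtain ⟨h, hh, e⟩ := hψ.exists_isEntireSol hD.isOpen
      hD.isSimplyConnected.isPathConnected.isConnected.isPreconnected hD.notMem hs hsq
    have e2 := IsRecessive.unique (subdom_isEntireSol j) (hh.const_mul (c ^ 3 / a))
      (subdom_isRecessive j) fun ε hε =>
        (tendsto_one_iff_scaled hj hD hs0 ha hsa hc0 hqc hr e hε).1 (ht ε hε)
    rw [e x hx, ← e2, mul_assoc, inv_mul_cancel_left₀ hκ]
  · obtain ⟨r, hr⟩ := exists_isSqrtBranch j
    have e : ∀ x ∈ D, ψ x = (s x)⁻¹ * ((c ^ 3 / a)⁻¹ * subdom y y' z j x) := fun x hx => by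
      rw [h x hx, mul_assoc]
    refine ⟨((subdom_isEntireSol j).const_mul _).isSolutionOn hD.isOpen hD.notMem hs hsq e, r, hr,
      fun ε hε => (tendsto_one_iff_scaled hj hD hs0 ha hsa hc0 hqc hr e hε).2 ?_⟩
    simp only [mul_inv_cancel_left₀ hκ]
    exact subdom_isRecessive j ε hε

/-- The common factor relating the two kinds of subdominant solutions cancels in the Stokes
relation, which therefore holds on the cut plane exactly when it holds for the entire solutions. -/
theorem IsCutPlane.isStokesMultiplier_iff {n : ℤ} {D : Set ℂ} (hD : IsCutPlane y (n : ZMod 5) D)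
    {q : ℂ → ℂ} (hq : IsFourthRootBranch (n : ZMod 5) q) {σ : ℂ} :
    IsStokesMultiplier y y' z D q (n : ZMod 5) σ ↔ σ = stokes y y' z n := by
  have hpi := Real.pi_pos
  obtain ⟨s, hs0, hs⟩ := hD.exists_isSubdominant_iff (y' := y') (z := z) hq
  have hm := hs (n - 1) (by
    have := angle_add_one (n - 1)
    rw [sub_add_cancel] at this
    rw [this, abs_le]; constructor <;> linarith)
  have h0 := hs n (by rw [sub_self, abs_zero]; positivity)
  have hp := hs (n + 1) (by rw [angle_add_one, abs_le]; constructor <;> linarith)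
  push_cast at hm hp
  simp only [IsStokesMultiplier, hm, h0, hp]
  constructor
  · rintro ⟨ψm, ψ, ψp, em, e0, ep, h⟩
    have t := subdom_isRecessive (y := y) (y' := y') (z := z) n (Real.pi / 10) (by positivity)
    have nb := logSector_neBot (γ := angle n) (ρ := 3 * Real.pi / 5 - Real.pi / 10) (by linarith)
    obtain ⟨l, hl, hlD⟩ := ((t.eventually_ne one_ne_zero).and
      ((hD.eventually_exp_mem (δ := Real.pi / 10) (by positivity)).filter_mono
        (logSector_le_cutPlane (by rw [sub_self, abs_zero]; positivity) _))).exists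
    have hne : subdom y y' z n (Complex.exp l) ≠ 0 :=
      right_ne_zero_of_mul (right_ne_zero_of_mul hl)
    have h1 := h _ hlD
    -- at a point where the `n`-th solution does not vanish, the relation determines `σ`
    rw [em _ hlD, e0 _ hlD, ep _ hlD, subdom_relation] at h1
    refine mul_right_cancel₀ (mul_ne_zero (hs0 _ hlD) hne) ?_
    linear_combination -h1
  · rintro rfl
    refine ⟨_, _, _, fun x _ => rfl, fun x _ => rfl, fun x _ => rfl, fun x _ => ?_⟩
    rw [subdom_relation]; ring

end

end CubicOscillator

end

theorem mainTheorem1 (y y' z : ℂ) (f : ℂ → ℂ)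
    (hf : CubicOscillator.IsSchwarzianSolution y y' z f) :
    ∃ w : ZMod 5 → OnePoint ℂ,
      (∀ k, CubicOscillator.IsAsymptoticValue f k (w k)) ∧
      (∀ k, w k ≠ w (k + 1)) ∧
      ∀ (k : ZMod 5) (D : Set ℂ) (q : ℂ → ℂ),
        CubicOscillator.IsCutPlane y k D → CubicOscillator.IsFourthRootBranch k q →
        ∀ σ : ℂ, CubicOscillator.IsStokesMultiplier y y' z D q k σ ↔
          σ = Complex.I *
            CubicOscillator.crossRatio (w (k + 1)) (w (k - 2)) (w (k - 1)) (w (k + 2)) := by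
  obtain ⟨g, h, hg, hh, hω, e⟩ := hf.exists_quotient
  have hk : ∀ k : ZMod 5, ∃ n : ℤ, (n : ZMod 5) = k := ZMod.intCast_surjective
  set w : ZMod 5 → OnePoint ℂ := fun k =>
    CubicOscillator.asymValue y y' z g h ((k.val : ℕ) : ℤ) with hw
  have hwn : ∀ n : ℤ, w (n : ZMod 5) = CubicOscillator.asymValue y y' z g h n :=
    CubicOscillator.asymValue_emod g h
  refine ⟨w, fun k => ?_, fun k => ?_, fun k D q hD hq σ => ?_⟩ <;> obtain ⟨n, rfl⟩ := hk k
  · rw [hwn]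
    exact CubicOscillator.isAsymptoticValue_asymValue hf.meromorphic hg hh hω e n
  · have e1 := hwn (n + 1)
    push_cast at e1
    rw [hwn, e1]
    exact CubicOscillator.asymValue_ne_succ hg hh hω n
  · have e1 := hwn (n + 1)
    have e2 := hwn (n - 2)
    have e3 := hwn (n - 1)
    have e4 := hwn (n + 2)
    push_cast at e1 e2 e3 e4
    rw [hD.isStokesMultiplier_iff hq, e1, e2, e3, e4,
      CubicOscillator.stokes_eq_crossRatio hg hh hω]
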